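/- **The Central Submonad Calculus (CSC).** Types over a set of ground types $G$: $A,B ::= G \mid 1 \mid A\to B \mid A\times B \mid \mathcal S A \mid \mathcal T A$. Terms over a set of constants $c$, up to $\alpha$-equivalence: $M,N ::= x \mid c \mid * \mid \lambda x^A.M \mid MN \mid \langle M,N\rangle \mid \pi_i M \mid \mathrm{ret}_{\mathcal X} M \mid \iota M \mid \mathrm{do}_{\mathcal X}\ x\leftarrow M;\ N$ with $\mathcal X\in\{\mathcal S,\mathcal T\}$. Every eliminator ($MN$, $\pi_iM$, $\iota M$, $\mathrm{do}$) carries, as a type annotation that is suppressed in writing, the types at which it is used. Besides the simply typed rules, the typing rules are: $M:A$ gives $\mathrm{ret}_{\mathcal X}M:\mathcal XA$; $M:\mathcal SA$ gives $\iota M:\mathcal TA$; $\Gamma\vdash M:\mathcal XA$ and $\Gamma,x:A\vdash N:\mathcal XB$ give $\Gamma\vdash \mathrm{do}_{\mathcal X}\,x\leftarrow M;N:\mathcal XB$; and a judgement stays derivable when its types are replaced by equal ones. A *CSC-theory* $\mathrm{Th}$ is given by ground types, constants with a type (well-formed in any context), a set of type equalities and a set of equalities $\Gamma\vdash M=N:A$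 between well-formed terms. Equality of types is the congruence generated by the given equalities. Equality of terms is the least congruence (type annotations being taken up to equality of types) that contains the given equalities, is closed under substitution, weakening and type conversion, contains $\beta\eta$ for $1,\times,\to$, and satisfies, for both $\mathcal X$, $\mathrm{do}_{\mathcal X}\,x\leftarrow \mathrm{ret}_{\mathcal X}M;N = N[M/x]$, $\ \mathrm{do}_{\mathcal X}\,x\leftarrow M;\mathrm{ret}_{\mathcal X}x=M$, $\ \mathrm{do}_{\mathcal X}\,y\leftarrow(\mathrm{do}_{\mathcal X}\,x\leftarrow M;N);P=\mathrm{do}_{\mathcal X}\,x\leftarrow M;\mathrm{do}_{\mathcal X}\,y\leftarrow N;P$ ($x$ not free in $P$), as well as $\iota\,\mathrm{ret}_{\mathcal S}M=\mathrm{ret}_{\mathcal T}M$, $\ \mathrm{do}_{\mathcal T}\,x\leftarrow\iota M;\iota N=\iota(\mathrm{do}_{\mathcal S}\,x\leftarrow M;N)$, $\ \iota M=\iota N\Rightarrow M=N$, and $\mathrm{do}_{\mathcal T}\,x\leftarrow\iota M;\mathrm{do}_{\mathcal T}\,y\leftarrow N;P=\mathrm{do}_{\mathcal T}\,y\leftarrow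 N;\mathrm{do}_{\mathcal T}\,x\leftarrow\iota M;P$ ($x$ not free in $N$, $y$ not free in $M$). A *CSC-translation* $V:\mathrm{Th}\to\mathrm{Th}'$ maps types to types and terms to terms, preserves all derivable judgements (typing, equality of types, equality of terms), fixes variables, and commutes with all type and term formers. A *transformation* $\alpha:V\Rightarrow V'$ is a family of terms $x:V(A)\vdash\alpha_A:V'(A)$ indexed by the types $A$ of $\mathrm{Th}$ such that $x:V(A)\vdash\alpha_B[V(f)/x]=V'(f)[\alpha_A/x]:V'(B)$ is derivable in $\mathrm{Th}'$ whenever $x:A\vdash f:B$ in $\mathrm{Th}$; $V\cong V'$ means that there are transformations $V\Rightarrow V'$ and $V'\Rightarrow V$ that are mutually inverse up to derivable equality. CSC-theories, translations and transformations (up to derivable equality) form the 2-category of CSC-theories. A *CSC-model* is a category $\mathbf C$ with chosen cartesian closed structure, a strong monad $\mathcal T=(\mathcal T,\eta,\mu,\tau)$, and a morphism of strong monads $\iota:\mathcal S\Rightarrow\mathcal T$ whose components are monomorphisms and which is central: $\mathrm{dst}_{X,Y}\circ(\iota_X\times\mathcal TY)=\mathrm{dst}'_{X,Y}\circ(\iota_X\times\mathcal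 TY)$ for all $X,Y$, where $\mathrm{dst}_{X,Y}=\mu\circ\mathcal T\tau_{X,Y}\circ\tau'_{X,\mathcal TY}$ and $\mathrm{dst}'_{X,Y}=\mu\circ\mathcal T\tau'_{X,Y}\circ\tau_{\mathcal TX,Y}$, with $\tau'$ the right strength obtained from $\tau$ by symmetry. A *CSC-model morphism* is a functor that strictly preserves the cartesian closed structure, the functor $\mathcal T$, the objects $\mathcal SX$, and $\iota,\eta,\mu,\tau$. CSC-models, CSC-model morphisms and natural transformations form the 2-category of CSC-models. The *syntactic model* $S(\mathrm{Th})$ has as objects the classes $[A]$ of types modulo equality of types and as morphisms $[A]\to[B]$ the classes of judgements $x:A\vdash f:B$ modulo derivable equality, with composition by substitution, the evident cartesian closed structure, and $\mathcal X[A]=[\mathcal XA]$, $\mathcal X[f]=[\mathrm{do}_{\mathcal X}\,x\leftarrow y;\mathrm{ret}_{\mathcal X}f]$, $\eta=[\mathrm{ret}_{\mathcal X}x]$, $\mu=[\mathrm{do}_{\mathcal X}\,y\leftarrow x;y]$, $\tau=[\mathrm{do}_{\mathcal X}\,y\leftarrow\pi_2x;\mathrm{ret}_{\mathcal X}\langle\pi_1x,y\rangle]$,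 $\iota=[\iota x]$. The *internal language* $L(\mathbf C)$ of a model has a ground type $A^*$ for every object $A$, interpreted as $[\![A^*]\!]=A$; a constant $c_f:A^*\to B^*$ for every morphism $f:A\to B$, interpreted as the transpose $1\to B^A$ of $f$; a type equality $A=B$ whenever $[\![A]\!]=[\![B]\!]$; and an equality $\Gamma\vdash M=N:A$ between well-formed terms whenever $[\![M]\!]=[\![N]\!]$. Here $[\![-]\!]$ is the standard interpretation in $\mathbf C$: $\mathrm{ret}_{\mathcal X}$ is composition with $\eta^{\mathcal X}$, $\iota$ is composition with $\iota$, and $[\![\mathrm{do}_{\mathcal X}\,x\leftarrow M;N]\!]=\mu^{\mathcal X}\circ\mathcal X[\![N]\!]\circ\tau^{\mathcal X}\circ\langle\mathrm{id},[\![M]\!]\rangle$. **Theorem.** 1. Every CSC-model $\mathbf C$ is equivalent to $S(L(\mathbf C))$ in the 2-category of CSC-models: there are CSC-model morphisms $F:\mathbf C\to SL(\mathbf C)$ and $G:SL(\mathbf C)\to\mathbf C$ with $F\circ G\cong\mathrm{id}$ and $\mathrm{id}\cong G\circ F$. 2. Every CSC-theory $\mathrm{Th}$ is equivalent to $L(S(\mathrm{Th}))$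 in the 2-category of CSC-theories: there are CSC-translations $V:\mathrm{Th}\to LS(\mathrm{Th})$ and $W:LS(\mathrm{Th})\to\mathrm{Th}$ with $V\circ W\cong\mathrm{id}$ and $\mathrm{id}\cong W\circ V$. -/

import Mathlib

open CategoryTheory MonoidalCategory CartesianMonoidalCategory

universe u v u₁ v₁ u₂ v₂

namespace CSC

/-! ### Syntax -/

/-- The two monads of the calculus: the ambient monad `T` and its central submonad `S`. -/
inductive Eff : Type
  | S
  | T

/-- Types over a set `G` of ground types; `mon Eff.S A` is `S A` and `mon Eff.T A` is `T A`. -/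
inductive Ty (G : Type u) : Type u
  | ground (g : G)
  | one
  | arr (A B : Ty G)
  | prod (A B : Ty G)
  | mon (e : Eff) (A : Ty G)

/-- Terms over ground types `G` and term constants `K`, up to `α`-equivalence (de Bruijn indices:
`lam A M` and `bind e A B M N` bind the variable `0` of `M`, respectively of `N`).
The eliminators carry the types they are used at:
`app A B M N` is `M N` for `M : A → B`, `fst A B M` and `snd A B M` are the projections from
`A × B`, `incl A M` is `ι M` for `M : S A`, and `bind e A B M N` is `do x ← M; N` for
`M : e A` and `N : e B`. -/
inductive Tm (G : Type u) (K : Type v) : Type (max u v)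
  | var (n : ℕ)
  | const (c : K)
  | star
  | lam (A : Ty G) (M : Tm G K)
  | app (A B : Ty G) (M N : Tm G K)
  | pair (M N : Tm G K)
  | fst (A B : Ty G) (M : Tm G K)
  | snd (A B : Ty G) (M : Tm G K)
  | ret (e : Eff) (M : Tm G K)
  | incl (A : Ty G) (M : Tm G K)
  | bind (e : Eff) (A B : Ty G) (M N : Tm G K)

namespace Tm

variable {G : Type u} {K : Type v}

/-- Lift a renaming under a binder. -/
def upr (ρ : ℕ → ℕ) : ℕ → ℕ
  | 0 => 0
  | n + 1 => ρ n + 1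

/-- Renaming of variables. -/
def ren : Tm G K → (ℕ → ℕ) → Tm G K
  | var n, ρ => var (ρ n)
  | const c, _ => const c
  | star, _ => star
  | lam A M, ρ => lam A (M.ren (upr ρ))
  | app A B M N, ρ => app A B (M.ren ρ) (N.ren ρ)
  | pair M N, ρ => pair (M.ren ρ) (N.ren ρ)
  | fst A B M, ρ => fst A B (M.ren ρ)
  | snd A B M, ρ => snd A B (M.ren ρ)
  | ret e M, ρ => ret e (M.ren ρ)
  | incl A M, ρ => incl A (M.ren ρ)
  | bind e A B M N, ρ => bind e A B (M.ren ρ) (N.ren (upr ρ))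

/-- Weakening by one variable. -/
abbrev wk (M : Tm G K) : Tm G K := M.ren Nat.succ

/-- Lift a substitution under a binder. -/
def up (σ : ℕ → Tm G K) : ℕ → Tm G K
  | 0 => var 0
  | n + 1 => (σ n).wk

/-- Simultaneous capture-avoiding substitution. -/
def subst : Tm G K → (ℕ → Tm G K) → Tm G K
  | var n, σ => σ n
  | const c, _ => const c
  | star, _ => star
  | lam A M, σ => lam A (M.subst (up σ))
  | app A B M N, σ => app A B (M.subst σ) (N.subst σ)
  | pair M N, σ => pair (M.subst σ) (N.subst σ)
  | fst A B M, σ => fst A B (M.subst σ)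
  | snd A B M, σ => snd A B (M.subst σ)
  | ret e M, σ => ret e (M.subst σ)
  | incl A M, σ => incl A (M.subst σ)
  | bind e A B M N, σ => bind e A B (M.subst σ) (N.subst (up σ))

/-- The substitution `[N/x]` for the last variable `x` of a context. -/
def substOne (N : Tm G K) : ℕ → Tm G K
  | 0 => N
  | n + 1 => var n

/-- Substitution `M[N/x]` for the last variable `x`. -/
abbrev inst (M N : Tm G K) : Tm G K := M.subst (substOne N)

/-- Substitution `M[N/x]` in a term whose only variable is `x`. -/
abbrev plug (M N : Tm G K) : Tm G K := M.subst (fun _ => N)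

/-- Exchange of the last two variables. -/
def swap : ℕ → ℕ
  | 0 => 1
  | 1 => 0
  | n + 2 => n + 2

lemma ren_eq_subst (M : Tm G K) (ρ : ℕ → ℕ) : M.ren ρ = M.subst (fun n => var (ρ n)) := by
  have hup : ∀ ρ : ℕ → ℕ, (up fun n => (var (ρ n) : Tm G K)) = fun n => var (upr ρ n) := by
    intro ρ; funext n; cases n <;> rfl
  induction M generalizing ρ <;> simp_all [ren, subst]

lemma subst_var (M : Tm G K) : M.subst var = M := by
  have hup : up (var : ℕ → Tm G K) = var := by
    funext n; cases n <;> rfl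
  induction M <;> simp_all [subst]

lemma ren_subst (M : Tm G K) (ρ : ℕ → ℕ) (σ : ℕ → Tm G K) :
    (M.ren ρ).subst σ = M.subst (fun n => σ (ρ n)) := by
  have hup : ∀ (ρ : ℕ → ℕ) (σ : ℕ → Tm G K),
      (fun n => up σ (upr ρ n)) = up (fun n => σ (ρ n)) := by
    intro ρ σ; funext n; cases n <;> rfl
  induction M generalizing ρ σ <;> simp_all [ren, subst]

lemma ren_ren (M : Tm G K) (ρ τ : ℕ → ℕ) : (M.ren ρ).ren τ = M.ren (fun n => τ (ρ n)) := by
  rw [ren_eq_subst _ τ, ren_subst, ren_eq_subst]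

lemma subst_ren (M : Tm G K) (σ : ℕ → Tm G K) (ρ : ℕ → ℕ) :
    (M.subst σ).ren ρ = M.subst (fun n => (σ n).ren ρ) := by
  have hup : ∀ (ρ : ℕ → ℕ) (σ : ℕ → Tm G K),
      (fun n => (up σ n).ren (upr ρ)) = up (fun n => (σ n).ren ρ) := by
    intro ρ σ; funext n; cases n with
    | zero => rfl
    | succ n => simp only [up, wk, ren_ren]; rfl
  induction M generalizing ρ σ <;> simp_all [ren, subst]

lemma subst_subst (M : Tm G K) (σ τ : ℕ → Tm G K) :
    (M.subst σ).subst τ = M.subst (fun n => (σ n).subst τ) := by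
  have hup : ∀ σ τ : ℕ → Tm G K,
      (fun n => (up σ n).subst (up τ)) = up (fun n => (σ n).subst τ) := by
    intro σ τ; funext n; cases n with
    | zero => rfl
    | succ n => simp only [up, wk, ren_subst, subst_ren]
  induction M generalizing σ τ <;> simp_all [subst]

end Tm

/-- The signature of a theory: ground types, term constants with their types, and axioms for
equality of types. -/
structure Signature where
  Ground : Type u
  Const : Type v
  constTy : Const → Ty Ground
  tyAx : Ty Ground → Ty Ground → Prop

namespace Signature

/-- Types of the theory. -/
abbrev Typ (sg : Signature.{u, v}) := Ty sg.Ground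

/-- (Raw) terms of the theory. -/
abbrev Term (sg : Signature.{u, v}) := Tm sg.Ground sg.Const

variable (sg : Signature.{u, v})

/-- The judgement `⊢ A = B : type`. -/
inductive TyEq : sg.Typ → sg.Typ → Prop
  | ax {A B} : sg.tyAx A B → TyEq A B
  | refl (A) : TyEq A A
  | symm {A B} : TyEq A B → TyEq B A
  | trans {A B C} : TyEq A B → TyEq B C → TyEq A C
  | prod {A A' B B'} : TyEq A A' → TyEq B B' → TyEq (.prod A B) (.prod A' B')
  | arr {A A' B B'} : TyEq A A' → TyEq B B' → TyEq (.arr A B) (.arr A' B')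
  | mon (e : Eff) {A B} : TyEq A B → TyEq (.mon e A) (.mon e B)

/-- The judgement `Γ ⊢ M : A`. Contexts are lists of types, the last variable first.
Conversion of the types of variables is derivable from `conv`. -/
inductive HasTy : List sg.Typ → sg.Term → sg.Typ → Prop
  | var {Γ n A} : Γ[n]? = some A → HasTy Γ (.var n) A
  | const {Γ} (c) : HasTy Γ (.const c) (sg.constTy c)
  | star {Γ} : HasTy Γ .star .one
  | lam {Γ A B M} : HasTy (A :: Γ) M B → HasTy Γ (.lam A M) (.arr A B)
  | app {Γ A B M N} : HasTy Γ M (.arr A B) → HasTy Γ N A → HasTy Γ (.app A B M N) B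
  | pair {Γ A B M N} : HasTy Γ M A → HasTy Γ N B → HasTy Γ (.pair M N) (.prod A B)
  | fst {Γ A B M} : HasTy Γ M (.prod A B) → HasTy Γ (.fst A B M) A
  | snd {Γ A B M} : HasTy Γ M (.prod A B) → HasTy Γ (.snd A B M) B
  | ret {Γ e A M} : HasTy Γ M A → HasTy Γ (.ret e M) (.mon e A)
  | incl {Γ A M} : HasTy Γ M (.mon .S A) → HasTy Γ (.incl A M) (.mon .T A)
  | bind {Γ e A B M N} : HasTy Γ M (.mon e A) → HasTy (A :: Γ) N (.mon e B) →
      HasTy Γ (.bind e A B M N) (.mon e B)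
  | conv {Γ M A B} : HasTy Γ M A → sg.TyEq A B → HasTy Γ M B

/-- `σ` is a substitution from the context `Γ` to the context `Δ`. -/
def IsSubst (Δ Γ : List sg.Typ) (σ : ℕ → sg.Term) : Prop :=
  ∀ n A, Γ[n]? = some A → sg.HasTy Δ (σ n) A

end Signature

/-- A CSC-theory: ground types, term constants, type equalities and equalities between well-formed
terms. -/
structure Theory extends Signature.{u, v} where
  tmAx : List toSignature.Typ → toSignature.Term → toSignature.Term → toSignature.Typ → Prop
  tmAx_left : ∀ {Γ M N A}, tmAx Γ M N A → toSignature.HasTy Γ M A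
  tmAx_right : ∀ {Γ M N A}, tmAx Γ M N A → toSignature.HasTy Γ N A

namespace Theory

open Tm

variable (Th : Theory.{u, v})

/-- The judgement `Γ ⊢ M = N : A`. The rule `subst` is stated for simultaneous substitutions, so
that it also contains weakening, permutation of the context and conversion of the types of
variables. In the congruence rules the type annotations may vary up to equality of types. -/
inductive TmEq : List Th.Typ → Th.Term → Th.Term → Th.Typ → Prop
  | ax {Γ M N A} : Th.tmAx Γ M N A → TmEq Γ M N A
  | refl {Γ M A} : Th.HasTy Γ M A → TmEq Γ M M A
  | symm {Γ M N A} : TmEq Γ M N A → TmEq Γ N M A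
  | trans {Γ M N P A} : TmEq Γ M N A → TmEq Γ N P A → TmEq Γ M P A
  | conv {Γ M N A B} : TmEq Γ M N A → Th.TyEq A B → TmEq Γ M N B
  | subst {Γ Δ M N A σ} : TmEq Γ M N A → Th.IsSubst Δ Γ σ →
      TmEq Δ (M.subst σ) (N.subst σ) A
  | one_eta {Γ M} : Th.HasTy Γ M .one → TmEq Γ .star M .one
  | pair_eq {Γ M M' N N' A B} : TmEq Γ M M' A → TmEq Γ N N' B →
      TmEq Γ (.pair M N) (.pair M' N') (.prod A B)
  | fst_eq {Γ M M' A A' B B'} : Th.TyEq A A' → Th.TyEq B B' → TmEq Γ M M' (.prod A B) →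
      TmEq Γ (.fst A B M) (.fst A' B' M') A
  | snd_eq {Γ M M' A A' B B'} : Th.TyEq A A' → Th.TyEq B B' → TmEq Γ M M' (.prod A B) →
      TmEq Γ (.snd A B M) (.snd A' B' M') B
  | fst_beta {Γ M N A B} : Th.HasTy Γ M A → Th.HasTy Γ N B →
      TmEq Γ (.fst A B (.pair M N)) M A
  | snd_beta {Γ M N A B} : Th.HasTy Γ M A → Th.HasTy Γ N B →
      TmEq Γ (.snd A B (.pair M N)) N B
  | prod_eta {Γ M A B} : Th.HasTy Γ M (.prod A B) →
      TmEq Γ (.pair (.fst A B M) (.snd A B M)) M (.prod A B)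
  | app_eq {Γ M M' N N' A A' B B'} : Th.TyEq A A' → Th.TyEq B B' →
      TmEq Γ M M' (.arr A B) → TmEq Γ N N' A →
      TmEq Γ (.app A B M N) (.app A' B' M' N') B
  | lam_eq {Γ M M' A A' B} : Th.TyEq A A' → TmEq (A :: Γ) M M' B →
      TmEq Γ (.lam A M) (.lam A' M') (.arr A B)
  | lam_beta {Γ M N A B} : Th.HasTy (A :: Γ) M B → Th.HasTy Γ N A →
      TmEq Γ (.app A B (.lam A M) N) (M.inst N) B
  | lam_eta {Γ M A B} : Th.HasTy Γ M (.arr A B) →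
      TmEq Γ (.lam A (.app A B M.wk (.var 0))) M (.arr A B)
  | ret_eq {Γ e M M' A} : TmEq Γ M M' A → TmEq Γ (.ret e M) (.ret e M') (.mon e A)
  | bind_eq {Γ e M M' N N' A A' B B'} : Th.TyEq A A' → Th.TyEq B B' →
      TmEq Γ M M' (.mon e A) → TmEq (A :: Γ) N N' (.mon e B) →
      TmEq Γ (.bind e A B M N) (.bind e A' B' M' N') (.mon e B)
  | mon_beta {Γ e M N A B} : Th.HasTy Γ M A → Th.HasTy (A :: Γ) N (.mon e B) →
      TmEq Γ (.bind e A B (.ret e M) N) (N.inst M) (.mon e B)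
  | mon_eta {Γ e M A} : Th.HasTy Γ M (.mon e A) →
      TmEq Γ (.bind e A A M (.ret e (.var 0))) M (.mon e A)
  | mon_assoc {Γ e M N P A B C} : Th.HasTy Γ M (.mon e A) →
      Th.HasTy (A :: Γ) N (.mon e B) → Th.HasTy (B :: Γ) P (.mon e C) →
      TmEq Γ (.bind e B C (.bind e A B M N) P)
        (.bind e A C M (.bind e B C N (P.ren (upr Nat.succ)))) (.mon e C)
  | central {Γ M N P A B C} : Th.HasTy Γ M (.mon .S A) → Th.HasTy Γ N (.mon .T B) →
      Th.HasTy (B :: A :: Γ) P (.mon .T C) →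
      TmEq Γ (.bind .T A C (.incl A M) (.bind .T B C N.wk P))
        (.bind .T B C N (.bind .T A C (.incl A M.wk) (P.ren swap))) (.mon .T C)
  | incl_eq {Γ M M' A A'} : Th.TyEq A A' → TmEq Γ M M' (.mon .S A) →
      TmEq Γ (.incl A M) (.incl A' M') (.mon .T A)
  | incl_mono {Γ M M' A} : Th.HasTy Γ M (.mon .S A) → Th.HasTy Γ M' (.mon .S A) →
      TmEq Γ (.incl A M) (.incl A M') (.mon .T A) → TmEq Γ M M' (.mon .S A)
  | incl_ret {Γ M A} : Th.HasTy Γ M A →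
      TmEq Γ (.incl A (.ret .S M)) (.ret .T M) (.mon .T A)
  | incl_comp {Γ M N A B} : Th.HasTy Γ M (.mon .S A) → Th.HasTy (A :: Γ) N (.mon .S B) →
      TmEq Γ (.bind .T A B (.incl A M) (.incl B N)) (.incl B (.bind .S A B M N)) (.mon .T B)

end Theory

namespace Signature

open Tm

variable {sg : Signature.{u, v}}

lemma HasTy.ren {Γ M A} (h : sg.HasTy Γ M A) : ∀ {Δ : List sg.Typ} {ρ : ℕ → ℕ},
    (∀ n B, Γ[n]? = some B → Δ[ρ n]? = some B) → sg.HasTy Δ (M.ren ρ) A := by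
  have hup : ∀ {Γ Δ : List sg.Typ} {ρ : ℕ → ℕ} {C : sg.Typ},
      (∀ n B, Γ[n]? = some B → Δ[ρ n]? = some B) →
      ∀ n B, (C :: Γ)[n]? = some B → (C :: Δ)[upr ρ n]? = some B := by
    intro Γ Δ ρ C h n B hn
    cases n with
    | zero => simpa [upr] using hn
    | succ n => simpa [upr] using h n B (by simpa using hn)
  induction h with
  | var hn => intro Δ ρ hρ; exact .var (hρ _ _ hn)
  | const c => intros; exact .const c
  | star => intros; exact .star
  | lam _ ih => intro Δ ρ hρ; exact .lam (ih (hup hρ))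
  | app _ _ ih₁ ih₂ => intro Δ ρ hρ; exact .app (ih₁ hρ) (ih₂ hρ)
  | pair _ _ ih₁ ih₂ => intro Δ ρ hρ; exact .pair (ih₁ hρ) (ih₂ hρ)
  | fst _ ih => intro Δ ρ hρ; exact .fst (ih hρ)
  | snd _ ih => intro Δ ρ hρ; exact .snd (ih hρ)
  | ret _ ih => intro Δ ρ hρ; exact .ret (ih hρ)
  | incl _ ih => intro Δ ρ hρ; exact .incl (ih hρ)
  | bind _ _ ih₁ ih₂ => intro Δ ρ hρ; exact .bind (ih₁ hρ) (ih₂ (hup hρ))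
  | conv _ he ih => intro Δ ρ hρ; exact .conv (ih hρ) he

lemma HasTy.wk {Γ M A} (B : sg.Typ) (h : sg.HasTy Γ M A) : sg.HasTy (B :: Γ) M.wk A :=
  h.ren (by intro n C hn; simpa using hn)

lemma IsSubst.up {Δ Γ σ} (h : sg.IsSubst Δ Γ σ) (A : sg.Typ) :
    sg.IsSubst (A :: Δ) (A :: Γ) (Tm.up σ) := by
  intro n B hn
  cases n with
  | zero => exact .var hn
  | succ n => exact (h n B (by simpa using hn)).wk A

lemma HasTy.subst {Γ M A} (h : sg.HasTy Γ M A) : ∀ {Δ σ}, sg.IsSubst Δ Γ σ →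
    sg.HasTy Δ (M.subst σ) A := by
  induction h with
  | var hn => intro Δ σ hσ; exact hσ _ _ hn
  | const c => intros; exact .const c
  | star => intros; exact .star
  | lam _ ih => intro Δ σ hσ; exact .lam (ih (hσ.up _))
  | app _ _ ih₁ ih₂ => intro Δ σ hσ; exact .app (ih₁ hσ) (ih₂ hσ)
  | pair _ _ ih₁ ih₂ => intro Δ σ hσ; exact .pair (ih₁ hσ) (ih₂ hσ)
  | fst _ ih => intro Δ σ hσ; exact .fst (ih hσ)
  | snd _ ih => intro Δ σ hσ; exact .snd (ih hσ)
  | ret _ ih => intro Δ σ hσ; exact .ret (ih hσ)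
  | incl _ ih => intro Δ σ hσ; exact .incl (ih hσ)
  | bind _ _ ih₁ ih₂ => intro Δ σ hσ; exact .bind (ih₁ hσ) (ih₂ (hσ.up _))
  | conv _ he ih => intro Δ σ hσ; exact .conv (ih hσ) he

/-- Substitutions that agree on the variables of the context act equally on well-formed terms. -/
lemma HasTy.subst_congr {Γ M A} (h : sg.HasTy Γ M A) : ∀ {σ τ : ℕ → sg.Term},
    (∀ n < Γ.length, σ n = τ n) → M.subst σ = M.subst τ := by
  have hup : ∀ {Γ : List sg.Typ} {C : sg.Typ} {σ τ : ℕ → sg.Term},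
      (∀ n < Γ.length, σ n = τ n) → ∀ n < (C :: Γ).length, Tm.up σ n = Tm.up τ n := by
    intro Γ C σ τ h n hn
    cases n with
    | zero => rfl
    | succ n => simp only [Tm.up, h n (by simpa using hn)]
  induction h with
  | var hn => intro σ τ hσ; exact hσ _ (List.getElem?_eq_some_iff.1 hn).1
  | const c => intros; rfl
  | star => intros; rfl
  | lam _ ih => intro σ τ hσ; simp only [Tm.subst, ih (hup hσ)]
  | app _ _ ih₁ ih₂ => intro σ τ hσ; simp only [Tm.subst, ih₁ hσ, ih₂ hσ]
  | pair _ _ ih₁ ih₂ => intro σ τ hσ; simp only [Tm.subst, ih₁ hσ, ih₂ hσ]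
  | fst _ ih => intro σ τ hσ; simp only [Tm.subst, ih hσ]
  | snd _ ih => intro σ τ hσ; simp only [Tm.subst, ih hσ]
  | ret _ ih => intro σ τ hσ; simp only [Tm.subst, ih hσ]
  | incl _ ih => intro σ τ hσ; simp only [Tm.subst, ih hσ]
  | bind _ _ ih₁ ih₂ => intro σ τ hσ; simp only [Tm.subst, ih₁ hσ, ih₂ (hup hσ)]
  | conv _ he ih => intro σ τ hσ; exact ih hσ

lemma isSubst_substOne {Γ : List sg.Typ} {A N} (h : sg.HasTy Γ N A) :
    sg.IsSubst Γ (A :: Γ) (Tm.substOne N) := by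
  intro n B hn
  cases n with
  | zero =>
    obtain rfl : A = B := by simpa using hn
    exact h
  | succ n => exact .var (by simpa using hn)

lemma isSubst_plug {Γ : List sg.Typ} {A N} (h : sg.HasTy Γ N A) :
    sg.IsSubst Γ [A] (fun _ => N) := by
  intro n B hn
  cases n with
  | zero =>
    obtain rfl : A = B := by simpa using hn
    exact h
  | succ n => simp at hn

lemma HasTy.plug {Γ : List sg.Typ} {A B M N} (h : sg.HasTy [A] M B) (hN : sg.HasTy Γ N A) :
    sg.HasTy Γ (M.plug N) B :=
  h.subst (isSubst_plug hN)

lemma HasTy.plug_var {A B : sg.Typ} {M} (h : sg.HasTy [A] M B) : M.plug (.var 0) = M := by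
  conv_rhs => rw [← M.subst_var]
  exact h.subst_congr (by intro n hn; obtain rfl : n = 0 := by simpa using hn
                          rfl)

/-- A term with one variable is well-formed in every larger context, and in every context with
equal types. -/
lemma HasTy.single {A A' B B' : sg.Typ} {M} (h : sg.HasTy [A] M B) (hA : sg.TyEq A A')
    (hB : sg.TyEq B B') (Γ : List sg.Typ) : sg.HasTy (A' :: Γ) M B' := by
  have := (h.plug (Γ := A' :: Γ) (N := .var 0) (.conv (.var rfl) hA.symm)).conv hB
  rwa [h.plug_var] at this

end Signature

namespace Theory

open Tm Signature

variable {Th : Theory.{u, v}}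

/-- Substituting equal terms for the only variable of a term gives equal terms. -/
lemma TmEq.plug {Γ : List Th.Typ} {A B M N N'} (h : Th.HasTy [A] M B) (hN : Th.HasTy Γ N A)
    (hN' : Th.HasTy Γ N' A) (e : Th.TmEq Γ N N' A) : Th.TmEq Γ (M.plug N) (M.plug N') B := by
  have hM := h.single (.refl _) (.refl _) Γ
  have key : ∀ P, M.inst P = M.plug P := fun P =>
    h.subst_congr (by intro n hn; obtain rfl : n = 0 := by simpa using hn
                      rfl)
  rw [← key, ← key]
  exact ((TmEq.lam_beta hM hN).symm.trans
    (.app_eq (.refl _) (.refl _) (.refl (.lam hM)) e)).trans (.lam_beta hM hN')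

lemma TmEq.single {A A' B B' : Th.Typ} {M N} (h : Th.TmEq [A] M N B) (hM : Th.HasTy [A] M B)
    (hN : Th.HasTy [A] N B) (hA : Th.TyEq A A')
    (hB : Th.TyEq B B') (Γ : List Th.Typ) : Th.TmEq (A' :: Γ) M N B' := by
  have := (TmEq.subst h (isSubst_plug (Γ := A' :: Γ) (N := .var 0)
    (.conv (.var rfl) hA.symm))).conv hB
  rwa [show M.subst _ = M from hM.plug_var, show N.subst _ = N from hN.plug_var] at this

end Theory

/-! ### Categorical models -/

/-- A strong monad on a monoidal category: a monad with a (left) strength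
`τ_{X,Y} : X ⊗ T Y ⟶ T (X ⊗ Y)`. -/
structure StrongMonad (C : Type u) [Category.{v} C] [MonoidalCategory C] extends Monad C where
  τ (X Y : C) : X ⊗ obj Y ⟶ obj (X ⊗ Y)
  τ_naturality {X X' Y Y' : C} (f : X ⟶ X') (g : Y ⟶ Y') :
    (f ⊗ₘ map g) ≫ τ X' Y' = τ X Y ≫ map (f ⊗ₘ g)
  τ_unit (X : C) : τ (𝟙_ C) X ≫ map (λ_ X).hom = (λ_ (obj X)).hom
  τ_assoc (X Y Z : C) :
    τ (X ⊗ Y) Z ≫ map (α_ X Y Z).hom = (α_ X Y (obj Z)).hom ≫ X ◁ τ Y Z ≫ τ X (Y ⊗ Z)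
  τ_η (X Y : C) : X ◁ η.app Y ≫ τ X Y = η.app (X ⊗ Y)
  τ_μ (X Y : C) : X ◁ μ.app Y ≫ τ X Y = τ X (obj Y) ≫ map (τ X Y) ≫ μ.app (X ⊗ Y)

/-- A morphism of strong monads: a morphism of monads that commutes with the strengths. -/
structure StrongMonadHom {C : Type u} [Category.{v} C] [MonoidalCategory C]
    (P Q : StrongMonad C) extends MonadHom P.toMonad Q.toMonad where
  app_τ (X Y : C) : P.τ X Y ≫ app (X ⊗ Y) = X ◁ app Y ≫ Q.τ X Y

section Cartesian

variable {C : Type u} [Category.{v} C] [CartesianMonoidalCategory C]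

/-- The symmetry of the cartesian product. -/
def swapHom (X Y : C) : X ⊗ Y ⟶ Y ⊗ X := lift (snd X Y) (fst X Y)

namespace StrongMonad

variable (P : StrongMonad C)

/-- The right strength `T X ⊗ Y ⟶ T (X ⊗ Y)`. -/
def τ' (X Y : C) : P.obj X ⊗ Y ⟶ P.obj (X ⊗ Y) :=
  swapHom (P.obj X) Y ≫ P.τ Y X ≫ P.map (swapHom Y X)

/-- The double strength `T X ⊗ T Y ⟶ T (X ⊗ Y)` that performs the left effect first. -/
def dst (X Y : C) : P.obj X ⊗ P.obj Y ⟶ P.obj (X ⊗ Y) :=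
  P.τ' X (P.obj Y) ≫ P.map (P.τ X Y) ≫ P.μ.app (X ⊗ Y)

/-- The double strength `T X ⊗ T Y ⟶ T (X ⊗ Y)` that performs the right effect first. -/
def dst' (X Y : C) : P.obj X ⊗ P.obj Y ⟶ P.obj (X ⊗ Y) :=
  P.τ (P.obj X) Y ≫ P.map (P.τ' X Y) ≫ P.μ.app (X ⊗ Y)

/-- `(Z, f)` is a central cone of `P` at `X`. -/
def IsCentralCone {X Z : C} (f : Z ⟶ P.obj X) : Prop :=
  ∀ Y : C, (f ▷ P.obj Y) ≫ P.dst X Y = (f ▷ P.obj Y) ≫ P.dst' X Y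

end StrongMonad

end Cartesian

/-- A CSC-model: a cartesian closed category (with chosen structure) with a strong monad `T` and a
central submonad `ι : S ⟶ T`. -/
structure Model where
  Obj : Type u
  [category : Category.{v} Obj]
  [cartesian : CartesianMonoidalCategory Obj]
  [closed : MonoidalClosed Obj]
  T : StrongMonad Obj
  S : StrongMonad Obj
  ι : StrongMonadHom S T
  mono (X : Obj) : Mono (ι.app X)
  central (X : Obj) : T.IsCentralCone (ι.app X)

attribute [instance] Model.category Model.cartesian Model.closed

/-- The monad of a model that is named by `e`. -/
def Model.monad (C : Model.{u, v}) : Eff → StrongMonad C.Obj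
  | .S => C.S
  | .T => C.T

/-- A CSC-model morphism: a functor that strictly preserves the cartesian closed structure, the
monad `T`, the objects `S X` and the inclusion `ι`. (As `ι` is a monomorphism, it then preserves
the rest of the structure of `S`.) -/
structure ModelHom (C : Model.{u₁, v₁}) (D : Model.{u₂, v₂}) extends C.Obj ⥤ D.Obj where
  obj_unit : obj (𝟙_ C.Obj) = 𝟙_ D.Obj
  obj_prod (X Y : C.Obj) : obj (X ⊗ Y) = obj X ⊗ obj Y
  map_fst (X Y : C.Obj) : map (fst X Y) = eqToHom (obj_prod X Y) ≫ fst (obj X) (obj Y)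
  map_snd (X Y : C.Obj) : map (snd X Y) = eqToHom (obj_prod X Y) ≫ snd (obj X) (obj Y)
  obj_exp (X Y : C.Obj) : obj ((ihom X).obj Y) = (ihom (obj X)).obj (obj Y)
  map_ev (X Y : C.Obj) : map ((ihom.ev X).app Y) =
    eqToHom ((obj_prod X ((ihom X).obj Y)).trans (congrArg (obj X ⊗ ·) (obj_exp X Y))) ≫
      (ihom.ev (obj X)).app (obj Y)
  obj_T (X : C.Obj) : obj (C.T.obj X) = D.T.obj (obj X)
  obj_S (X : C.Obj) : obj (C.S.obj X) = D.S.obj (obj X)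
  map_T {X Y : C.Obj} (f : X ⟶ Y) :
    map (C.T.map f) = eqToHom (obj_T X) ≫ D.T.map (map f) ≫ eqToHom (obj_T Y).symm
  map_ι (X : C.Obj) :
    map (C.ι.app X) = eqToHom (obj_S X) ≫ D.ι.app (obj X) ≫ eqToHom (obj_T X).symm
  map_η (X : C.Obj) : map (C.T.η.app X) = D.T.η.app (obj X) ≫ eqToHom (obj_T X).symm
  map_μ (X : C.Obj) : map (C.T.μ.app X) =
    eqToHom ((obj_T (C.T.obj X)).trans (congrArg D.T.obj (obj_T X))) ≫
      D.T.μ.app (obj X) ≫ eqToHom (obj_T X).symm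
  map_τ (X Y : C.Obj) : map (C.T.τ X Y) =
    eqToHom ((obj_prod X (C.T.obj Y)).trans (congrArg (obj X ⊗ ·) (obj_T Y))) ≫
      D.T.τ (obj X) (obj Y) ≫
      eqToHom ((obj_T (X ⊗ Y)).trans (congrArg D.T.obj (obj_prod X Y))).symm

/-! ### Semantic interpretation and internal language -/

section Interpretation

variable (C : Model.{u₁, v₁})

/-- Interpretation of types, given an interpretation of the ground types. -/
def tyDen {G : Type u} (g : G → C.Obj) : Ty G → C.Obj
  | .ground x => g x
  | .one => 𝟙_ C.Obj
  | .arr A B => (ihom (tyDen g A)).obj (tyDen g B)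
  | .prod A B => tyDen g A ⊗ tyDen g B
  | .mon e A => (C.monad e).obj (tyDen g A)

/-- Interpretation of contexts. -/
def ctxDen {G : Type u} (g : G → C.Obj) : List (Ty G) → C.Obj
  | [] => 𝟙_ C.Obj
  | A :: Γ => ctxDen g Γ ⊗ tyDen C g A

variable {sg : Signature.{u, v}} (g : sg.Ground → C.Obj)
  (k : ∀ c : sg.Const, 𝟙_ C.Obj ⟶ tyDen C g (sg.constTy c))

/-- The interpretation of well-formed terms, given an interpretation of the ground types and of
the constants: `Den C g k Γ M A f` says that `⟦Γ ⊢ M : A⟧` is `f`. -/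
inductive Den : (Γ : List sg.Typ) → sg.Term → (A : sg.Typ) →
    (ctxDen C g Γ ⟶ tyDen C g A) → Prop
  | var_zero {Γ A} : Den (A :: Γ) (.var 0) A (snd _ _)
  | var_succ {Γ A B n f} : Den Γ (.var n) A f → Den (B :: Γ) (.var (n + 1)) A (fst _ _ ≫ f)
  | const {Γ} (c) : Den Γ (.const c) (sg.constTy c) (toUnit _ ≫ k c)
  | star {Γ} : Den Γ .star .one (toUnit _)
  | lam {Γ A B M f} : Den (A :: Γ) M B f →
      Den Γ (.lam A M) (.arr A B)
        (MonoidalClosed.curry (swapHom (tyDen C g A) (ctxDen C g Γ) ≫ f))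
  | app {Γ A B M N f h} : Den Γ M (.arr A B) f → Den Γ N A h →
      Den Γ (.app A B M N) B (lift h f ≫ (ihom.ev (tyDen C g A)).app (tyDen C g B))
  | pair {Γ A B M N f h} : Den Γ M A f → Den Γ N B h →
      Den Γ (.pair M N) (.prod A B) (lift f h)
  | fst {Γ A B M f} : Den Γ M (.prod A B) f → Den Γ (.fst A B M) A (f ≫ fst _ _)
  | snd {Γ A B M f} : Den Γ M (.prod A B) f → Den Γ (.snd A B M) B (f ≫ snd _ _)
  | ret {Γ e A M f} : Den Γ M A f →
      Den Γ (.ret e M) (.mon e A) (f ≫ (C.monad e).η.app (tyDen C g A))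
  | incl {Γ A M f} : Den Γ M (.mon .S A) f →
      Den Γ (.incl A M) (.mon .T A) (f ≫ C.ι.app (tyDen C g A))
  | bind {Γ e A B M N f h} : Den Γ M (.mon e A) f → Den (A :: Γ) N (.mon e B) h →
      Den Γ (.bind e A B M N) (.mon e B)
        (lift (𝟙 _) f ≫ (C.monad e).τ (ctxDen C g Γ) (tyDen C g A) ≫ (C.monad e).map h ≫
          (C.monad e).μ.app (tyDen C g B))
  | conv {Γ M A B f} : Den Γ M A f → sg.TyEq A B → (hAB : tyDen C g A = tyDen C g B) →
      Den Γ M B (f ≫ eqToHom hAB)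

end Interpretation

/-- The signature of the internal language of a model: a ground type for every object, a constant
`c_f : X → Y` for every morphism `f : X ⟶ Y`, and an equality between any two types with the same
interpretation. -/
def internalSignature (C : Model.{u, v}) : Signature.{u, max u v} where
  Ground := C.Obj
  Const := Σ X Y : C.Obj, X ⟶ Y
  constTy c := .arr (.ground c.1) (.ground c.2.1)
  tyAx A B := tyDen C id A = tyDen C id B

/-- The interpretation `1 ⟶ Y ^ X` of the constant `c_f`, for `f : X ⟶ Y`. -/
def internalConst (C : Model.{u, v}) (c : (internalSignature C).Const) :
    𝟙_ C.Obj ⟶ tyDen C id ((internalSignature C).constTy c) :=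
  MonoidalClosed.curry (fst c.1 (𝟙_ C.Obj) ≫ c.2.2)

/-- The internal language `L(C)` of a model `C`: any two well-formed terms with the same
interpretation are equal. -/
def L (C : Model.{u, v}) : Theory.{u, max u v} where
  toSignature := internalSignature C
  tmAx Γ M N A := (internalSignature C).HasTy Γ M A ∧ (internalSignature C).HasTy Γ N A ∧
    ∃ f, Den C id (internalConst C) Γ M A f ∧ Den C id (internalConst C) Γ N A f
  tmAx_left h := h.1
  tmAx_right h := h.2.1

/-! ### Translations -/

/-- A CSC-translation. -/
structure Translation (Th : Theory.{u₁, v₁}) (Th' : Theory.{u₂, v₂}) where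
  ty : Th.Typ → Th'.Typ
  tm : Th.Term → Th'.Term
  tyEq {A B} : Th.TyEq A B → Th'.TyEq (ty A) (ty B)
  hasTy {Γ M A} : Th.HasTy Γ M A → Th'.HasTy (Γ.map ty) (tm M) (ty A)
  tmEq {Γ M N A} : Th.TmEq Γ M N A → Th'.TmEq (Γ.map ty) (tm M) (tm N) (ty A)
  ty_one : ty .one = .one
  ty_arr (A B) : ty (.arr A B) = .arr (ty A) (ty B)
  ty_prod (A B) : ty (.prod A B) = .prod (ty A) (ty B)
  ty_mon (e A) : ty (.mon e A) = .mon e (ty A)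
  tm_var (n) : tm (.var n) = .var n
  tm_star : tm .star = .star
  tm_lam (A M) : tm (.lam A M) = .lam (ty A) (tm M)
  tm_app (A B M N) : tm (.app A B M N) = .app (ty A) (ty B) (tm M) (tm N)
  tm_pair (M N) : tm (.pair M N) = .pair (tm M) (tm N)
  tm_fst (A B M) : tm (.fst A B M) = .fst (ty A) (ty B) (tm M)
  tm_snd (A B M) : tm (.snd A B M) = .snd (ty A) (ty B) (tm M)
  tm_ret (e M) : tm (.ret e M) = .ret e (tm M)
  tm_incl (A M) : tm (.incl A M) = .incl (ty A) (tm M)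
  tm_bind (e A B M N) : tm (.bind e A B M N) = .bind e (ty A) (ty B) (tm M) (tm N)

namespace Translation

/-- The identity translation. -/
def id (Th : Theory.{u, v}) : Translation Th Th where
  ty A := A
  tm M := M
  tyEq h := h
  hasTy h := by simpa using h
  tmEq h := by simpa using h
  ty_one := rfl
  ty_arr _ _ := rfl
  ty_prod _ _ := rfl
  ty_mon _ _ := rfl
  tm_var _ := rfl
  tm_star := rfl
  tm_lam _ _ := rfl
  tm_app _ _ _ _ := rfl
  tm_pair _ _ := rfl
  tm_fst _ _ _ := rfl
  tm_snd _ _ _ := rfl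
  tm_ret _ _ := rfl
  tm_incl _ _ := rfl
  tm_bind _ _ _ _ _ := rfl

/-- The composite `W ∘ V` of translations. -/
def comp {Th₁ : Theory.{u, v}} {Th₂ : Theory.{u₁, v₁}} {Th₃ : Theory.{u₂, v₂}}
    (W : Translation Th₂ Th₃) (V : Translation Th₁ Th₂) : Translation Th₁ Th₃ where
  ty A := W.ty (V.ty A)
  tm M := W.tm (V.tm M)
  tyEq h := W.tyEq (V.tyEq h)
  hasTy h := by simpa [Function.comp_def] using W.hasTy (V.hasTy h)
  tmEq h := by simpa [Function.comp_def] using W.tmEq (V.tmEq h)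
  ty_one := by simp only [V.ty_one, W.ty_one]
  ty_arr _ _ := by simp only [V.ty_arr, W.ty_arr]
  ty_prod _ _ := by simp only [V.ty_prod, W.ty_prod]
  ty_mon _ _ := by simp only [V.ty_mon, W.ty_mon]
  tm_var _ := by simp only [V.tm_var, W.tm_var]
  tm_star := by simp only [V.tm_star, W.tm_star]
  tm_lam _ _ := by simp only [V.tm_lam, W.tm_lam]
  tm_app _ _ _ _ := by simp only [V.tm_app, W.tm_app]
  tm_pair _ _ := by simp only [V.tm_pair, W.tm_pair]
  tm_fst _ _ _ := by simp only [V.tm_fst, W.tm_fst]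
  tm_snd _ _ _ := by simp only [V.tm_snd, W.tm_snd]
  tm_ret _ _ := by simp only [V.tm_ret, W.tm_ret]
  tm_incl _ _ := by simp only [V.tm_incl, W.tm_incl]
  tm_bind _ _ _ _ _ := by simp only [V.tm_bind, W.tm_bind]

end Translation

/-- A CSC-translation transformation `V ⇒ V'`: terms `x : V A ⊢ α_A : V' A`, natural in the
judgements `x : A ⊢ f : B`. -/
structure Transformation {Th : Theory.{u₁, v₁}} {Th' : Theory.{u₂, v₂}}
    (V V' : Translation Th Th') where
  app : Th.Typ → Th'.Term
  hasTy (A) : Th'.HasTy [V.ty A] (app A) (V'.ty A)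
  naturality {A B f} : Th.HasTy [A] f B →
    Th'.TmEq [V.ty A] ((app B).plug (V.tm f)) ((V'.tm f).plug (app A)) (V'.ty B)

/-- Two translations are isomorphic if there are transformations between them that are inverse to
each other, up to provable equality of terms. -/
def Translation.Isomorphic {Th : Theory.{u₁, v₁}} {Th' : Theory.{u₂, v₂}}
    (V V' : Translation Th Th') : Prop :=
  ∃ (α : Transformation V V') (β : Transformation V' V),
    (∀ A, Th'.TmEq [V.ty A] ((β.app A).plug (α.app A)) (.var 0) (V.ty A)) ∧
    ∀ A, Th'.TmEq [V'.ty A] ((α.app A).plug (β.app A)) (.var 0) (V'.ty A)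

/-! ### Strong monads from binding operators -/

/-- A strong monad presented by a unit and a `do`-operator in context. -/
structure DoMonad (C : Type u) [Category.{v} C] [CartesianMonoidalCategory C] where
  T : C → C
  ret (X : C) : X ⟶ T X
  bind {Z X Y : C} : (Z ⟶ T X) → (Z ⊗ X ⟶ T Y) → (Z ⟶ T Y)
  comp_bind {W Z X Y : C} (f : W ⟶ Z) (m : Z ⟶ T X) (n : Z ⊗ X ⟶ T Y) :
    f ≫ bind m n = bind (f ≫ m) (lift (fst W X ≫ f) (snd W X) ≫ n)
  ret_bind {Z X Y : C} (m : Z ⟶ X) (n : Z ⊗ X ⟶ T Y) :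
    bind (m ≫ ret X) n = lift (𝟙 Z) m ≫ n
  bind_ret {Z X : C} (m : Z ⟶ T X) : bind m (snd Z X ≫ ret X) = m
  bind_bind {Z X Y W : C} (m : Z ⟶ T X) (n : Z ⊗ X ⟶ T Y) (p : Z ⊗ Y ⟶ T W) :
    bind (bind m n) p = bind m (bind n (lift (fst (Z ⊗ X) Y ≫ fst Z X) (snd (Z ⊗ X) Y) ≫ p))

namespace DoMonad

variable {C : Type u} [Category.{v} C] [CartesianMonoidalCategory C] (D : DoMonad C)

lemma comp_ret_bind {Z W X Y : C} (l : Z ⟶ W) (m : W ⟶ X) (n : Z ⊗ X ⟶ D.T Y) :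
    D.bind (l ≫ m ≫ D.ret X) n = lift (𝟙 Z) (l ≫ m) ≫ n := by
  rw [← Category.assoc, D.ret_bind]

lemma comp_comp_ret_bind {Z W V X Y : C} (k : Z ⟶ V) (l : V ⟶ W) (m : W ⟶ X)
    (n : Z ⊗ X ⟶ D.T Y) :
    D.bind (k ≫ l ≫ m ≫ D.ret X) n = lift (𝟙 Z) (k ≫ l ≫ m) ≫ n := by
  rw [← Category.assoc, D.comp_ret_bind, Category.assoc]

lemma id_ret_bind {X Y : C} (n : X ⊗ X ⟶ D.T Y) :
    D.bind (D.ret X) n = lift (𝟙 X) (𝟙 X) ≫ n :=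
  by
  simpa using D.ret_bind (𝟙 X) n

lemma tensorHom_eq_lift {X X' Y Y' : C} (f : X ⟶ X') (g : Y ⟶ Y') :
    (f ⊗ₘ g) = lift (fst X Y ≫ f) (snd X Y ≫ g) := by ext <;> simp

lemma whiskerLeft_eq_lift (X : C) {Y Y' : C} (g : Y ⟶ Y') :
    X ◁ g = lift (fst X Y) (snd X Y ≫ g) := by ext <;> simp

lemma whiskerRight_eq_lift {X X' : C} (f : X ⟶ X') (Y : C) :
    f ▷ Y = lift (fst X Y ≫ f) (snd X Y) := by ext <;> simp

lemma associator_eq_lift (X Y Z : C) : (α_ X Y Z).hom =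
    lift (fst (X ⊗ Y) Z ≫ fst X Y) (lift (fst (X ⊗ Y) Z ≫ snd X Y) (snd (X ⊗ Y) Z)) := by
  ext <;> simp

attribute [local simp] comp_bind ret_bind bind_ret bind_bind id_ret_bind
  comp_ret_bind comp_comp_ret_bind comp_lift_assoc tensorHom_eq_lift whiskerLeft_eq_lift
  whiskerRight_eq_lift associator_eq_lift leftUnitor_hom

attribute [-simp] lift_fst_comp_snd_comp

/-- The strong monad of a `do`-operator. Its structure maps may be given in any form. -/
def toStrongMonad (mapD : ∀ {X Y : C}, (X ⟶ Y) → (D.T X ⟶ D.T Y))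
    (muD : ∀ X : C, D.T (D.T X) ⟶ D.T X) (tauD : ∀ X Y : C, X ⊗ D.T Y ⟶ D.T (X ⊗ Y))
    (hmap : ∀ {X Y : C} (f : X ⟶ Y), mapD f = D.bind (𝟙 _) (snd _ _ ≫ f ≫ D.ret Y))
    (hmu : ∀ X : C, muD X = D.bind (𝟙 _) (snd _ _))
    (htau : ∀ X Y : C,
      tauD X Y = D.bind (snd _ _) (lift (fst _ _ ≫ fst _ _) (snd _ _) ≫ D.ret _)) :
    StrongMonad C where
  obj := D.T
  map := mapD
  map_id X := by simp [hmap]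
  map_comp f g := by simp [hmap]
  η := { app := D.ret, naturality := by intros; simp [hmap] }
  μ := { app := muD, naturality := by intros; simp [hmap, hmu] }
  assoc X := by simp [hmap, hmu]
  left_unit X := by simp [hmu]
  right_unit X := by simp [hmap, hmu]
  τ := tauD
  τ_naturality f g := by simp [hmap, htau]
  τ_unit X := by simp [hmap, htau]
  τ_assoc X Y Z := by simp [hmap, htau]
  τ_η X Y := by simp [htau]
  τ_μ X Y := by simp [hmu, hmap, htau]

/-- A central inclusion of `do`-operators gives central cones. -/
lemma isCentralCone {mapD muD tauD}
    (hmap : ∀ {X Y : C} (f : X ⟶ Y), mapD f = D.bind (𝟙 _) (snd _ _ ≫ f ≫ D.ret Y))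
    (hmu : ∀ X : C, muD X = D.bind (𝟙 _) (snd _ _))
    (htau : ∀ X Y : C,
      tauD X Y = D.bind (snd _ _) (lift (fst _ _ ≫ fst _ _) (snd _ _) ≫ D.ret _))
    {X R : C} (j : R ⟶ D.T X)
    (hj : ∀ {Z Y W : C} (m : Z ⟶ R) (n : Z ⟶ D.T Y) (p : (Z ⊗ X) ⊗ Y ⟶ D.T W),
      D.bind (m ≫ j) (D.bind (fst Z X ≫ n) p) = D.bind n (D.bind (fst Z Y ≫ m ≫ j)
        (lift (lift (fst (Z ⊗ Y) X ≫ fst Z Y) (snd (Z ⊗ Y) X)) (fst (Z ⊗ Y) X ≫ snd Z Y) ≫ p))) :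
    (D.toStrongMonad mapD muD tauD hmap hmu htau).IsCentralCone j := by
  intro Y
  change j ▷ D.T Y ≫ (swapHom (D.T X) (D.T Y) ≫ tauD (D.T Y) X ≫ mapD (swapHom (D.T Y) X)) ≫
      mapD (tauD X Y) ≫ muD (X ⊗ Y) = j ▷ D.T Y ≫ tauD (D.T X) Y ≫
      mapD (swapHom (D.T X) Y ≫ tauD Y X ≫ mapD (swapHom Y X)) ≫ muD (X ⊗ Y)
  simp [hmap, hmu, htau, swapHom]
  rw [hj]
  simp

lemma incl_map (E : DoMonad C) (j : ∀ X, D.T X ⟶ E.T X) (hr : ∀ X, D.ret X ≫ j X = E.ret X)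
    (hb : ∀ {Z X Y : C} (m : Z ⟶ D.T X) (n : Z ⊗ X ⟶ D.T Y),
      D.bind m n ≫ j Y = E.bind (m ≫ j X) (n ≫ j Y)) {X Y : C} (f : X ⟶ Y) :
    D.bind (𝟙 _) (snd _ _ ≫ f ≫ D.ret Y) ≫ j Y =
      j X ≫ E.bind (𝟙 _) (snd _ _ ≫ f ≫ E.ret Y) := by
  simp [hr, hb]

lemma incl_mu (E : DoMonad C) (j : ∀ X, D.T X ⟶ E.T X) (hr : ∀ X, D.ret X ≫ j X = E.ret X)
    (hb : ∀ {Z X Y : C} (m : Z ⟶ D.T X) (n : Z ⊗ X ⟶ D.T Y),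
      D.bind m n ≫ j Y = E.bind (m ≫ j X) (n ≫ j Y)) (X : C) :
    D.bind (𝟙 (D.T (D.T X))) (snd _ _) ≫ j X =
      (D.bind (𝟙 _) (snd _ _ ≫ j X ≫ D.ret (E.T X)) ≫ j _) ≫ E.bind (𝟙 _) (snd _ _) := by
  simp [hr, hb]

lemma incl_tau (E : DoMonad C) (j : ∀ X, D.T X ⟶ E.T X) (hr : ∀ X, D.ret X ≫ j X = E.ret X)
    (hb : ∀ {Z X Y : C} (m : Z ⟶ D.T X) (n : Z ⊗ X ⟶ D.T Y),
      D.bind m n ≫ j Y = E.bind (m ≫ j X) (n ≫ j Y)) (X Y : C) :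
    D.bind (snd X (D.T Y)) (lift (fst _ _ ≫ fst _ _) (snd _ _) ≫ D.ret _) ≫ j _ =
      X ◁ j Y ≫ E.bind (snd X (E.T Y)) (lift (fst _ _ ≫ fst _ _) (snd _ _) ≫ E.ret _) := by
  simp [hr, hb]

end DoMonad

/-! ### The syntactic model -/

section SyntacticModel

open Signature Theory

/-- Types modulo equality of types. -/
def tySetoid (Th : Theory.{u, v}) : Setoid Th.Typ where
  r := Th.TyEq
  iseqv := ⟨.refl, .symm, .trans⟩

/-- The objects of the syntactic category: types modulo equality of types. -/
def Syn (Th : Theory.{u, v}) : Type u := Quotient (tySetoid Th)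

variable {Th : Theory.{u, v}}

namespace Syn

/-- The class `[A]` of a type. -/
def mk (A : Th.Typ) : Syn Th := Quotient.mk (tySetoid Th) A

/-- A representative of a class of types. -/
noncomputable def rep (a : Syn Th) : Th.Typ := Quotient.out a

@[simp] lemma mk_rep (a : Syn Th) : mk a.rep = a := Quotient.out_eq a

lemma mk_eq {A B : Th.Typ} : mk A = mk B ↔ Th.TyEq A B :=
  ⟨fun h => Quotient.exact h, fun h => Quotient.sound h⟩

/-- `[A] × [B] = [A × B]`. -/
def prod (a b : Syn Th) : Syn Th :=
  Quotient.map₂ Ty.prod (fun _ _ h _ _ h' => TyEq.prod h h') a b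

/-- `[A] → [B] = [A → B]`. -/
def arr (a b : Syn Th) : Syn Th :=
  Quotient.map₂ Ty.arr (fun _ _ h _ _ h' => TyEq.arr h h') a b

/-- `T [A] = [T A]` and `S [A] = [S A]`. -/
def mon (e : Eff) (a : Syn Th) : Syn Th :=
  Quotient.map (Ty.mon e) (fun _ _ h => TyEq.mon e h) a

lemma mk_prod {A B : Th.Typ} {a b : Syn Th} (hA : mk A = a) (hB : mk B = b) :
    mk (A.prod B) = prod a b := by subst hA hB; rfl

lemma mk_arr {A B : Th.Typ} {a b : Syn Th} (hA : mk A = a) (hB : mk B = b) :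
    mk (A.arr B) = arr a b := by subst hA hB; rfl

lemma mk_mon (e : Eff) {A : Th.Typ} {a : Syn Th} (hA : mk A = a) :
    mk (A.mon e) = mon e a := by subst hA; rfl

/-- `x : A ⊢ f : B` for representatives `A` and `B` of `a` and `b`. -/
def Typed (a b : Syn Th) (f : Th.Term) : Prop :=
  ∃ A B, mk A = a ∧ mk B = b ∧ Th.HasTy [A] f B

lemma Typed.hasTy {a b : Syn Th} {f} (h : Typed a b f) {A B} (hA : mk A = a) (hB : mk B = b)
    (Γ : List Th.Typ) : Th.HasTy (A :: Γ) f B := by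
  obtain ⟨A', B', hA', hB', hf⟩ := h
  exact hf.single (mk_eq.1 (hA'.trans hA.symm)) (mk_eq.1 (hB'.trans hB.symm)) Γ

/-- `x : A ⊢ f = g : B` for representatives `A` and `B` of `a` and `b`. -/
def Equal (a b : Syn Th) (f g : Th.Term) : Prop :=
  ∃ A B, mk A = a ∧ mk B = b ∧ Th.TmEq [A] f g B

lemma Equal.tmEq {a b : Syn Th} {f g} (h : Equal a b f g) (hf : Typed a b f) (hg : Typed a b g)
    {A B} (hA : mk A = a) (hB : mk B = b) (Γ : List Th.Typ) : Th.TmEq (A :: Γ) f g B := by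
  obtain ⟨A', B', hA', hB', h⟩ := h
  exact h.single (hf.hasTy hA' hB' []) (hg.hasTy hA' hB' [])
    (mk_eq.1 (hA'.trans hA.symm)) (mk_eq.1 (hB'.trans hB.symm)) Γ

/-- Judgements `x : A ⊢ f : B` modulo provable equality. -/
def homSetoid (a b : Syn Th) : Setoid {f : Th.Term // Typed a b f} where
  r f g := Equal a b f.1 g.1
  iseqv := by
    refine ⟨fun f => ?_, fun {f g} h => ?_, fun {f g k} h h' => ?_⟩
    · exact ⟨a.rep, b.rep, mk_rep a, mk_rep b, .refl (f.2.hasTy (mk_rep a) (mk_rep b) [])⟩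
    · exact ⟨a.rep, b.rep, mk_rep a, mk_rep b,
        (h.tmEq f.2 g.2 (mk_rep a) (mk_rep b) []).symm⟩
    · exact ⟨a.rep, b.rep, mk_rep a, mk_rep b,
        (h.tmEq f.2 g.2 (mk_rep a) (mk_rep b) []).trans
          (h'.tmEq g.2 k.2 (mk_rep a) (mk_rep b) [])⟩

/-- The morphisms of the syntactic category. -/
def Hom (a b : Syn Th) : Type (max u v) := Quotient (homSetoid a b)

/-- The class `[x : A ⊢ f : B]`. -/
def Hom.of {a b : Syn Th} (f : Th.Term) (hf : Typed a b f) : Hom a b :=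
  Quotient.mk (homSetoid a b) ⟨f, hf⟩

lemma Hom.of_eq {a b : Syn Th} {f g : Th.Term} {hf : Typed a b f} {hg : Typed a b g}
    (h : Equal a b f g) : Hom.of f hf = Hom.of g hg := Quotient.sound h

lemma Typed.plug {a b c : Syn Th} {f g} (hf : Typed a b f) (hg : Typed b c g) :
    Typed a c (g.plug f) :=
  ⟨a.rep, c.rep, mk_rep a, mk_rep c,
    (hg.hasTy (mk_rep b) (mk_rep c) []).plug (hf.hasTy (mk_rep a) (mk_rep b) [])⟩

/-- Composition: `[y : B ⊢ g : C] ∘ [x : A ⊢ f : B] = [x : A ⊢ g[f/y] : C]`. -/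
def Hom.comp {a b c : Syn Th} (φ : Hom a b) (ψ : Hom b c) : Hom a c :=
  Quotient.map₂ (fun f g => ⟨g.1.plug f.1, f.2.plug g.2⟩) (by
    intro f f' hf g g' hg
    have hA := mk_rep a
    have hB := mk_rep b
    have hC := mk_rep c
    have e₁ := hf.tmEq f.2 f'.2 hA hB []
    have e₂ := hg.tmEq g.2 g'.2 hB hC []
    refine ⟨a.rep, c.rep, hA, hC, ?_⟩
    exact (TmEq.plug (g.2.hasTy hB hC []) (f.2.hasTy hA hB []) (f'.2.hasTy hA hB []) e₁).trans
      (.subst e₂ (isSubst_plug (f'.2.hasTy hA hB [])))) φ ψ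

lemma typed_id (a : Syn Th) : Typed a a (.var 0) :=
  ⟨a.rep, a.rep, mk_rep a, mk_rep a, .var rfl⟩

instance : Category.{max u v} (Syn Th) where
  Hom := Hom
  id a := Hom.of (.var 0) (typed_id a)
  comp := Hom.comp
  id_comp φ := by
    induction φ using Quotient.ind with
    | _ f => exact congrArg _ (Subtype.ext (f.2.hasTy (mk_rep _) (mk_rep _) []).plug_var)
  comp_id φ := by
    induction φ using Quotient.ind with
    | _ f => rfl
  assoc φ ψ χ := by
    induction φ using Quotient.ind with
    | _ f => induction ψ using Quotient.ind with
      | _ g => induction χ using Quotient.ind with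
        | _ h => exact congrArg _ (Subtype.ext (Tm.subst_subst _ _ _).symm)

/-- The class `[x : A ⊢ f : B]` as a morphism. -/
def of {a b : Syn Th} (f : Th.Term) (hf : Typed a b f) : a ⟶ b := Hom.of f hf

lemma of_eq {a b : Syn Th} {f g : Th.Term} {hf : Typed a b f} {hg : Typed a b g} {A B}
    (hA : mk A = a) (hB : mk B = b) (h : Th.TmEq [A] f g B) : of f hf = of g hg :=
  Quotient.sound ⟨A, B, hA, hB, h⟩

lemma tmEq_of_eq {a b : Syn Th} {f g : Th.Term} {hf : Typed a b f} {hg : Typed a b g}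
    (h : of f hf = of g hg) {A B} (hA : mk A = a) (hB : mk B = b) : Th.TmEq [A] f g B :=
  Equal.tmEq (Quotient.exact h) hf hg hA hB []

lemma exists_of {a b : Syn Th} (φ : a ⟶ b) : ∃ f hf, φ = of f hf := by
  induction φ using Quotient.ind with
  | _ f => exact ⟨f.1, f.2, rfl⟩

lemma of_comp_of {a b c : Syn Th} {f g : Th.Term} (hf : Typed a b f) (hg : Typed b c g) :
    of f hf ≫ of g hg = of (g.plug f) (hf.plug hg) := rfl

lemma id_eq_of (a : Syn Th) : 𝟙 a = of (.var 0) (typed_id a) := rfl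

/-! #### Cartesian closed structure -/

/-- The terminal object `[1]`. -/
def one : Syn Th := mk .one

lemma hom_one_ext {a : Syn Th} (φ ψ : a ⟶ one) : φ = ψ := by
  obtain ⟨f, hf, rfl⟩ := exists_of φ
  obtain ⟨g, hg, rfl⟩ := exists_of ψ
  exact of_eq (mk_rep a) rfl ((TmEq.one_eta (hf.hasTy (mk_rep a) rfl [])).symm.trans
    (.one_eta (hg.hasTy (mk_rep a) rfl [])))

/-- `[x : A ⊢ * : 1]` -/
def bang (a : Syn Th) : a ⟶ one := of .star ⟨a.rep, .one, mk_rep a, rfl, .star⟩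

lemma mk_prod_rep (a b : Syn Th) : mk (a.rep.prod b.rep) = prod a b :=
  mk_prod (mk_rep a) (mk_rep b)

lemma mk_arr_rep (a b : Syn Th) : mk (a.rep.arr b.rep) = arr a b :=
  mk_arr (mk_rep a) (mk_rep b)

lemma mk_mon_rep (e : Eff) (a : Syn Th) : mk (a.rep.mon e) = mon e a :=
  mk_mon e (mk_rep a)

/-- `[x : A × B ⊢ π₁ x : A]` -/
noncomputable def p₁ (a b : Syn Th) : prod a b ⟶ a :=
  of (.fst a.rep b.rep (.var 0)) ⟨_, _, mk_prod_rep a b, mk_rep a, .fst (.var rfl)⟩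

/-- `[x : A × B ⊢ π₂ x : B]` -/
noncomputable def p₂ (a b : Syn Th) : prod a b ⟶ b :=
  of (.snd a.rep b.rep (.var 0)) ⟨_, _, mk_prod_rep a b, mk_rep b, .snd (.var rfl)⟩

lemma Typed.pair {a b c : Syn Th} {f g} (hf : Typed c a f) (hg : Typed c b g) :
    Typed c (prod a b) (.pair f g) :=
  ⟨c.rep, _, mk_rep c, mk_prod_rep a b,
    .pair (hf.hasTy (mk_rep c) (mk_rep a) []) (hg.hasTy (mk_rep c) (mk_rep b) [])⟩

/-- `⟨[x : C ⊢ f : A], [x : C ⊢ g : B]⟩ = [x : C ⊢ ⟨f, g⟩ : A × B]` -/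
def pairing {a b c : Syn Th} (φ : c ⟶ a) (ψ : c ⟶ b) : c ⟶ prod a b :=
  Quotient.map₂ (fun f g => ⟨.pair f.1 g.1, f.2.pair g.2⟩) (by
    intro f f' hf g g' hg
    exact ⟨c.rep, _, mk_rep c, mk_prod_rep a b,
      .pair_eq (hf.tmEq f.2 f'.2 (mk_rep c) (mk_rep a) [])
        (hg.tmEq g.2 g'.2 (mk_rep c) (mk_rep b) [])⟩) φ ψ

lemma pairing_of {a b c : Syn Th} {f g} (hf : Typed c a f) (hg : Typed c b g) :
    pairing (of f hf) (of g hg) = of (.pair f g) (hf.pair hg) := rfl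

lemma pairing_p₁ {a b c : Syn Th} (φ : c ⟶ a) (ψ : c ⟶ b) : pairing φ ψ ≫ p₁ a b = φ := by
  obtain ⟨f, hf, rfl⟩ := exists_of φ
  obtain ⟨g, hg, rfl⟩ := exists_of ψ
  exact of_eq (mk_rep c) (mk_rep a)
    (.fst_beta (hf.hasTy (mk_rep c) (mk_rep a) []) (hg.hasTy (mk_rep c) (mk_rep b) []))

lemma pairing_p₂ {a b c : Syn Th} (φ : c ⟶ a) (ψ : c ⟶ b) : pairing φ ψ ≫ p₂ a b = ψ := by
  obtain ⟨f, hf, rfl⟩ := exists_of φ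
  obtain ⟨g, hg, rfl⟩ := exists_of ψ
  exact of_eq (mk_rep c) (mk_rep b)
    (.snd_beta (hf.hasTy (mk_rep c) (mk_rep a) []) (hg.hasTy (mk_rep c) (mk_rep b) []))

lemma pairing_eta {a b c : Syn Th} (χ : c ⟶ prod a b) : pairing (χ ≫ p₁ a b) (χ ≫ p₂ a b) = χ := by
  obtain ⟨h, hh, rfl⟩ := exists_of χ
  exact of_eq (mk_rep c) (mk_prod_rep a b)
    (.prod_eta (hh.hasTy (mk_rep c) (mk_prod_rep a b) []))

noncomputable instance : CartesianMonoidalCategory (Syn Th) :=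
  .ofChosenFiniteProducts
    ⟨_, Limits.IsTerminal.ofUniqueHom (bang (Th := Th)) (fun _ _ => hom_one_ext _ _)⟩
    (fun a b => ⟨Limits.BinaryFan.mk (p₁ a b) (p₂ a b),
      Limits.BinaryFan.IsLimit.mk _ pairing pairing_p₁ pairing_p₂ (by
        intro c φ ψ m h₁ h₂
        rw [← pairing_eta m]
        exact congrArg₂ pairing h₁ h₂)⟩)

lemma fst_eq (a b : Syn Th) : fst a b = p₁ a b := rfl
lemma snd_eq (a b : Syn Th) : snd a b = p₂ a b := rfl
lemma lift_eq {a b c : Syn Th} (φ : c ⟶ a) (ψ : c ⟶ b) : lift φ ψ = pairing φ ψ := by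
  rw [← pairing_eta (lift φ ψ)]
  exact congrArg₂ pairing (lift_fst φ ψ) (lift_snd φ ψ)


lemma Typed.curry {a b c : Syn Th} {f} (hf : Typed (prod a b) c f) :
    Typed b (arr a c) (.lam a.rep (f.plug (.pair (.var 0) (.var 1)))) :=
  ⟨b.rep, _, mk_rep b, mk_arr_rep a c, .lam ((hf.hasTy (mk_prod_rep a b) (mk_rep c) []).plug
    (.pair (.var rfl) (.var rfl)))⟩

/-- The transpose `[y : B ⊢ λ x. f[⟨x, y⟩/z] : A → C]` of `[z : A × B ⊢ f : C]`. -/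
noncomputable def curry {a b c : Syn Th} (φ : prod a b ⟶ c) : b ⟶ arr a c :=
  Quotient.map (fun f => ⟨_, f.2.curry⟩) (by
    intro f f' hf
    exact ⟨b.rep, _, mk_rep b, mk_arr_rep a c, .lam_eq (.refl _)
      (.subst (hf.tmEq f.2 f'.2 (mk_prod_rep a b) (mk_rep c) [])
        (isSubst_plug (.pair (.var rfl) (.var rfl))))⟩) φ

lemma curry_of {a b c : Syn Th} {f} (hf : Typed (prod a b) c f) :
    curry (of f hf) = of _ hf.curry := rfl

/-- Evaluation `[z : A × (A → B) ⊢ (π₂ z) (π₁ z) : B]`. -/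
noncomputable def ev (a b : Syn Th) : prod a (arr a b) ⟶ b :=
  of (.app a.rep b.rep (.snd a.rep (a.rep.arr b.rep) (.var 0))
      (.fst a.rep (a.rep.arr b.rep) (.var 0)))
    ⟨_, _, mk_prod (mk_rep a) (mk_arr_rep a b), mk_rep b,
      .app (.snd (.var rfl)) (.fst (.var rfl))⟩

noncomputable def uncurry {a b c : Syn Th} (ψ : b ⟶ arr a c) : prod a b ⟶ c :=
  pairing (p₁ a b) (p₂ a b ≫ ψ) ≫ ev a c

lemma typed_uncurry {a b c : Syn Th} {g} (hg : Typed b (arr a c) g) :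
    Typed (prod a b) c (.app a.rep c.rep (g.plug (.snd a.rep b.rep (.var 0)))
      (.fst a.rep b.rep (.var 0))) :=
  ⟨_, _, mk_prod_rep a b, mk_rep c, .app ((hg.hasTy (mk_rep b) (mk_arr_rep a c) []).plug
    (.snd (.var rfl))) (.fst (.var rfl))⟩

lemma uncurry_of {a b c : Syn Th} {g} (hg : Typed b (arr a c) g) :
    uncurry (of g hg) = of (.app a.rep c.rep (g.plug (.snd a.rep b.rep (.var 0)))
      (.fst a.rep b.rep (.var 0))) (typed_uncurry hg) := by
  refine of_eq (mk_prod_rep a b) (mk_rep c) ?_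
  have h₁ : Th.HasTy [a.rep.prod b.rep] (.fst a.rep b.rep (.var 0)) a.rep := .fst (.var rfl)
  have h₂ : Th.HasTy [a.rep.prod b.rep] (g.plug (.snd a.rep b.rep (.var 0)))
      (a.rep.arr c.rep) :=
    (hg.hasTy (mk_rep b) (mk_arr_rep a c) []).plug (.snd (.var rfl))
  exact .app_eq (.refl _) (.refl _) (.snd_beta h₁ h₂) (.fst_beta h₁ h₂)

lemma uncurry_curry {a b c : Syn Th} (φ : prod a b ⟶ c) : uncurry (curry φ) = φ := by
  obtain ⟨f, hf, rfl⟩ := exists_of φ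
  rw [curry_of, uncurry_of]
  refine of_eq (mk_prod_rep a b) (mk_rep c) ?_
  have hf' := hf.hasTy (mk_prod_rep a b) (mk_rep c) []
  have hv : Th.HasTy [a.rep.prod b.rep] (.var 0) (a.rep.prod b.rep) := .var rfl
  have hl : Th.HasTy (a.rep :: [a.rep.prod b.rep])
      (f.plug (.pair (.var 0) (.snd a.rep b.rep (.var 1)))) c.rep :=
    hf'.plug (.pair (.var rfl) (.snd (.var rfl)))
  have e₁ := TmEq.lam_beta hl (.fst hv)
  have e₂ := TmEq.plug hf' (.pair (.fst hv) (.snd hv)) hv (.prod_eta hv)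
  rw [hf'.plug_var] at e₂
  simp only [Tm.plug, Tm.inst, Tm.subst, Tm.subst_subst, Tm.up, Tm.wk, Tm.ren,
    Tm.substOne] at e₁ e₂ ⊢
  exact e₁.trans e₂

lemma curry_uncurry {a b c : Syn Th} (ψ : b ⟶ arr a c) : curry (uncurry ψ) = ψ := by
  obtain ⟨g, hg, rfl⟩ := exists_of ψ
  rw [uncurry_of, curry_of]
  refine of_eq (mk_rep b) (mk_arr_rep a c) ?_
  have hg' := hg.hasTy (mk_rep b) (mk_arr_rep a c) []
  have hwk : g.plug (.var 1) = g.wk := by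
    rw [Tm.wk, Tm.ren_eq_subst]
    exact hg'.subst_congr (by intro n hn; obtain rfl : n = 0 := by simpa using hn
                              rfl)
  have h₀ : Th.HasTy [a.rep, b.rep] (.var 0) a.rep := .var rfl
  have h₁ : Th.HasTy [a.rep, b.rep] (.var 1) b.rep := .var rfl
  have e₁ := TmEq.lam_eta hg'
  have e₂ := TmEq.plug hg' (.snd (.pair h₀ h₁)) h₁ (.snd_beta h₀ h₁)
  have e₃ := TmEq.lam_eq (.refl a.rep)
    (TmEq.app_eq (.refl _) (.refl _) e₂ (.fst_beta h₀ h₁))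
  rw [hwk] at e₃
  simp only [Tm.plug, Tm.subst, Tm.subst_subst] at e₃ ⊢
  exact e₃.trans e₁

lemma comp_curry {a b b' c : Syn Th} (κ : b' ⟶ b) (φ : prod a b ⟶ c) :
    κ ≫ curry φ = curry (pairing (p₁ a b') (p₂ a b' ≫ κ) ≫ φ) := by
  rw [← curry_uncurry (κ ≫ curry φ)]
  congr 1
  have h : pairing (p₁ a b') (p₂ a b' ≫ κ) ≫ pairing (p₁ a b) (p₂ a b ≫ curry φ) =
      pairing (p₁ a b') (p₂ a b' ≫ κ ≫ curry φ) := by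
    rw [← pairing_eta (_ ≫ pairing (p₁ a b) _)]
    simp only [Category.assoc, pairing_p₁, pairing_p₂]
    rw [← Category.assoc, pairing_p₂, Category.assoc]
  conv_rhs => rw [← uncurry_curry φ]
  rw [uncurry, uncurry, ← h, Category.assoc]

lemma tensorLeft_map (a : Syn Th) {b b' : Syn Th} (κ : b' ⟶ b) :
    (tensorLeft a).map κ = pairing (p₁ a b') (p₂ a b' ≫ κ) := by
  rw [← lift_eq, ← fst_eq, ← snd_eq]
  exact DoMonad.whiskerLeft_eq_lift a κ

noncomputable instance : MonoidalClosed (Syn Th) where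
  closed a :=
    { rightAdj := Adjunction.rightAdjointOfEquiv (F := tensorLeft a) (G_obj := arr a)
        (fun b c => ⟨curry, uncurry, uncurry_curry, curry_uncurry⟩)
        (fun b' b c κ φ => by
          rw [tensorLeft_map]
          exact (comp_curry κ φ).symm)
      adj := Adjunction.adjunctionOfEquivRight _ _ }

/-! #### The monads -/

/-- `[x : A ⊢ ret x : T A]` -/
def unit (e : Eff) (a : Syn Th) : a ⟶ mon e a :=
  of (.ret e (.var 0)) ⟨a.rep, _, mk_rep a, mk_mon_rep e a, .ret (.var rfl)⟩

lemma Typed.bind {e : Eff} {a b c : Syn Th} {m n} (hm : Typed c (mon e a) m)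
    (hn : Typed (prod c a) (mon e b) n) :
    Typed c (mon e b) (.bind e a.rep b.rep m (n.plug (.pair (.var 1) (.var 0)))) :=
  ⟨c.rep, _, mk_rep c, mk_mon_rep e b, .bind (hm.hasTy (mk_rep c) (mk_mon_rep e a) [])
    ((hn.hasTy (mk_prod_rep c a) (mk_mon_rep e b) []).plug (.pair (.var rfl) (.var rfl)))⟩

/-- `[z : C ⊢ do x ← m; n[⟨z, x⟩/w] : T B]` for `[z : C ⊢ m : T A]` and
`[w : C × A ⊢ n : T B]`. -/
noncomputable def bind (e : Eff) {a b c : Syn Th} (φ : c ⟶ mon e a) (ψ : prod c a ⟶ mon e b) :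
    c ⟶ mon e b :=
  Quotient.map₂ (fun m n => ⟨_, m.2.bind n.2⟩) (by
    intro m m' hm n n' hn
    exact ⟨c.rep, _, mk_rep c, mk_mon_rep e b, .bind_eq (.refl _) (.refl _)
      (hm.tmEq m.2 m'.2 (mk_rep c) (mk_mon_rep e a) [])
      (.subst (hn.tmEq n.2 n'.2 (mk_prod_rep c a) (mk_mon_rep e b) [])
        (isSubst_plug (.pair (.var rfl) (.var rfl))))⟩) φ ψ

lemma bind_of {e : Eff} {a b c : Syn Th} {m n} (hm : Typed c (mon e a) m)
    (hn : Typed (prod c a) (mon e b) n) : bind e (of m hm) (of n hn) = of _ (hm.bind hn) := rfl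

lemma comp_bind (e : Eff) {a b c d : Syn Th} (κ : d ⟶ c) (φ : c ⟶ mon e a)
    (ψ : prod c a ⟶ mon e b) :
    κ ≫ bind e φ ψ = bind e (κ ≫ φ) (pairing (p₁ d a ≫ κ) (p₂ d a) ≫ ψ) := by
  obtain ⟨k, hk, rfl⟩ := exists_of κ
  obtain ⟨m, hm, rfl⟩ := exists_of φ
  obtain ⟨n, hn, rfl⟩ := exists_of ψ
  refine of_eq (mk_rep d) (mk_mon_rep e b) ?_
  have hk' := hk.hasTy (mk_rep d) (mk_rep c) []
  have hm' := hm.hasTy (mk_rep c) (mk_mon_rep e a) []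
  have hn' := hn.hasTy (mk_prod_rep c a) (mk_mon_rep e b) []
  have hwk : k.plug (.var 1) = k.wk := by
    rw [Tm.wk, Tm.ren_eq_subst]
    exact hk'.subst_congr (by intro n hn; obtain rfl : n = 0 := by simpa using hn
                              rfl)
  have h₀ : Th.HasTy [a.rep, d.rep] (.var 0) a.rep := .var rfl
  have h₁ : Th.HasTy [a.rep, d.rep] (.var 1) d.rep := .var rfl
  have e₁ := TmEq.plug hk' (.fst (.pair h₁ h₀)) h₁ (.fst_beta h₁ h₀)
  have e₂ := TmEq.plug hn'
    (.pair (hk'.plug (.fst (.pair h₁ h₀))) (.snd (.pair h₁ h₀))) (.pair (hk'.plug h₁) h₀)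
    (.pair_eq e₁ (.snd_beta h₁ h₀))
  have e₃ := TmEq.bind_eq (.refl _) (.refl _) (.refl (hm'.plug hk')) e₂
  rw [hwk] at e₃
  simp only [Tm.plug, Tm.subst, Tm.subst_subst, Tm.up, Tm.wk] at e₃ ⊢
  exact e₃.symm

lemma unit_bind (e : Eff) {a b c : Syn Th} (φ : c ⟶ a) (ψ : prod c a ⟶ mon e b) :
    bind e (φ ≫ unit e a) ψ = pairing (𝟙 c) φ ≫ ψ := by
  obtain ⟨m, hm, rfl⟩ := exists_of φ
  obtain ⟨n, hn, rfl⟩ := exists_of ψ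
  refine of_eq (mk_rep c) (mk_mon_rep e b) ?_
  have hm' := hm.hasTy (mk_rep c) (mk_rep a) []
  have hn' := hn.hasTy (mk_prod_rep c a) (mk_mon_rep e b) []
  have e₁ := TmEq.mon_beta (e := e) (A := a.rep) (B := b.rep) hm'
    (hn'.plug (Γ := [a.rep, c.rep]) (.pair (.var (n := 1) rfl) (.var (n := 0) rfl)))
  simp only [Tm.plug, Tm.inst, Tm.subst, Tm.subst_subst, Tm.substOne] at e₁ ⊢
  exact e₁

lemma bind_unit (e : Eff) {a c : Syn Th} (φ : c ⟶ mon e a) :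
    bind e φ (p₂ c a ≫ unit e a) = φ := by
  obtain ⟨m, hm, rfl⟩ := exists_of φ
  refine of_eq (mk_rep c) (mk_mon_rep e a) ?_
  have hm' := hm.hasTy (mk_rep c) (mk_mon_rep e a) []
  have h₀ : Th.HasTy [a.rep, c.rep] (.var 0) a.rep := .var rfl
  have h₁ : Th.HasTy [a.rep, c.rep] (.var 1) c.rep := .var rfl
  exact (TmEq.bind_eq (.refl _) (.refl _) (.refl hm') (.ret_eq (.snd_beta h₁ h₀))).trans
    (.mon_eta hm')

lemma bind_bind (e : Eff) {a b c d : Syn Th} (φ : c ⟶ mon e a) (ψ : prod c a ⟶ mon e b)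
    (χ : prod c b ⟶ mon e d) :
    bind e (bind e φ ψ) χ =
      bind e φ (bind e ψ (pairing (p₁ (prod c a) b ≫ p₁ c a) (p₂ (prod c a) b) ≫ χ)) := by
  obtain ⟨m, hm, rfl⟩ := exists_of φ
  obtain ⟨n, hn, rfl⟩ := exists_of ψ
  obtain ⟨p, hp, rfl⟩ := exists_of χ
  refine of_eq (mk_rep c) (mk_mon_rep e d) ?_
  have hm' := hm.hasTy (mk_rep c) (mk_mon_rep e a) []
  have hn' := hn.hasTy (mk_prod_rep c a) (mk_mon_rep e b) []
  have hp' := hp.hasTy (mk_prod_rep c b) (mk_mon_rep e d) []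
  have h₁₀ : Th.HasTy [a.rep, c.rep] (.pair (.var 1) (.var 0)) (c.rep.prod a.rep) :=
    .pair (.var rfl) (.var rfl)
  have e₁ := TmEq.mon_assoc (e := e) (A := a.rep) (B := b.rep) (C := d.rep) hm' (hn'.plug h₁₀)
    (hp'.plug (Γ := [b.rep, c.rep]) (.pair (.var (n := 1) rfl) (.var (n := 0) rfl)))
  have k₀ : Th.HasTy [b.rep, a.rep, c.rep] (.var 0) b.rep := .var rfl
  have k₁ : Th.HasTy [b.rep, a.rep, c.rep] (.var 1) a.rep := .var rfl
  have k₂ : Th.HasTy [b.rep, a.rep, c.rep] (.var 2) c.rep := .var rfl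
  have k₂₁ := HasTy.pair k₂ k₁
  have q : Th.TyEq (c.rep.prod a.rep) (prod c a).rep := mk_eq.1 (by rw [mk_prod_rep, mk_rep])
  have k₂₁' := HasTy.conv k₂₁ q
  have f₁ := TmEq.fst_beta k₂₁' k₀
  have f₂ := (TmEq.fst_eq (.refl _) (.refl _) (f₁.conv q.symm)).trans (.fst_beta k₂ k₁)
  have f₃ := TmEq.snd_beta k₂₁' k₀
  have t₁ : Th.HasTy [b.rep, a.rep, c.rep] (.fst c.rep a.rep (.fst (prod c a).rep b.rep
      (.pair (.pair (.var 2) (.var 1)) (.var 0)))) c.rep :=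
    .fst (.conv (.fst (.pair k₂₁' k₀)) q.symm)
  have f₄ := TmEq.plug hp' (.pair t₁ (.snd (.pair k₂₁' k₀))) (.pair k₂ k₀) (.pair_eq f₂ f₃)
  have e₂ := TmEq.bind_eq (.refl _) (.refl _) (.refl hm')
    (TmEq.bind_eq (.refl _) (.refl _) (.refl (hn'.plug h₁₀)) f₄)
  simp only [Tm.plug, Tm.subst, Tm.ren, Tm.subst_subst, Tm.subst_ren, Tm.up, Tm.wk, Tm.upr] at e₁ e₂ ⊢
  exact e₁.trans e₂.symm

/-- The `do`-operators of the syntactic category. -/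
noncomputable def doMonad (Th : Theory.{u, v}) (e : Eff) : DoMonad (Syn Th) where
  T := mon e
  ret := unit e
  bind := bind e
  comp_bind f m n := by rw [lift_eq]; exact comp_bind e f m n
  ret_bind m n := by rw [lift_eq]; exact unit_bind e m n
  bind_ret m := bind_unit e m
  bind_bind m n p := by rw [lift_eq]; exact bind_bind e m n p


/-- `[y : T A ⊢ do x ← y; ret f : T B]` for `[x : A ⊢ f : B]`. -/
noncomputable def monMap (e : Eff) {a b : Syn Th} (φ : a ⟶ b) : mon e a ⟶ mon e b :=
  Quotient.map (fun f => ⟨.bind e a.rep b.rep (.var 0) (.ret e f.1),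
      _, _, mk_mon_rep e a, mk_mon_rep e b,
      .bind (.var rfl) (.ret (f.2.hasTy (mk_rep a) (mk_rep b) _))⟩) (by
    intro f f' hf
    exact ⟨_, _, mk_mon_rep e a, mk_mon_rep e b, .bind_eq (.refl _) (.refl _) (.refl (.var rfl))
      (.ret_eq (hf.tmEq f.2 f'.2 (mk_rep a) (mk_rep b) _))⟩) φ

/-- `[x : T T A ⊢ do y ← x; y : T A]` -/
noncomputable def mult (e : Eff) (a : Syn Th) : mon e (mon e a) ⟶ mon e a :=
  of (.bind e (a.rep.mon e) a.rep (.var 0) (.var 0))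
    ⟨_, _, mk_mon e (mk_mon_rep e a), mk_mon_rep e a, .bind (.var rfl) (.var rfl)⟩

/-- `[x : A × T B ⊢ do y ← π₂ x; ret ⟨π₁ x, y⟩ : T (A × B)]` -/
noncomputable def strength (e : Eff) (a b : Syn Th) : prod a (mon e b) ⟶ mon e (prod a b) :=
  of (.bind e b.rep (a.rep.prod b.rep) (.snd a.rep (b.rep.mon e) (.var 0))
      (.ret e (.pair (.fst a.rep (b.rep.mon e) (.var 1)) (.var 0))))
    ⟨_, _, mk_prod (mk_rep a) (mk_mon_rep e b), mk_mon e (mk_prod_rep a b),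
      .bind (.snd (.var rfl)) (.ret (.pair (.fst (.var rfl)) (.var rfl)))⟩

/-- `[x : S A ⊢ ι x : T A]` -/
noncomputable def inclusion (a : Syn Th) : mon .S a ⟶ mon .T a :=
  of (.incl a.rep (.var 0)) ⟨_, _, mk_mon_rep .S a, mk_mon_rep .T a, .incl (.var rfl)⟩

lemma tyEq_mon_rep (e : Eff) (a : Syn Th) : Th.TyEq (a.rep.mon e) (mon e a).rep :=
  mk_eq.1 (by rw [mk_mon_rep, mk_rep])

lemma tyEq_prod_rep (a b : Syn Th) : Th.TyEq (a.rep.prod b.rep) (prod a b).rep :=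
  mk_eq.1 (by rw [mk_prod_rep, mk_rep])

lemma monMap_eq (e : Eff) {a b : Syn Th} (φ : a ⟶ b) :
    monMap e φ = bind e (𝟙 _) (p₂ _ _ ≫ φ ≫ unit e b) := by
  obtain ⟨f, hf, rfl⟩ := exists_of φ
  refine of_eq (mk_rep _) (mk_mon_rep e b) ?_
  have hf' := hf.hasTy (mk_rep a) (mk_rep b) []
  have h₀ : Th.HasTy [a.rep, (mon e a).rep] (.var 0) a.rep := .var rfl
  have h₁ : Th.HasTy [a.rep, (mon e a).rep] (.var 1) (mon e a).rep := .var rfl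
  have e₁ := TmEq.plug hf' (.snd (.pair h₁ h₀)) h₀ (.snd_beta h₁ h₀)
  rw [hf'.plug_var] at e₁
  have e₂ := TmEq.bind_eq (.refl a.rep) (.refl b.rep)
    (.refl (.conv (.var (n := 0) rfl) (tyEq_mon_rep e a).symm)) (TmEq.ret_eq (e := e) e₁)
  simp only [Tm.plug, Tm.subst, Tm.subst_subst] at e₂ ⊢
  exact e₂.symm

lemma mult_eq (e : Eff) (a : Syn Th) : mult e a = bind e (𝟙 _) (p₂ _ _) := by
  refine of_eq (mk_rep _) (mk_mon_rep e a) ?_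
  have q := tyEq_mon_rep e a
  have h₀ : Th.HasTy [a.rep.mon e, (mon e (mon e a)).rep] (.var 0) (mon e a).rep :=
    .conv (.var rfl) q
  have h₁ : Th.HasTy [a.rep.mon e, (mon e (mon e a)).rep] (.var 1) (mon e (mon e a)).rep :=
    .var rfl
  have q' : Th.TyEq (mon e (mon e a)).rep ((a.rep.mon e).mon e) :=
    mk_eq.1 (by rw [mk_rep, mk_mon e (mk_mon_rep e a)])
  exact TmEq.bind_eq q (.refl _) (.refl (.conv (.var rfl) q'))
    ((TmEq.snd_beta h₁ h₀).symm.conv q.symm)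

lemma strength_eq (e : Eff) (a b : Syn Th) : strength e a b =
    bind e (p₂ _ _) (pairing (p₁ _ _ ≫ p₁ _ _) (p₂ _ _) ≫ unit e _) := by
  refine of_eq (mk_rep _) (mk_mon e (mk_prod_rep a b)) ?_
  have q := tyEq_mon_rep e b
  have q' : Th.TyEq (prod a (mon e b)).rep (a.rep.prod (b.rep.mon e)) :=
    mk_eq.1 (by rw [mk_rep, mk_prod (mk_rep a) (mk_mon_rep e b)])
  have h₀ : Th.HasTy [b.rep, (prod a (mon e b)).rep] (.var 0) b.rep := .var rfl
  have h₁ : Th.HasTy [b.rep, (prod a (mon e b)).rep] (.var 1) (prod a (mon e b)).rep := .var rfl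
  have f₁ : Th.TmEq [b.rep, (prod a (mon e b)).rep]
      (.fst a.rep (b.rep.mon e) (.var 1)) (.fst a.rep (mon e b).rep
        (.fst (prod a (mon e b)).rep b.rep (.pair (.var 1) (.var 0)))) a.rep :=
    .fst_eq (.refl _) q ((TmEq.fst_beta h₁ h₀).symm.conv q')
  exact TmEq.bind_eq (.refl _) (tyEq_prod_rep a b)
    ((TmEq.snd_eq (.refl _) q (.refl (.conv (.var rfl) q'))))
    (.ret_eq (.pair_eq f₁ (TmEq.snd_beta h₁ h₀).symm))

/-- The strong monads `T` and `S` of the syntactic category. -/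
noncomputable def strongMonad (Th : Theory.{u, v}) (e : Eff) : StrongMonad (Syn Th) :=
  (doMonad Th e).toStrongMonad (monMap e) (mult e) (strength e) (monMap_eq e) (mult_eq e)
    (fun a b => by rw [lift_eq]; exact strength_eq e a b)

lemma unit_inclusion (a : Syn Th) : unit .S a ≫ inclusion a = unit .T a :=
  of_eq (mk_rep a) (mk_mon_rep .T a) (.incl_ret (.var rfl))

lemma bind_inclusion {a b c : Syn Th} (φ : c ⟶ mon .S a) (ψ : prod c a ⟶ mon .S b) :
    bind .S φ ψ ≫ inclusion b = bind .T (φ ≫ inclusion a) (ψ ≫ inclusion b) := by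
  obtain ⟨m, hm, rfl⟩ := exists_of φ
  obtain ⟨n, hn, rfl⟩ := exists_of ψ
  refine of_eq (mk_rep c) (mk_mon_rep .T b) (TmEq.incl_comp ?_ ?_).symm
  · exact hm.hasTy (mk_rep c) (mk_mon_rep .S a) []
  · exact (hn.hasTy (mk_prod_rep c a) (mk_mon_rep .S b) []).plug
      (.pair (.var rfl) (.var rfl))

instance mono_inclusion (a : Syn Th) : Mono (inclusion a) where
  right_cancellation {c} φ ψ h := by
    obtain ⟨m, hm, rfl⟩ := exists_of φ
    obtain ⟨n, hn, rfl⟩ := exists_of ψ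
    exact of_eq (mk_rep c) (mk_mon_rep .S a)
      (.incl_mono (hm.hasTy (mk_rep c) (mk_mon_rep .S a) [])
        (hn.hasTy (mk_rep c) (mk_mon_rep .S a) [])
        (tmEq_of_eq h (mk_rep c) (mk_mon_rep .T a)))

lemma bind_central {a b c d : Syn Th} (φ : c ⟶ mon .S a) (ψ : c ⟶ mon .T b)
    (χ : prod (prod c a) b ⟶ mon .T d) :
    bind .T (φ ≫ inclusion a) (bind .T (p₁ c a ≫ ψ) χ) =
      bind .T ψ (bind .T (p₁ c b ≫ φ ≫ inclusion a)
        (pairing (pairing (p₁ (prod c b) a ≫ p₁ c b) (p₂ (prod c b) a))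
          (p₁ (prod c b) a ≫ p₂ c b) ≫ χ)) := by
  obtain ⟨m, hm, rfl⟩ := exists_of φ
  obtain ⟨n, hn, rfl⟩ := exists_of ψ
  obtain ⟨p, hp, rfl⟩ := exists_of χ
  refine of_eq (mk_rep c) (mk_mon_rep .T d) ?_
  have hm' := hm.hasTy (mk_rep c) (mk_mon_rep .S a) []
  have hn' := hn.hasTy (mk_rep c) (mk_mon_rep .T b) []
  have hp' := hp.hasTy (mk_prod (mk_prod_rep c a) (mk_rep b)) (mk_mon_rep .T d) []
  have hwkm : m.plug (.var 1) = m.wk := by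
    rw [Tm.wk, Tm.ren_eq_subst]
    exact hm'.subst_congr (by intro n hn; obtain rfl : n = 0 := by simpa using hn
                              rfl)
  have hwkn : n.plug (.var 1) = n.wk := by
    rw [Tm.wk, Tm.ren_eq_subst]
    exact hn'.subst_congr (by intro n hn; obtain rfl : n = 0 := by simpa using hn
                              rfl)
  have k₀ : Th.HasTy [b.rep, a.rep, c.rep] (.var 0) b.rep := .var rfl
  have k₁ : Th.HasTy [b.rep, a.rep, c.rep] (.var 1) a.rep := .var rfl
  have k₂ : Th.HasTy [b.rep, a.rep, c.rep] (.var 2) c.rep := .var rfl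
  have hP := hp'.plug (.pair (.pair k₂ k₁) k₀)
  have e₁ := TmEq.central hm' hn' hP
  have h₀ : Th.HasTy [a.rep, c.rep] (.var 0) a.rep := .var rfl
  have h₁ : Th.HasTy [a.rep, c.rep] (.var 1) c.rep := .var rfl
  have i₀ : Th.HasTy [b.rep, c.rep] (.var 0) b.rep := .var rfl
  have i₁ : Th.HasTy [b.rep, c.rep] (.var 1) c.rep := .var rfl
  have e₂ := TmEq.bind_eq (.refl _) (.refl _) (.refl (.incl hm'))
    (TmEq.bind_eq (.refl _) (.refl _)
      (TmEq.plug hn' (.fst (.pair h₁ h₀)) h₁ (.fst_beta h₁ h₀)) (.refl hP))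
  rw [hwkn] at e₂
  have l₀ : Th.HasTy [a.rep, b.rep, c.rep] (.var 0) a.rep := .var rfl
  have l₁ : Th.HasTy [a.rep, b.rep, c.rep] (.var 1) b.rep := .var rfl
  have l₂ : Th.HasTy [a.rep, b.rep, c.rep] (.var 2) c.rep := .var rfl
  have q := tyEq_prod_rep c b
  have l₂₁ := HasTy.conv (HasTy.pair l₂ l₁) q
  have f₁ := (TmEq.fst_beta l₂₁ l₀).conv q.symm
  have t₁ := HasTy.conv (HasTy.fst (HasTy.pair l₂₁ l₀)) q.symm
  have f₂ := (TmEq.fst_eq (.refl _) (.refl _) f₁).trans (.fst_beta l₂ l₁)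
  have f₃ := (TmEq.snd_eq (.refl _) (.refl _) f₁).trans (.snd_beta l₂ l₁)
  have f₄ := TmEq.snd_beta l₂₁ l₀
  have f₅ := TmEq.plug hp'
    (.pair (.pair (.fst t₁) (.snd (.pair l₂₁ l₀))) (.snd t₁)) (.pair (.pair l₂ l₀) l₁)
    (.pair_eq (.pair_eq f₂ f₄) f₃)
  have e₃ := TmEq.bind_eq (.refl _) (.refl _) (.refl hn')
    (TmEq.bind_eq (.refl _) (.refl _)
      (.incl_eq (.refl _) (TmEq.plug hm' (.fst (.pair i₁ i₀)) i₁ (.fst_beta i₁ i₀))) f₅)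
  rw [hwkm] at e₃
  simp only [Tm.plug, Tm.subst, Tm.ren, Tm.subst_subst, Tm.subst_ren, Tm.up, Tm.wk, Tm.swap]
    at e₁ e₂ e₃ ⊢
  exact e₂.trans (e₁.trans e₃.symm)

/-- The inclusion of the syntactic monad `S` into the syntactic monad `T`. -/
noncomputable def inclusionHom (Th : Theory.{u, v}) :
    StrongMonadHom (strongMonad Th .S) (strongMonad Th .T) where
  app := inclusion
  naturality a b φ := by
    change monMap .S φ ≫ inclusion b = inclusion a ≫ monMap .T φ
    rw [monMap_eq, monMap_eq]
    exact (doMonad Th .S).incl_map (doMonad Th .T) inclusion unit_inclusion bind_inclusion φ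
  app_η a := unit_inclusion a
  app_μ a := by
    change mult .S a ≫ inclusion a = (monMap .S (inclusion a) ≫ inclusion _) ≫ mult .T a
    rw [mult_eq, mult_eq, monMap_eq]
    exact (doMonad Th .S).incl_mu (doMonad Th .T) inclusion unit_inclusion bind_inclusion a
  app_τ a b := by
    change strength .S a b ≫ inclusion _ = a ◁ inclusion b ≫ strength .T a b
    rw [strength_eq, strength_eq, ← lift_eq, ← lift_eq]
    exact (doMonad Th .S).incl_tau (doMonad Th .T) inclusion unit_inclusion bind_inclusion a b

end Syn

/-- The syntactic model `S(Th)`. -/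
noncomputable def S (Th : Theory.{u, v}) : Model.{u, max u v} where
  Obj := Syn Th
  T := Syn.strongMonad Th .T
  S := Syn.strongMonad Th .S
  ι := Syn.inclusionHom Th
  mono a := Syn.mono_inclusion a
  central a := by
    refine (Syn.doMonad Th .T).isCentralCone _ _ _ (Syn.inclusion a) ?_
    intro Z Y W m n p
    rw [Syn.lift_eq, Syn.lift_eq]
    exact Syn.bind_central m n p

end SyntacticModel

end CSC

/-! A strong monad on a category with finite products amounts to a `do`-operator in context:
`StrongMonad.bind` satisfies the laws of `do`, and `map`, `μ` and `τ` are recovered from it. In this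
form the monad rules of the calculus can be read off in every model. A morphism of strong monads
commutes with `do`, and centrality of `ι` becomes the exchange of two consecutive `do`s, since the
two orders of evaluation are the two double strengths (`IsCentralCone.bind_comm`). Type conversion
makes typing derivations non-unique, so the interpretation is the relation `Den`. It is total on
well-formed terms when the type axioms hold in the model. By the annotations on eliminators it is
single-valued up to transport along equalities of objects (`Den.unique`). Soundness
(`TmEq.exists_den`) is then an induction over derivations of equality.

Models. By soundness and the choice of axioms, two types of `L C` are equal exactly when their
interpretations are the same object, and two well-formed terms exactly when their interpretations
are the same morphism. Hence interpretation is a well-defined faithful functor `sem` from `S (L C)`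
to `C`. Naming objects by ground types and morphisms by constants gives a functor `names`;
interpreting a name returns the named thing, and every type equals the name of its interpretation.
That `sem` preserves the structure is a computation of the interpretations of the structure terms.
That `names` preserves it follows, because equations in `S (L C)` may be checked after applying the
faithful functor `sem`.

Theories. The translation W from `L (S Th)` to `Th` chooses a representative of every class of
types, and sends the constant of a morphism to the abstraction of a representative term. The
interpretation in `S Th` of a term M in context Γ is the class of W M with the variables replaced by
the projections from the product of Γ (`Reflect.den_eq`). Therefore W both preserves and reflects
equality of terms. The translation V in the other direction sends a constant c to the constant of
the class of x : 1 ⊢ c, applied to `*`, and a β-step shows that W V is provably the identity. The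
rest is formal: because W reflects equality, V preserves equality and V W is provably the identity
as well. All types involved are provably equal to their images, so the components of the
isomorphisms are just variables. -/

namespace CSC

/-! ### The `do`-operator of a strong monad -/

namespace StrongMonad

variable {C : Type u} [Category.{v} C] [CartesianMonoidalCategory C] (P : StrongMonad C)

/-- Collapsing the context to the unit object commutes with the strength by naturality, and there
the strength is the unitor by `τ_unit`. -/
lemma τ_map_snd (X Y : C) : P.τ X Y ≫ P.map (snd X Y) = snd X (P.obj Y) := by
  have h := P.τ_naturality (toUnit X) (𝟙 Y)
  have h' := P.τ_unit Y
  have e : snd X Y = (toUnit X ⊗ₘ 𝟙 Y) ≫ (λ_ Y).hom := by simp [leftUnitor_hom]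
  rw [e, P.map_comp, ← Category.assoc, ← h, Category.assoc, h']
  simp [leftUnitor_hom]

lemma whiskerLeft_τ (X : C) {Y Y' : C} (f : Y ⟶ Y') :
    X ◁ P.map f ≫ P.τ X Y' = P.τ X Y ≫ P.map (X ◁ f) := by
  simpa using P.τ_naturality (𝟙 X) f

lemma whiskerRight_τ {X X' : C} (f : X ⟶ X') (Y : C) :
    f ▷ P.obj Y ≫ P.τ X' Y = P.τ X Y ≫ P.map (f ▷ Y) := by
  simpa using P.τ_naturality f (𝟙 Y)

/-- Running a computation with the strength keeps the context available for reuse. -/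
lemma lift_fst_τ (Z X : C) :
    lift (fst Z (P.obj X)) (P.τ Z X) ≫ P.τ Z (Z ⊗ X) =
      P.τ Z X ≫ P.map (lift (fst Z X) (𝟙 _)) := by
  have h := P.τ_assoc Z Z X
  have e : lift (fst Z (P.obj X)) (P.τ Z X) =
      lift (𝟙 Z) (𝟙 Z) ▷ P.obj X ≫ (α_ Z Z (P.obj X)).hom ≫ Z ◁ P.τ Z X := by
    ext
    -- The context is duplicated first and one copy is fed to the strength, so that `τ_assoc`
    -- applies; duplication itself passes the strength by naturality.
    · simp
    · have : lift (𝟙 Z) (𝟙 Z) ▷ P.obj X ≫ (α_ Z Z (P.obj X)).hom ≫ snd _ _ = 𝟙 _ := by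
        ext <;> simp
      simp only [lift_snd, Category.assoc, whiskerLeft_snd]
      simp only [← Category.assoc] at this ⊢
      rw [this, Category.id_comp]
  have e' : lift (fst Z X) (𝟙 _) = lift (𝟙 Z) (𝟙 Z) ▷ X ≫ (α_ Z Z X).hom := by
    ext <;> simp
  rw [e, e', Category.assoc, Category.assoc, ← h, reassoc_of% P.whiskerRight_τ, P.map_comp]

/-- The interpretation of `do x ← m; n` in the context `Z`. -/
def bind {Z X Y : C} (m : Z ⟶ P.obj X) (n : Z ⊗ X ⟶ P.obj Y) : Z ⟶ P.obj Y :=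
  lift (𝟙 Z) m ≫ P.τ Z X ≫ P.map n ≫ P.μ.app Y

/-- Naturality of the strength in the context. -/
lemma comp_bind {W Z X Y : C} (f : W ⟶ Z) (m : Z ⟶ P.obj X) (n : Z ⊗ X ⟶ P.obj Y) :
    f ≫ P.bind m n = P.bind (f ≫ m) (lift (fst W X ≫ f) (snd W X) ≫ n) := by
  rw [← DoMonad.whiskerRight_eq_lift, bind, bind, P.map_comp, Category.assoc,
    ← reassoc_of% P.whiskerRight_τ]
  simp only [← Category.assoc]
  simp

/-- The unit of a strong monad. -/
def ret (X : C) : X ⟶ P.obj X := P.η.app X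

lemma ret_bind {Z X Y : C} (m : Z ⟶ X) (n : Z ⊗ X ⟶ P.obj Y) :
    P.bind (m ≫ P.ret X) n = lift (𝟙 Z) m ≫ n := by
  have e : lift (𝟙 Z) (m ≫ P.η.app X) = lift (𝟙 Z) m ≫ Z ◁ P.η.app X := by simp
  have h := P.η.naturality n
  simp only [Functor.id_map] at h
  rw [bind, ret, e, Category.assoc, ← Category.assoc (Z ◁ _), P.τ_η, ← Category.assoc (P.η.app _),
    ← h, Category.assoc]
  erw [P.left_unit]
  simp

lemma bind_ret {Z X : C} (m : Z ⟶ P.obj X) : P.bind m (snd Z X ≫ P.ret X) = m := by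
  rw [bind, ret, P.map_comp, Category.assoc, reassoc_of% P.τ_map_snd]
  erw [P.right_unit]
  simp

/-- By `lift_fst_τ` the context survives the run of `m` and is still paired with its result. Then
`τ_μ` moves the inner multiplication past the second strength, and associativity of `μ` regroups the
three effects. -/
lemma bind_bind {Z X Y W : C} (m : Z ⟶ P.obj X) (n : Z ⊗ X ⟶ P.obj Y) (p : Z ⊗ Y ⟶ P.obj W) :
    P.bind (P.bind m n) p =
      P.bind m (P.bind n (lift (fst (Z ⊗ X) Y ≫ fst Z X) (snd (Z ⊗ X) Y) ≫ p)) := by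
  have e : lift (𝟙 Z) (P.bind m n) = lift (𝟙 Z) m ≫ lift (fst _ _) (P.τ Z X) ≫
      Z ◁ P.map n ≫ Z ◁ P.μ.app Y := by
    simp [bind]
  have e' : lift (fst Z X) (𝟙 _) ≫ Z ◁ n ≫ P.τ Z Y =
      lift (𝟙 _) n ≫ P.τ (Z ⊗ X) Y ≫ P.map (fst Z X ▷ Y) := by
    rw [← whiskerRight_τ, ← Category.assoc, ← Category.assoc]
    simp
  have hμ := P.μ.naturality p
  have hμ' := P.assoc W
  simp only [Functor.comp_map] at hμ
  rw [bind, e]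
  simp only [Category.assoc]
  rw [reassoc_of% P.τ_μ Z Y, reassoc_of% P.whiskerLeft_τ, ← Category.assoc (lift (fst _ _) _),
    lift_fst_τ, ← DoMonad.whiskerRight_eq_lift]
  simp only [bind, P.map_comp, Category.assoc]
  rw [hμ', ← reassoc_of% hμ]
  simp only [← P.map_comp_assoc]
  rw [reassoc_of% e']

/-- `ret_bind` for right-associated composites, the form in which `simp` leaves them. -/
lemma comp_ret_bind {Z W X Y : C} (l : Z ⟶ W) (m : W ⟶ X) (n : Z ⊗ X ⟶ P.obj Y) :
    P.bind (l ≫ m ≫ P.ret X) n = lift (𝟙 Z) (l ≫ m) ≫ n := by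
  rw [← Category.assoc, P.ret_bind]

/-- Together with `μ_eq_bind` and `τ_eq_bind` this turns an equation between diagrams of structure
maps into an equation of `do`-expressions, which the `do`-laws decide as rewriting rules. -/
lemma map_eq_bind {X Y : C} (f : X ⟶ Y) :
    P.map f = P.bind (𝟙 _) (snd _ _ ≫ f ≫ P.ret Y) := by
  simp only [bind, ret, P.map_comp, Category.assoc, reassoc_of% P.τ_map_snd]
  erw [P.right_unit]
  simp

lemma μ_eq_bind (X : C) : P.μ.app X = P.bind (𝟙 (P.obj (P.obj X))) (snd _ _) := by
  simp [bind, reassoc_of% P.τ_map_snd]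

lemma τ_eq_bind (X Y : C) : P.τ X Y = P.bind (snd X (P.obj Y))
    (lift (fst _ _ ≫ fst _ _) (snd _ _) ≫ P.ret _) := by
  simp only [bind, ret, P.map_comp, Category.assoc,
    ← DoMonad.whiskerRight_eq_lift, ← reassoc_of% P.whiskerRight_τ]
  erw [P.right_unit]
  simp only [← Category.assoc]
  simp

attribute [local simp] comp_bind ret_bind bind_ret bind_bind comp_ret_bind comp_lift_assoc
  DoMonad.tensorHom_eq_lift DoMonad.whiskerLeft_eq_lift DoMonad.whiskerRight_eq_lift
  DoMonad.associator_eq_lift leftUnitor_hom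

/-- The left sides here and in `bind_snd` and `bind_lift` are bracketed exactly as `Den` interprets
the terms for `map`, `μ` and `τ` in the syntactic model. -/
lemma bind_map {Z X Y : C} (m : Z ⟶ P.obj X) (f : X ⟶ Y) :
    P.bind m ((snd Z X ≫ f) ≫ P.ret Y) = m ≫ P.map f := by
  simp [map_eq_bind, -lift_fst_comp_snd_comp]

lemma bind_snd {Z X : C} (m : Z ⟶ P.obj (P.obj X)) : P.bind m (snd _ _) = m ≫ P.μ.app X := by
  simp [μ_eq_bind, -lift_fst_comp_snd_comp]

lemma bind_lift {Z X Y : C} (m : Z ⟶ X ⊗ P.obj Y) :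
    P.bind (m ≫ snd _ _) (lift ((fst Z Y ≫ m) ≫ fst _ _) (snd Z Y) ≫ P.ret _) = m ≫ P.τ X Y := by
  simp [τ_eq_bind, -lift_fst_comp_snd_comp]

/-- Running two computations in sequence is running their double strength. -/
lemma bind_dst {Z X Y W : C} (m : Z ⟶ P.obj X) (n : Z ⟶ P.obj Y) (p : (Z ⊗ X) ⊗ Y ⟶ P.obj W) :
    P.bind (lift m n ≫ P.dst X Y) ((α_ Z X Y).inv ≫ p) = P.bind m (P.bind (fst Z X ≫ n) p) := by
  have e : (α_ Z X Y).inv = lift (lift (fst _ _) (snd _ _ ≫ fst _ _)) (snd _ _ ≫ snd _ _) := by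
    ext <;> simp
  rw [e, dst, τ']
  simp only [map_eq_bind, μ_eq_bind, τ_eq_bind, swapHom]
  simp [-lift_fst_comp_snd_comp]

lemma bind_dst' {Z X Y W : C} (m : Z ⟶ P.obj X) (n : Z ⟶ P.obj Y) (p : (Z ⊗ X) ⊗ Y ⟶ P.obj W) :
    P.bind (lift m n ≫ P.dst' X Y) ((α_ Z X Y).inv ≫ p) = P.bind n (P.bind (fst Z Y ≫ m)
      (lift (lift (fst (Z ⊗ Y) X ≫ fst Z Y) (snd (Z ⊗ Y) X)) (fst (Z ⊗ Y) X ≫ snd Z Y) ≫ p)) := by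
  have e : (α_ Z X Y).inv = lift (lift (fst _ _) (snd _ _ ≫ fst _ _)) (snd _ _ ≫ snd _ _) := by
    ext <;> simp
  rw [e, dst', τ']
  simp only [map_eq_bind, μ_eq_bind, τ_eq_bind, swapHom]
  simp [-lift_fst_comp_snd_comp]

/-- Both sides are a single `bind` along a double strength, by `bind_dst` and `bind_dst'`. Pulling
`j` out of the pair leaves the two composites that centrality identifies. -/
lemma IsCentralCone.bind_comm {P : StrongMonad C} {R Z X Y W : C} {j : R ⟶ P.obj X}
    (hj : P.IsCentralCone j) (m : Z ⟶ R) (n : Z ⟶ P.obj Y) (p : (Z ⊗ X) ⊗ Y ⟶ P.obj W) :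
    P.bind (m ≫ j) (P.bind (fst Z X ≫ n) p) = P.bind n (P.bind (fst Z Y ≫ m ≫ j)
      (lift (lift (fst (Z ⊗ Y) X ≫ fst Z Y) (snd (Z ⊗ Y) X)) (fst (Z ⊗ Y) X ≫ snd Z Y) ≫ p)) := by
  have e : lift (m ≫ j) n = lift m n ≫ j ▷ P.obj Y := by simp
  rw [← bind_dst, ← bind_dst', e, Category.assoc, Category.assoc, hj]

end StrongMonad

namespace StrongMonadHom

variable {C : Type u} [Category.{v} C] [CartesianMonoidalCategory C] {P Q : StrongMonad C}

/-- Compatibility with `τ` and `μ` plus two uses of naturality. This is the semantic content of the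
rule `incl_comp`. -/
lemma bind_app (j : StrongMonadHom P Q) {Z X Y : C} (m : Z ⟶ P.obj X) (n : Z ⊗ X ⟶ P.obj Y) :
    P.bind m n ≫ j.app Y = Q.bind (m ≫ j.app X) (n ≫ j.app Y) := by
  have e : lift (𝟙 Z) (m ≫ j.app X) = lift (𝟙 Z) m ≫ Z ◁ j.app X := by simp
  have hμ := j.app_μ Y
  have hn := j.naturality n
  have hY := j.naturality (j.app Y)
  simp only [StrongMonad.bind, Category.assoc, e, Q.map_comp]
  rw [hμ, ← reassoc_of% j.app_τ Z X, ← reassoc_of% hn]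
  simp only [Category.assoc]
  rw [reassoc_of% hY]

end StrongMonadHom

/-- The passage from `do`-operators to strong monads and back loses nothing, so `do` in the
syntactic model is interpreted by syntactic `do`. -/
lemma DoMonad.bind_toStrongMonad {C : Type u} [Category.{v} C] [CartesianMonoidalCategory C]
    (D : DoMonad C) {mapD muD tauD}
    (hmap : ∀ {X Y : C} (f : X ⟶ Y), mapD f = D.bind (𝟙 _) (snd _ _ ≫ f ≫ D.ret Y))
    (hmu : ∀ X : C, muD X = D.bind (𝟙 _) (snd _ _))
    (htau : ∀ X Y : C,
      tauD X Y = D.bind (snd _ _) (lift (fst _ _ ≫ fst _ _) (snd _ _) ≫ D.ret _))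
    {Z X Y : C} (m : Z ⟶ D.T X) (n : Z ⊗ X ⟶ D.T Y) :
    (D.toStrongMonad mapD muD tauD hmap hmu htau).bind m n = D.bind m n := by
  change lift (𝟙 Z) m ≫ tauD Z X ≫ mapD n ≫ muD Y = _
  simp [hmap, hmu, htau, D.comp_bind, D.bind_bind, D.comp_ret_bind, D.ret_bind, comp_lift_assoc,
    -lift_fst_comp_snd_comp]

open Tm Signature Theory

/-! ### Presuppositions of the judgements -/

namespace Signature

variable {sg : Signature.{u, v}}

/-- There is no typing rule that converts the types of a context; the identity substitution, with
`conv` at each variable, takes its place. -/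
lemma IsSubst.var_of_tyEq {Γ Δ : List sg.Typ}
    (h : ∀ (n : ℕ) (A : sg.Typ), Γ[n]? = some A → ∃ B, Δ[n]? = some B ∧ sg.TyEq B A) :
    sg.IsSubst Δ Γ .var := by
  intro n A hn
  obtain ⟨B, hB, e⟩ := h n A hn
  exact .conv (.var hB) e

lemma IsSubst.var_head {A A' : sg.Typ} (h : sg.TyEq A A') (Γ : List sg.Typ) :
    sg.IsSubst (A' :: Γ) (A :: Γ) .var := by
  refine IsSubst.var_of_tyEq fun n B hn => ?_
  cases n with
  | zero =>
    obtain rfl : A = B := by simpa using hn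
    exact ⟨A', rfl, h.symm⟩
  | succ n => exact ⟨B, by simpa using hn, .refl _⟩

lemma HasTy.conv_head {A A' B : sg.Typ} {Γ M} (h : sg.HasTy (A :: Γ) M B) (e : sg.TyEq A A') :
    sg.HasTy (A' :: Γ) M B := by
  simpa only [subst_var] using h.subst (.var_head e Γ)

lemma HasTy.swap {A B C : sg.Typ} {Γ M} (h : sg.HasTy (B :: A :: Γ) M C) :
    sg.HasTy (A :: B :: Γ) (M.ren Tm.swap) C := by
  refine h.ren fun n D hn => ?_
  match n with
  | 0 => simpa [Tm.swap] using hn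
  | 1 => simpa [Tm.swap] using hn
  | n + 2 => simpa [Tm.swap] using hn

lemma HasTy.wk_upr {A B C : sg.Typ} {Γ M} (h : sg.HasTy (B :: Γ) M C) :
    sg.HasTy (B :: A :: Γ) (M.ren (upr Nat.succ)) C := by
  refine h.ren fun n D hn => ?_
  match n with
  | 0 => simpa [upr] using hn
  | n + 1 => simpa [upr] using hn

lemma HasTy.subst_of_nil {M A} (h : sg.HasTy [] M A) (σ : ℕ → sg.Term) : M.subst σ = M := by
  conv_rhs => rw [← M.subst_var]
  exact h.subst_congr (by simp)

lemma HasTy.of_nil {M A} (h : sg.HasTy [] M A) (Γ : List sg.Typ) : sg.HasTy Γ M A := by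
  have := h.subst (Δ := Γ) (σ := .var) (by intro n A hn; simp at hn)
  rwa [subst_var] at this

end Signature

namespace Theory

variable {Th : Theory.{u, v}}

/-- In the congruence rules the right side carries different annotations, hence has the expected
type only after converting its parts to the new annotations and the result back. -/
lemma TmEq.hasTy {Γ M N A} (h : Th.TmEq Γ M N A) : Th.HasTy Γ M A ∧ Th.HasTy Γ N A := by
  induction h with
  | ax h => exact ⟨Th.tmAx_left h, Th.tmAx_right h⟩
  | refl h => exact ⟨h, h⟩
  | symm _ ih => exact ih.symm
  | trans _ _ ih₁ ih₂ => exact ⟨ih₁.1, ih₂.2⟩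
  | conv _ e ih => exact ⟨ih.1.conv e, ih.2.conv e⟩
  | subst _ hσ ih => exact ⟨ih.1.subst hσ, ih.2.subst hσ⟩
  | one_eta h => exact ⟨.star, h⟩
  | pair_eq _ _ ih₁ ih₂ => exact ⟨.pair ih₁.1 ih₂.1, .pair ih₁.2 ih₂.2⟩
  | fst_eq e e' _ ih => exact ⟨.fst ih.1, .conv (.fst (ih.2.conv (.prod e e'))) e.symm⟩
  | snd_eq e e' _ ih => exact ⟨.snd ih.1, .conv (.snd (ih.2.conv (.prod e e'))) e'.symm⟩
  | fst_beta h h' => exact ⟨.fst (.pair h h'), h⟩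
  | snd_beta h h' => exact ⟨.snd (.pair h h'), h'⟩
  | prod_eta h => exact ⟨.pair (.fst h) (.snd h), h⟩
  | app_eq e e' _ _ ih₁ ih₂ =>
    exact ⟨.app ih₁.1 ih₂.1, .conv (.app (ih₁.2.conv (.arr e e')) (ih₂.2.conv e)) e'.symm⟩
  | lam_eq e _ ih =>
    exact ⟨.lam ih.1, .conv (.lam (ih.2.conv_head e)) (.arr e.symm (.refl _))⟩
  | lam_beta h h' => exact ⟨.app (.lam h) h', h.subst (isSubst_substOne h')⟩
  | lam_eta h => exact ⟨.lam (.app (h.wk _) (.var rfl)), h⟩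
  | ret_eq _ ih => exact ⟨.ret ih.1, .ret ih.2⟩
  | bind_eq e e' _ _ ih₁ ih₂ =>
    exact ⟨.bind ih₁.1 ih₂.1, .conv (.bind (ih₁.2.conv (.mon _ e))
      ((ih₂.2.conv_head e).conv (.mon _ e'))) (.mon _ e'.symm)⟩
  | mon_beta h h' => exact ⟨.bind (.ret h) h', h'.subst (isSubst_substOne h)⟩
  | mon_eta h => exact ⟨.bind h (.ret (.var rfl)), h⟩
  | mon_assoc h₁ h₂ h₃ => exact ⟨.bind (.bind h₁ h₂) h₃, .bind h₁ (.bind h₂ h₃.wk_upr)⟩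
  | central h₁ h₂ h₃ =>
    exact ⟨.bind (.incl h₁) (.bind (h₂.wk _) h₃), .bind h₂ (.bind (.incl (h₁.wk _)) h₃.swap)⟩
  | incl_eq e _ ih =>
    exact ⟨.incl ih.1, .conv (.incl (ih.2.conv (.mon _ e))) (.mon _ e.symm)⟩
  | incl_mono h h' => exact ⟨h, h'⟩
  | incl_ret h => exact ⟨.incl (.ret h), .ret h⟩
  | incl_comp h h' => exact ⟨.bind (.incl h) (.incl h'), .incl (.bind h h')⟩

lemma TmEq.wk {Γ M N A} (B : Th.Typ) (h : Th.TmEq Γ M N A) : Th.TmEq (B :: Γ) M.wk N.wk A := by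
  rw [Tm.wk, Tm.wk, ren_eq_subst, ren_eq_subst]
  exact .subst h fun n A hn => .var (by simpa using hn)

/-- Substitutions with equal values give equal terms. -/
lemma TmEq.subst_congr {Γ M A} (h : Th.HasTy Γ M A) : ∀ {Δ} {σ τ : ℕ → Th.Term},
    (∀ n A, Γ[n]? = some A → Th.TmEq Δ (σ n) (τ n) A) →
    Th.TmEq Δ (M.subst σ) (M.subst τ) A := by
  have hup : ∀ {Γ Δ : List Th.Typ} {C : Th.Typ} {σ τ : ℕ → Th.Term},
      (∀ n A, Γ[n]? = some A → Th.TmEq Δ (σ n) (τ n) A) →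
      ∀ n A, (C :: Γ)[n]? = some A → Th.TmEq (C :: Δ) (up σ n) (up τ n) A := by
    intro Γ Δ C σ τ h n A hn
    cases n with
    | zero => exact .refl (.var hn)
    | succ n => exact (h n A (by simpa using hn)).wk C
  induction h with
  | var hn => intro Δ σ τ h; exact h _ _ hn
  | const c => intros; exact .refl (.const c)
  | star => intros; exact .refl .star
  | lam _ ih => intro Δ σ τ h; exact .lam_eq (.refl _) (ih (hup h))
  | app _ _ ih₁ ih₂ => intro Δ σ τ h; exact .app_eq (.refl _) (.refl _) (ih₁ h) (ih₂ h)
  | pair _ _ ih₁ ih₂ => intro Δ σ τ h; exact .pair_eq (ih₁ h) (ih₂ h)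
  | fst _ ih => intro Δ σ τ h; exact .fst_eq (.refl _) (.refl _) (ih h)
  | snd _ ih => intro Δ σ τ h; exact .snd_eq (.refl _) (.refl _) (ih h)
  | ret _ ih => intro Δ σ τ h; exact .ret_eq (ih h)
  | incl _ ih => intro Δ σ τ h; exact .incl_eq (.refl _) (ih h)
  | bind _ _ ih₁ ih₂ => intro Δ σ τ h; exact .bind_eq (.refl _) (.refl _) (ih₁ h) (ih₂ (hup h))
  | conv _ e ih => intro Δ σ τ h; exact .conv (ih h) e

end Theory

/-! ### The interpretation -/

section Interpretation

variable {C : Model.{u₁, v₁}} {sg : Signature.{u, v}} {g : sg.Ground → C.Obj}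
  {k : ∀ c : sg.Const, 𝟙_ C.Obj ⟶ tyDen C g (sg.constTy c)}

/-- The instance argument of `ihom X` depends on `X`, so the equality is obtained by substitution of
variables instead of rewriting. -/
lemma congr_ihom_obj {X X' Y Y' : C.Obj} (h : X = X') (h' : Y = Y') :
    (ihom X).obj Y = (ihom X').obj Y' := by subst h h'; rfl

lemma tyDen_eq_of_tyEq (hg : ∀ A B, sg.tyAx A B → tyDen C g A = tyDen C g B) {A B : sg.Typ}
    (h : sg.TyEq A B) : tyDen C g A = tyDen C g B := by
  induction h with
  | ax h => exact hg _ _ h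
  | refl => rfl
  | symm _ ih => exact ih.symm
  | trans _ _ ih₁ ih₂ => exact ih₁.trans ih₂
  | prod _ _ ih₁ ih₂ => simp only [tyDen, ih₁, ih₂]
  | arr _ _ ih₁ ih₂ => exact congr_ihom_obj ih₁ ih₂
  | mon e _ ih => simp only [tyDen, ih]

namespace Den

lemma hasTy {Γ M A f} (h : Den C g k Γ M A f) : sg.HasTy Γ M A := by
  induction h with
  | var_zero => exact .var rfl
  | @var_succ Γ A B n f _ ih =>
    have := ih.wk B
    exact this
  | const c => exact .const c
  | star => exact .star
  | lam _ ih => exact .lam ih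
  | app _ _ ih₁ ih₂ => exact .app ih₁ ih₂
  | pair _ _ ih₁ ih₂ => exact .pair ih₁ ih₂
  | fst _ ih => exact .fst ih
  | snd _ ih => exact .snd ih
  | ret _ ih => exact .ret ih
  | incl _ ih => exact .incl ih
  | bind _ _ ih₁ ih₂ => exact .bind ih₁ ih₂
  | conv _ e _ ih => exact .conv ih e

lemma exists_var {Γ : List sg.Typ} {n A} (h : Γ[n]? = some A) : ∃ f, Den C g k Γ (.var n) A f := by
  induction Γ generalizing n with
  | nil => simp at h
  | cons B Γ ih =>
    cases n with
    | zero =>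
      obtain rfl : B = A := by simpa using h
      exact ⟨_, .var_zero⟩
    | succ n =>
      obtain ⟨f, hf⟩ := ih (by simpa using h)
      exact ⟨_, .var_succ hf⟩

lemma exists_of_hasTy (hg : ∀ A B, sg.tyAx A B → tyDen C g A = tyDen C g B) {Γ M A}
    (h : sg.HasTy Γ M A) : ∃ f, Den C g k Γ M A f := by
  induction h with
  | var h => exact exists_var h
  | const c => exact ⟨_, .const c⟩
  | star => exact ⟨_, .star⟩
  | lam _ ih => exact ⟨_, .lam ih.choose_spec⟩
  | app _ _ ih₁ ih₂ => exact ⟨_, .app ih₁.choose_spec ih₂.choose_spec⟩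
  | pair _ _ ih₁ ih₂ => exact ⟨_, .pair ih₁.choose_spec ih₂.choose_spec⟩
  | fst _ ih => exact ⟨_, .fst ih.choose_spec⟩
  | snd _ ih => exact ⟨_, .snd ih.choose_spec⟩
  | ret _ ih => exact ⟨_, .ret ih.choose_spec⟩
  | incl _ ih => exact ⟨_, .incl ih.choose_spec⟩
  | bind _ _ ih₁ ih₂ => exact ⟨_, .bind ih₁.choose_spec ih₂.choose_spec⟩
  | conv _ e ih => exact ⟨_, .conv ih.choose_spec e (tyDen_eq_of_tyEq hg e)⟩

variable (C g k) in
/-- The interpretations of a variable by the two rules for variables. -/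
def VarCore (n : ℕ) : (Γ : List sg.Typ) → (Σ A : sg.Typ, ctxDen C g Γ ⟶ tyDen C g A) → Prop
  | [], _ => False
  | A :: Γ, x => match n with
    | 0 => x = ⟨A, CartesianMonoidalCategory.snd _ _⟩
    | n + 1 => ∃ B f, Den C g k Γ (.var n) B f ∧
      x = ⟨B, CartesianMonoidalCategory.fst _ _ ≫ f⟩

variable (C g k) in
/-- The interpretations of a term by the rule of its outermost term former. -/
def Core (Γ : List sg.Typ) : sg.Term → (Σ A : sg.Typ, ctxDen C g Γ ⟶ tyDen C g A) → Prop
  | .var n, x => VarCore C g k n Γ x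
  | .const c, x => x = ⟨sg.constTy c, toUnit _ ≫ k c⟩
  | .star, x => x = ⟨.one, toUnit _⟩
  | .lam A M, x => ∃ B f, Den C g k (A :: Γ) M B f ∧
      x = ⟨.arr A B, MonoidalClosed.curry (swapHom (tyDen C g A) (ctxDen C g Γ) ≫ f)⟩
  | .app A B M N, x => ∃ f h, Den C g k Γ M (.arr A B) f ∧ Den C g k Γ N A h ∧
      x = ⟨B, lift h f ≫ (ihom.ev (tyDen C g A)).app (tyDen C g B)⟩
  | .pair M N, x => ∃ A B f h, Den C g k Γ M A f ∧ Den C g k Γ N B h ∧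
      x = ⟨.prod A B, lift f h⟩
  | .fst A B M, x => ∃ f, Den C g k Γ M (.prod A B) f ∧
      x = ⟨A, f ≫ CartesianMonoidalCategory.fst _ _⟩
  | .snd A B M, x => ∃ f, Den C g k Γ M (.prod A B) f ∧
      x = ⟨B, f ≫ CartesianMonoidalCategory.snd _ _⟩
  | .ret e M, x => ∃ A f, Den C g k Γ M A f ∧
      x = ⟨.mon e A, f ≫ (C.monad e).η.app (tyDen C g A)⟩
  | .incl A M, x => ∃ f, Den C g k Γ M (.mon .S A) f ∧
      x = ⟨.mon .T A, f ≫ C.ι.app (tyDen C g A)⟩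
  | .bind e A B M N, x => ∃ f h, Den C g k Γ M (.mon e A) f ∧
      Den C g k (A :: Γ) N (.mon e B) h ∧ x = ⟨.mon e B, (C.monad e).bind f h⟩

/-- Inversion for `Den`: a derivation is one structural rule followed by conversions, which compose
to one transport. Packing type and morphism into a pair avoids inverting a relation whose last index
has a type depending on another index. -/
lemma exists_core {Γ M A f} (h : Den C g k Γ M A f) : ∃ x, Core C g k Γ M x ∧ sg.TyEq x.1 A ∧
    ∃ e : tyDen C g x.1 = tyDen C g A, f = x.2 ≫ eqToHom e := by
  have key : ∀ {Γ M A f}, Core C g k Γ M ⟨A, f⟩ → ∃ x, Core C g k Γ M x ∧ sg.TyEq x.1 A ∧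
      ∃ e : tyDen C g x.1 = tyDen C g A, f = x.2 ≫ eqToHom e :=
    fun h => ⟨_, h, .refl _, rfl, by simp⟩
  induction h with
  | var_zero => exact key rfl
  | var_succ h => exact key ⟨_, _, h, rfl⟩
  | const c => exact key rfl
  | star => exact key rfl
  | lam h => exact key ⟨_, _, h, rfl⟩
  | app h h' => exact key ⟨_, _, h, h', rfl⟩
  | pair h h' => exact key ⟨_, _, _, _, h, h', rfl⟩
  | fst h => exact key ⟨_, h, rfl⟩
  | snd h => exact key ⟨_, h, rfl⟩
  | ret h => exact key ⟨_, _, h, rfl⟩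
  | incl h => exact key ⟨_, h, rfl⟩
  | bind h h' => exact key ⟨_, _, h, h', rfl⟩
  | conv _ he hAB ih =>
    obtain ⟨x, hx, he', e, rfl⟩ := ih
    exact ⟨x, hx, he'.trans he, e.trans hAB, by simp⟩

/-- This and the next three lemmas move a transport out of a term former. They speak of arbitrary
objects so that the equality can be eliminated, which is impossible for an equality between two
values of `tyDen`. -/
lemma comp_eqToHom_comp {W X Y Y' Z : C.Obj} (e : Y = Y') (e' : Y' = Z) (h : W ⟶ X) (f : X ⟶ Y) :
    (h ≫ f ≫ eqToHom e) ≫ eqToHom e' = (h ≫ f) ≫ eqToHom (e.trans e') := by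
  simp

lemma η_eqToHom_comp (P : StrongMonad C.Obj) {X Y Y' Z : C.Obj} (e : Y = Y') (e' : P.obj Y' = Z)
    (f : X ⟶ Y) : ((f ≫ eqToHom e) ≫ P.η.app Y') ≫ eqToHom e' =
      (f ≫ P.η.app Y) ≫ eqToHom ((congrArg P.obj e).trans e') := by
  subst e; simp

lemma lift_eqToHom_comp {Z X X' Y Y' W : C.Obj} (e : X = X') (e' : Y = Y') (e'' : X' ⊗ Y' = W)
    (f : Z ⟶ X) (h : Z ⟶ Y) : lift (f ≫ eqToHom e) (h ≫ eqToHom e') ≫ eqToHom e'' =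
      lift f h ≫ eqToHom ((congrArg₂ _ e e').trans e'') := by
  subst e e'; simp

lemma curry_eqToHom_comp {Z X Y Y' W V : C.Obj} (e : Y = Y') (e' : (ihom X).obj Y' = W)
    (s : X ⊗ Z ⟶ V) (f : V ⟶ Y) : MonoidalClosed.curry (s ≫ f ≫ eqToHom e) ≫ eqToHom e' =
      MonoidalClosed.curry (s ≫ f) ≫ eqToHom ((congr_ihom_obj rfl e).trans e') := by
  subst e; simp

/-- The interpretations of a term at two types agree up to an equality of the types. -/
lemma unique {Γ M A f} (h : Den C g k Γ M A f) : ∀ {B f'}, Den C g k Γ M B f' →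
    sg.TyEq A B ∧ ∃ e : tyDen C g A = tyDen C g B, f' = f ≫ eqToHom e := by
  induction h with
  | conv _ he hAB ih =>
    intro B f' h'
    obtain ⟨he', e, rfl⟩ := ih h'
    exact ⟨he.symm.trans he', hAB.symm.trans e, by simp⟩
  | var_zero =>
    intro B f' h'
    obtain ⟨x, rfl, he, e, rfl⟩ := h'.exists_core
    exact ⟨he, e, rfl⟩
  | var_succ _ ih =>
    intro B f' h'
    obtain ⟨x, ⟨A', f, hf, rfl⟩, he, e, rfl⟩ := h'.exists_core
    obtain ⟨he', e', rfl⟩ := ih hf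
    exact ⟨he'.trans he, e'.trans e, comp_eqToHom_comp _ _ _ _⟩
  | const | star =>
    intro B f' h'
    obtain ⟨x, rfl, he, e, rfl⟩ := h'.exists_core
    exact ⟨he, e, rfl⟩
  | lam _ ih =>
    intro B f' h'
    obtain ⟨x, ⟨A', f, hf, rfl⟩, he, e, rfl⟩ := h'.exists_core
    obtain ⟨he', e', rfl⟩ := ih hf
    refine ⟨.trans (.arr (.refl _) he') he, (congr_ihom_obj rfl e').trans e, ?_⟩
    exact curry_eqToHom_comp _ _ _ _
  | app _ _ ih₁ ih₂ =>
    intro B f' h'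
    obtain ⟨x, ⟨f, h, hf, hh, rfl⟩, he, e, rfl⟩ := h'.exists_core
    -- The annotations fix the types of both subterms, so the induction hypotheses supply transports
    -- along equalities of an object with itself, which are identities. Without annotations the
    -- argument type could differ between derivations.
    obtain ⟨-, _, rfl⟩ := ih₁ hf
    obtain ⟨-, _, rfl⟩ := ih₂ hh
    exact ⟨he, e, by simp⟩
  | pair _ _ ih₁ ih₂ =>
    intro B f' h'
    obtain ⟨x, ⟨A₁, A₂, f, h, hf, hh, rfl⟩, he, e, rfl⟩ := h'.exists_core
    obtain ⟨he₁, e₁, rfl⟩ := ih₁ hf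
    obtain ⟨he₂, e₂, rfl⟩ := ih₂ hh
    refine ⟨.trans (.prod he₁ he₂) he, (congrArg₂ _ e₁ e₂).trans e, ?_⟩
    exact lift_eqToHom_comp _ _ _ _ _
  | fst _ ih | snd _ ih | incl _ ih =>
    intro B f' h'
    obtain ⟨x, ⟨f, hf, rfl⟩, he, e, rfl⟩ := h'.exists_core
    obtain ⟨-, _, rfl⟩ := ih hf
    exact ⟨he, e, by simp⟩
  | ret _ ih =>
    intro B f' h'
    obtain ⟨x, ⟨A', f, hf, rfl⟩, he, e, rfl⟩ := h'.exists_core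
    obtain ⟨he', e', rfl⟩ := ih hf
    refine ⟨.trans (.mon _ he') he, (congrArg (C.monad _).obj e').trans e, ?_⟩
    exact η_eqToHom_comp _ _ _ _
  | bind _ _ ih₁ ih₂ =>
    intro B f' h'
    obtain ⟨x, ⟨f, h, hf, hh, rfl⟩, he, e, rfl⟩ := h'.exists_core
    obtain ⟨-, _, rfl⟩ := ih₁ hf
    obtain ⟨-, _, rfl⟩ := ih₂ hh
    exact ⟨he, e, by simp only [eqToHom_refl, Category.comp_id]; rfl⟩

lemma eq {Γ M A f f'} (h : Den C g k Γ M A f) (h' : Den C g k Γ M A f') : f = f' := by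
  obtain ⟨-, e, rfl⟩ := h.unique h'
  simp

end Den

end Interpretation

section Soundness

variable {C : Model.{u₁, v₁}} {sg : Signature.{u, v}} {g : sg.Ground → C.Obj}
  {k : ∀ c : sg.Const, 𝟙_ C.Obj ⟶ tyDen C g (sg.constTy c)}

/-! ### Interpretation of substitutions -/

lemma comp_comp_assoc {V W X Y Z : C.Obj} (s : V ⟶ W) (a : W ⟶ X) (f : X ⟶ Y) (e : Y ⟶ Z) :
    ((s ≫ a) ≫ f) ≫ e = s ≫ (a ≫ f) ≫ e := by simp

lemma lift_comp_comp {W Z X Y V : C.Obj} (s : W ⟶ Z) (f : Z ⟶ X) (h : Z ⟶ Y) (p : X ⊗ Y ⟶ V) :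
    lift (s ≫ f) (s ≫ h) ≫ p = s ≫ lift f h ≫ p := by
  rw [← comp_lift, Category.assoc]

lemma Den.congr {Γ M A f f'} (h : Den C g k Γ M A f) (e : f = f') : Den C g k Γ M A f' := e ▸ h

variable (C g k) in
/-- The morphism `s` interprets the substitution `σ` from the context `Γ` to the context `Δ`. -/
def DenSubst (Δ Γ : List sg.Typ) (σ : ℕ → sg.Term) (s : ctxDen C g Δ ⟶ ctxDen C g Γ) : Prop :=
  ∀ n A f, Den C g k Γ (.var n) A f → Den C g k Δ (σ n) A (s ≫ f)

namespace DenSubst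

lemma id (Γ : List sg.Typ) : DenSubst C g k Γ Γ .var (𝟙 _) :=
  fun _ _ _ h => h.congr (Category.id_comp _).symm

lemma nil {Δ : List sg.Typ} {σ s} : DenSubst C g k Δ [] σ s := by
  intro n A f h
  obtain ⟨x, hx, -⟩ := h.exists_core
  exact hx.elim

/-- The projections of `s` are prescribed by equations instead of taking `s` to be `lift t a`, so
that `s` may be given in any form. -/
lemma cons {Δ Γ : List sg.Typ} {A σ s t a} (ht : DenSubst C g k Δ Γ (fun n => σ (n + 1)) t)
    (ha : Den C g k Δ (σ 0) A a) (e₁ : s ≫ fst (ctxDen C g Γ) (tyDen C g A) = t)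
    (e₂ : s ≫ snd (ctxDen C g Γ) (tyDen C g A) = a) : DenSubst C g k Δ (A :: Γ) σ s := by
  subst e₁ e₂
  intro n B f h
  obtain ⟨x, hx, he, e, rfl⟩ := h.exists_core
  cases n with
  | zero =>
    obtain rfl := hx
    exact (ha.conv he e).congr (Category.assoc _ _ _)
  | succ n =>
    obtain ⟨B', f', hf', rfl⟩ := hx
    exact ((ht _ _ _ hf').conv he e).congr (comp_comp_assoc _ _ _ _)

lemma succ {Δ Γ : List sg.Typ} {s} {ρ : ℕ → ℕ} (h : DenSubst C g k Δ Γ (fun n => .var (ρ n)) s)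
    (A : sg.Typ) : DenSubst C g k (A :: Δ) Γ (fun n => .var (ρ n + 1))
      (fst (ctxDen C g Δ) (tyDen C g A) ≫ s) :=
  fun n B f hf => (Den.var_succ (h n B f hf)).congr (Category.assoc _ _ _).symm

lemma upr {Δ Γ : List sg.Typ} {s} {ρ : ℕ → ℕ} (h : DenSubst C g k Δ Γ (fun n => .var (ρ n)) s)
    (A : sg.Typ) : DenSubst C g k (A :: Δ) (A :: Γ) (fun n => .var (Tm.upr ρ n))
      (lift (fst (ctxDen C g Δ) (tyDen C g A) ≫ s) (snd _ _)) :=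
  cons (h.succ A) .var_zero (lift_fst _ _) (lift_snd _ _)

lemma wk (Γ : List sg.Typ) (A : sg.Typ) : DenSubst C g k (A :: Γ) Γ (fun n => .var (n + 1))
    (fst (ctxDen C g Γ) (tyDen C g A)) :=
  fun _ _ _ hf => .var_succ hf

lemma swap (Γ : List sg.Typ) (A B : sg.Typ) :
    DenSubst C g k (A :: B :: Γ) (B :: A :: Γ) (fun n => .var (Tm.swap n))
      (lift (lift (fst (ctxDen C g Γ ⊗ tyDen C g B) (tyDen C g A) ≫ fst _ _) (snd _ _))
        (fst _ _ ≫ snd _ _)) :=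
  cons (cons (t := fst (ctxDen C g Γ ⊗ tyDen C g B) (tyDen C g A) ≫ fst _ _)
    (fun _ _ _ hf => (Den.var_succ (.var_succ hf)).congr (Category.assoc _ _ _).symm)
    .var_zero (lift_fst _ _) (lift_snd _ _)) (.var_succ .var_zero) (lift_fst _ _) (lift_snd _ _)

end DenSubst

/-- Naturality of currying. The swap is present because contexts grow on the right while `curry`
abstracts the left factor. -/
lemma comp_curry_swapHom {W Z X Y : C.Obj} (s : W ⟶ Z) (f : Z ⊗ X ⟶ Y) :
    s ≫ MonoidalClosed.curry (swapHom X Z ≫ f) =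
      MonoidalClosed.curry (swapHom X W ≫ lift (fst W X ≫ s) (snd W X) ≫ f) := by
  rw [← MonoidalClosed.curry_natural_left]
  congr 1
  simp only [← Category.assoc]
  congr 1
  ext <;> simp [swapHom]

namespace Den

/-- Substitution, for a class of substitutions that is closed under passing a binder. -/
lemma subst_of_closed
    (Q : ∀ Δ Γ : List sg.Typ, (ℕ → sg.Term) → (ctxDen C g Δ ⟶ ctxDen C g Γ) → Prop)
    (hQ : ∀ {Δ Γ σ s}, Q Δ Γ σ s → DenSubst C g k Δ Γ σ s)
    (hup : ∀ {Δ Γ σ s} A, Q Δ Γ σ s → Q (A :: Δ) (A :: Γ) (up σ)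
      (lift (CartesianMonoidalCategory.fst (ctxDen C g Δ) (tyDen C g A) ≫ s)
        (CartesianMonoidalCategory.snd _ _)))
    {Γ M A f} (h : Den C g k Γ M A f) : ∀ {Δ σ s}, Q Δ Γ σ s →
      Den C g k Δ (M.subst σ) A (s ≫ f) := by
  induction h with
  | var_zero => intro Δ σ s hs; exact hQ hs _ _ _ .var_zero
  | var_succ h => intro Δ σ s hs; exact hQ hs _ _ _ (.var_succ h)
  | const c => intro Δ σ s hs; exact (Den.const c).congr (by simp)
  | star => intro Δ σ s hs; exact Den.star.congr (toUnit_unique _ _)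
  | lam _ ih => intro Δ σ s hs; exact (ih (hup _ hs)).lam.congr (comp_curry_swapHom _ _).symm
  | app _ _ ih₁ ih₂ =>
    intro Δ σ s hs
    exact ((ih₁ hs).app (ih₂ hs)).congr (lift_comp_comp _ _ _ _)
  | pair _ _ ih₁ ih₂ => intro Δ σ s hs; exact ((ih₁ hs).pair (ih₂ hs)).congr (comp_lift _ _ _).symm
  | fst _ ih => intro Δ σ s hs; exact (ih hs).fst.congr (Category.assoc _ _ _)
  | snd _ ih => intro Δ σ s hs; exact (ih hs).snd.congr (Category.assoc _ _ _)
  | ret _ ih => intro Δ σ s hs; exact (ih hs).ret.congr (Category.assoc _ _ _)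
  | incl _ ih => intro Δ σ s hs; exact (ih hs).incl.congr (Category.assoc _ _ _)
  | bind _ _ ih₁ ih₂ =>
    intro Δ σ s hs
    exact ((ih₁ hs).bind (ih₂ (hup _ hs))).congr ((C.monad _).comp_bind _ _ _).symm
  | conv _ he e ih => intro Δ σ s hs; exact ((ih hs).conv he e).congr (Category.assoc _ _ _)

/-- Renamings come before substitutions: they pass a binder without appeal to weakening, whereas an
arbitrary substitution passes a binder only by weakening its values, which is an instance of this
lemma. -/
lemma ren {Γ M A f} (h : Den C g k Γ M A f) {Δ ρ s}
    (hs : DenSubst C g k Δ Γ (fun n => .var (ρ n)) s) : Den C g k Δ (M.ren ρ) A (s ≫ f) := by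
  rw [ren_eq_subst]
  refine subst_of_closed (k := k) (fun Δ Γ σ s => ∃ ρ : ℕ → ℕ, σ = (fun n => .var (ρ n)) ∧
    DenSubst C g k Δ Γ σ s) (fun h => h.choose_spec.2) ?_ h ⟨ρ, rfl, hs⟩
  rintro Δ Γ _ s A ⟨ρ, rfl, hs⟩
  have e : up (fun n => (.var (ρ n) : sg.Term)) = fun n => .var (Tm.upr ρ n) := by
    funext n; cases n <;> rfl
  rw [e]
  exact ⟨Tm.upr ρ, rfl, hs.upr A⟩

lemma wk {Γ M A f} (h : Den C g k Γ M A f) (B : sg.Typ) : Den C g k (B :: Γ) M.wk A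
    (CartesianMonoidalCategory.fst (ctxDen C g Γ) (tyDen C g B) ≫ f) :=
  h.ren (DenSubst.wk Γ B)

lemma subst {Γ M A f} (h : Den C g k Γ M A f) {Δ σ s} (hs : DenSubst C g k Δ Γ σ s) :
    Den C g k Δ (M.subst σ) A (s ≫ f) :=
  subst_of_closed (k := k) (DenSubst C g k) (fun h => h)
    (fun A hs => .cons (fun n B f hf => ((hs n B f hf).wk A).congr (Category.assoc _ _ _).symm)
      .var_zero (lift_fst _ _) (lift_snd _ _)) h hs

lemma inst {Γ M N A B f h} (hM : Den C g k (A :: Γ) M B f) (hN : Den C g k Γ N A h) :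
    Den C g k Γ (M.inst N) B (lift (𝟙 _) h ≫ f) :=
  hM.subst (.cons (DenSubst.id Γ) hN (lift_fst _ _) (lift_snd _ _))

lemma conv_head {Γ M A A' B f} (h : Den C g k (A :: Γ) M B f) (he : sg.TyEq A A')
    (e : tyDen C g A = tyDen C g A') : Den C g k (A' :: Γ) M B
      (lift (CartesianMonoidalCategory.fst (ctxDen C g Γ) (tyDen C g A'))
        (CartesianMonoidalCategory.snd _ _ ≫ eqToHom e.symm) ≫ f) := by
  have := h.subst (σ := .var) (.cons (DenSubst.wk Γ A') (.conv .var_zero he.symm e.symm)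
    (lift_fst _ _) (lift_snd _ _))
  rwa [subst_var] at this

end Den

/-- The morphism is the tuple of the interpretations of the substituted terms. -/
lemma IsSubst.exists_denSubst (hg : ∀ A B, sg.tyAx A B → tyDen C g A = tyDen C g B)
    {Δ Γ : List sg.Typ} {σ} (h : sg.IsSubst Δ Γ σ) : ∃ s, DenSubst C g k Δ Γ σ s := by
  induction Γ generalizing σ with
  | nil => exact ⟨toUnit _, .nil⟩
  | cons A Γ ih =>
    obtain ⟨s, hs⟩ := ih (σ := fun n => σ (n + 1)) fun n B hn => h (n + 1) B (by simpa using hn)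
    obtain ⟨a, ha⟩ := Den.exists_of_hasTy (k := k) hg (h 0 A rfl)
    exact ⟨lift s a, .cons hs ha (lift_fst _ _) (lift_snd _ _)⟩

end Soundness

/-! ### Soundness of the interpretation -/

section Soundness

variable {C : Model.{u₁, v₁}}

/-- The β-rule for functions, read off from `uncurry_curry`; the lemma after it is the η-rule, read
off from `curry_uncurry`. -/
lemma lift_curry_ev {Z X Y : C.Obj} (f : Z ⊗ X ⟶ Y) (h : Z ⟶ X) :
    lift h (MonoidalClosed.curry (swapHom X Z ≫ f)) ≫ (ihom.ev X).app Y = lift (𝟙 Z) h ≫ f := by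
  have e : lift h (MonoidalClosed.curry (swapHom X Z ≫ f)) =
      lift h (𝟙 Z) ≫ X ◁ MonoidalClosed.curry (swapHom X Z ≫ f) := by simp
  rw [e, Category.assoc, ← MonoidalClosed.uncurry_eq, MonoidalClosed.uncurry_curry,
    ← Category.assoc]
  congr 1
  ext <;> simp [swapHom]

lemma curry_lift_ev {Z X Y : C.Obj} (f : Z ⟶ (ihom X).obj Y) :
    MonoidalClosed.curry (swapHom X Z ≫ lift (snd Z X) (fst Z X ≫ f) ≫ (ihom.ev X).app Y) =
      f := by
  have e : swapHom X Z ≫ lift (snd Z X) (fst Z X ≫ f) = X ◁ f := by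
    ext <;> simp [swapHom]
  rw [reassoc_of% e, ← MonoidalClosed.uncurry_eq, MonoidalClosed.curry_uncurry]

/-- The lemmas from here to `eqToHom_ι` serve the congruence rules in which annotations vary:
transporting the inputs to the new annotations and the output back (for `eqToHom_curry`, the bound
variable and the function type) has no effect. -/
lemma eqToHom_fst {Z X X' Y Y' : C.Obj} (e : X = X') (e' : Y = Y') (f : Z ⟶ X ⊗ Y) :
    ((f ≫ eqToHom (congrArg₂ _ e e')) ≫ fst X' Y') ≫ eqToHom e.symm = f ≫ fst X Y := by
  subst e e'; simp

lemma eqToHom_snd {Z X X' Y Y' : C.Obj} (e : X = X') (e' : Y = Y') (f : Z ⟶ X ⊗ Y) :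
    ((f ≫ eqToHom (congrArg₂ _ e e')) ≫ snd X' Y') ≫ eqToHom e'.symm = f ≫ snd X Y := by
  subst e e'; simp

lemma eqToHom_ev {Z X X' Y Y' : C.Obj} (e : X = X') (e' : Y = Y') (f : Z ⟶ (ihom X).obj Y)
    (h : Z ⟶ X) : (lift (h ≫ eqToHom e) (f ≫ eqToHom (congr_ihom_obj e e')) ≫
      (ihom.ev X').app Y') ≫ eqToHom e'.symm = lift h f ≫ (ihom.ev X).app Y := by
  subst e e'; simp

lemma eqToHom_curry {Z X X' Y : C.Obj} (e : X = X') (f : Z ⊗ X ⟶ Y) :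
    MonoidalClosed.curry (swapHom X' Z ≫ lift (fst Z X') (snd Z X' ≫ eqToHom e.symm) ≫ f) ≫
      eqToHom (congr_ihom_obj e.symm rfl) = MonoidalClosed.curry (swapHom X Z ≫ f) := by
  subst e; simp

lemma eqToHom_bind (P : StrongMonad C.Obj) {Z X X' Y Y' : C.Obj} (e : X = X') (e' : Y = Y')
    (f : Z ⟶ P.obj X) (h : Z ⊗ X ⟶ P.obj Y) :
    P.bind (f ≫ eqToHom (congrArg P.obj e))
      ((lift (fst Z X') (snd Z X' ≫ eqToHom e.symm) ≫ h) ≫ eqToHom (congrArg P.obj e')) ≫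
        eqToHom (congrArg P.obj e'.symm) = P.bind f h := by
  subst e e'; simp

lemma eqToHom_ι {Z X X' : C.Obj} (e : X = X') (f : Z ⟶ C.S.obj X) :
    ((f ≫ eqToHom (congrArg C.S.obj e)) ≫ C.ι.app X') ≫ eqToHom (congrArg C.T.obj e.symm) =
      f ≫ C.ι.app X := by
  subst e; simp

lemma comp_η_ι {Z X : C.Obj} (f : Z ⟶ X) :
    (f ≫ C.S.η.app X) ≫ C.ι.app X = f ≫ C.T.η.app X := by
  have := C.ι.app_η X
  rw [Category.assoc]
  exact congrArg _ this

lemma eq_of_comp_ι {Z X : C.Obj} {f f' : Z ⟶ C.S.obj X} (h : f ≫ C.ι.app X = f' ≫ C.ι.app X) :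
    f = f' := by
  have := C.mono X
  exact (cancel_mono _).1 h

lemma lift_fst_snd_of_prod {Z X Y : C.Obj} (f : Z ⟶ X ⊗ Y) :
    lift (f ≫ fst X Y) (f ≫ snd X Y) = f := by
  simp

variable {Th : Theory.{u, v}} {g : Th.Ground → C.Obj}
  {k : ∀ c : Th.Const, 𝟙_ C.Obj ⟶ tyDen C g (Th.constTy c)}

/-- Provably equal terms have the same interpretation, if this holds for the axioms. -/
theorem Theory.TmEq.exists_den (hg : ∀ A B, Th.tyAx A B → tyDen C g A = tyDen C g B)
    (hk : ∀ {Γ M N A}, Th.tmAx Γ M N A → ∃ f, Den C g k Γ M A f ∧ Den C g k Γ N A f)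
    {Γ M N A} (h : Th.TmEq Γ M N A) : ∃ f, Den C g k Γ M A f ∧ Den C g k Γ N A f := by
  have ex : ∀ {Γ M A}, Th.HasTy Γ M A → ∃ f, Den C g k Γ M A f := Den.exists_of_hasTy hg
  have hd : ∀ {A B}, Th.TyEq A B → tyDen C g A = tyDen C g B := tyDen_eq_of_tyEq hg
  induction h with
  | ax h => exact hk h
  | refl h =>
    obtain ⟨f, hf⟩ := ex h
    exact ⟨f, hf, hf⟩
  | symm _ ih =>
    obtain ⟨f, hf, hf'⟩ := ih
    exact ⟨f, hf', hf⟩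
  | trans _ _ ih₁ ih₂ =>
    obtain ⟨f, hf, hf'⟩ := ih₁
    obtain ⟨f₂, hf₂, hf₂'⟩ := ih₂
    -- The two derivations interpret the middle term separately; uniqueness identifies the results.
    exact ⟨f, hf, hf₂'.congr (hf₂.eq hf')⟩
  | conv _ e ih =>
    obtain ⟨f, hf, hf'⟩ := ih
    exact ⟨_, hf.conv e (hd e), hf'.conv e (hd e)⟩
  | subst _ hσ ih =>
    obtain ⟨f, hf, hf'⟩ := ih
    obtain ⟨s, hs⟩ := IsSubst.exists_denSubst (k := k) hg hσ
    exact ⟨_, hf.subst hs, hf'.subst hs⟩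
  | one_eta h =>
    obtain ⟨f, hf⟩ := ex h
    exact ⟨f, Den.star.congr (toUnit_unique _ _), hf⟩
  | pair_eq _ _ ih₁ ih₂ =>
    obtain ⟨f, hf, hf'⟩ := ih₁
    obtain ⟨h, hh, hh'⟩ := ih₂
    exact ⟨_, hf.pair hh, hf'.pair hh'⟩
  | fst_eq e e' _ ih =>
    obtain ⟨f, hf, hf'⟩ := ih
    exact ⟨_, hf.fst, ((hf'.conv (.prod e e') (hd (.prod e e'))).fst.conv e.symm
      (hd e.symm)).congr (eqToHom_fst (hd e) (hd e') f)⟩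
  | snd_eq e e' _ ih =>
    obtain ⟨f, hf, hf'⟩ := ih
    exact ⟨_, hf.snd, ((hf'.conv (.prod e e') (hd (.prod e e'))).snd.conv e'.symm
      (hd e'.symm)).congr (eqToHom_snd (hd e) (hd e') f)⟩
  | fst_beta h h' =>
    obtain ⟨f, hf⟩ := ex h
    obtain ⟨f', hf'⟩ := ex h'
    exact ⟨f, (hf.pair hf').fst.congr (lift_fst _ _), hf⟩
  | snd_beta h h' =>
    obtain ⟨f, hf⟩ := ex h
    obtain ⟨f', hf'⟩ := ex h'
    exact ⟨f', (hf.pair hf').snd.congr (lift_snd _ _), hf'⟩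
  | prod_eta h =>
    obtain ⟨f, hf⟩ := ex h
    exact ⟨f, (hf.fst.pair hf.snd).congr (lift_fst_snd_of_prod f), hf⟩
  | app_eq e e' _ _ ih₁ ih₂ =>
    obtain ⟨f, hf, hf'⟩ := ih₁
    obtain ⟨h, hh, hh'⟩ := ih₂
    exact ⟨_, hf.app hh, (((hf'.conv (.arr e e') (hd (.arr e e'))).app
      (hh'.conv e (hd e))).conv e'.symm (hd e'.symm)).congr (eqToHom_ev (hd e) (hd e') f h)⟩
  | lam_eq e _ ih =>
    obtain ⟨f, hf, hf'⟩ := ih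
    exact ⟨_, hf.lam, ((hf'.conv_head e (hd e)).lam.conv (.arr e.symm (.refl _))
      (hd (.arr e.symm (.refl _)))).congr (eqToHom_curry (hd e) f)⟩
  | lam_beta h h' =>
    obtain ⟨f, hf⟩ := ex h
    obtain ⟨f', hf'⟩ := ex h'
    exact ⟨_, (hf.lam.app hf').congr (lift_curry_ev f f'), hf.inst hf'⟩
  | lam_eta h =>
    obtain ⟨f, hf⟩ := ex h
    exact ⟨f, ((hf.wk _).app .var_zero).lam.congr (curry_lift_ev f), hf⟩
  | ret_eq _ ih =>
    obtain ⟨f, hf, hf'⟩ := ih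
    exact ⟨_, hf.ret, hf'.ret⟩
  | bind_eq e e' _ _ ih₁ ih₂ =>
    obtain ⟨f, hf, hf'⟩ := ih₁
    obtain ⟨h, hh, hh'⟩ := ih₂
    exact ⟨_, hf.bind hh, (((hf'.conv (.mon _ e) (hd (.mon _ e))).bind
      ((hh'.conv_head e (hd e)).conv (.mon _ e') (hd (.mon _ e')))).conv (.mon _ e'.symm)
        (hd (.mon _ e'.symm))).congr (eqToHom_bind _ (hd e) (hd e') f h)⟩
  | mon_beta h h' =>
    obtain ⟨f, hf⟩ := ex h
    obtain ⟨f', hf'⟩ := ex h'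
    exact ⟨_, (hf.ret.bind hf').congr ((C.monad _).ret_bind f f'), hf'.inst hf⟩
  | mon_eta h =>
    obtain ⟨f, hf⟩ := ex h
    exact ⟨f, (hf.bind (.ret .var_zero)).congr ((C.monad _).bind_ret f), hf⟩
  | mon_assoc h₁ h₂ h₃ =>
    obtain ⟨f₁, hf₁⟩ := ex h₁
    obtain ⟨f₂, hf₂⟩ := ex h₂
    obtain ⟨f₃, hf₃⟩ := ex h₃
    exact ⟨_, (hf₁.bind hf₂).bind hf₃,
      (hf₁.bind (hf₂.bind (hf₃.ren ((DenSubst.wk _ _).upr _)))).congr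
        ((C.monad _).bind_bind f₁ f₂ f₃).symm⟩
  | central h₁ h₂ h₃ =>
    obtain ⟨f₁, hf₁⟩ := ex h₁
    obtain ⟨f₂, hf₂⟩ := ex h₂
    obtain ⟨f₃, hf₃⟩ := ex h₃
    exact ⟨_, hf₁.incl.bind ((hf₂.wk _).bind hf₃),
      (hf₂.bind (((hf₁.wk _).incl.congr (Category.assoc _ _ _)).bind
        (hf₃.ren (DenSubst.swap _ _ _)))).congr ((C.central _).bind_comm f₁ f₂ f₃).symm⟩
  | incl_eq e _ ih =>
    obtain ⟨f, hf, hf'⟩ := ih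
    exact ⟨_, hf.incl, ((hf'.conv (.mon _ e) (hd (.mon _ e))).incl.conv (.mon _ e.symm)
      (hd (.mon _ e.symm))).congr (eqToHom_ι (hd e) f)⟩
  | incl_mono h h' _ ih =>
    obtain ⟨f, hf⟩ := ex h
    obtain ⟨f', hf'⟩ := ex h'
    obtain ⟨t, ht, ht'⟩ := ih
    -- Uniqueness turns the common interpretation of the two inclusions into an equation after `ι`,
    -- which can be cancelled because its components are monomorphisms.
    exact ⟨f, hf, hf'.congr (eq_of_comp_ι ((hf'.incl.eq ht').trans (ht.eq hf.incl)))⟩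
  | incl_ret h =>
    obtain ⟨f, hf⟩ := ex h
    exact ⟨_, hf.ret.incl, hf.ret.congr (comp_η_ι f).symm⟩
  | incl_comp h h' =>
    obtain ⟨f, hf⟩ := ex h
    obtain ⟨f', hf'⟩ := ex h'
    exact ⟨_, hf.incl.bind hf'.incl, (hf.bind hf').incl.congr (C.ι.bind_app f f')⟩

end Soundness

/-! ### The syntactic category in terms of arbitrary representatives -/

namespace Syn

variable {Th : Theory.{u, v}}

lemma exists_mk (a : Syn Th) : ∃ A, a = mk A := ⟨a.rep, (mk_rep a).symm⟩

lemma tyEq_rep (A : Th.Typ) : Th.TyEq (mk A).rep A := mk_eq.1 (mk_rep _)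

lemma of_comp_eqToHom {a b c : Syn Th} {f} (hf : Typed a b f) (h : b = c) :
    of f hf ≫ eqToHom h = of f (h ▸ hf) := by
  subst h; simp

/-- The syntactic structure is defined with chosen representatives as annotations. Equality of terms
ignores annotations up to equality of types, so here and in the following lemmas any representatives
will do. -/
lemma p₁_mk (A B : Th.Typ) : p₁ (mk A) (mk B) =
    of (.fst A B (.var 0)) ⟨_, _, rfl, rfl, .fst (.var rfl)⟩ :=
  of_eq (A := A.prod B) (B := A) rfl rfl <| by
    have h := (tyEq_rep A).prod (tyEq_rep B)
    exact (TmEq.fst_eq (tyEq_rep A) (tyEq_rep B) (.refl (.conv (.var rfl) h.symm))).conv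
      (tyEq_rep A)

lemma p₂_mk (A B : Th.Typ) : p₂ (mk A) (mk B) =
    of (.snd A B (.var 0)) ⟨_, _, rfl, rfl, .snd (.var rfl)⟩ :=
  of_eq (A := A.prod B) (B := B) rfl rfl <| by
    have h := (tyEq_rep A).prod (tyEq_rep B)
    exact (TmEq.snd_eq (tyEq_rep A) (tyEq_rep B) (.refl (.conv (.var rfl) h.symm))).conv
      (tyEq_rep B)

lemma ev_mk (A B : Th.Typ) : ev (mk A) (mk B) =
    of (.app A B (.snd A (A.arr B) (.var 0)) (.fst A (A.arr B) (.var 0)))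
      ⟨_, _, rfl, rfl, .app (.snd (.var rfl)) (.fst (.var rfl))⟩ :=
  of_eq (A := A.prod (A.arr B)) (B := B) rfl rfl <| by
    have h₁ := tyEq_rep A
    have h₂ := tyEq_rep B
    have h₃ := h₁.arr h₂
    have h : Th.HasTy [A.prod (A.arr B)] (.var 0) _ := .conv (.var rfl) (h₁.prod h₃).symm
    exact (TmEq.app_eq h₁ h₂ (.snd_eq h₁ h₃ (.refl h)) (.fst_eq h₁ h₃ (.refl h))).conv h₂

lemma inclusion_mk (A : Th.Typ) :
    inclusion (mk A) = of (.incl A (.var 0)) ⟨_, _, rfl, rfl, .incl (.var rfl)⟩ :=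
  of_eq (A := A.mon .S) (B := A.mon .T) rfl rfl <|
    (TmEq.incl_eq (tyEq_rep A) (.refl (.conv (.var rfl) (.mon _ (tyEq_rep A).symm)))).conv
      (.mon _ (tyEq_rep A))

lemma monMap_mk (e : Eff) {A B : Th.Typ} {f} (hf : Th.HasTy [A] f B) :
    monMap e (of f ⟨A, B, rfl, rfl, hf⟩) = of (.bind e A B (.var 0) (.ret e f))
      ⟨_, _, rfl, rfl, .bind (.var rfl) (.ret (hf.single (.refl _) (.refl _) _))⟩ :=
  of_eq (A := A.mon e) (B := B.mon e) rfl rfl <| by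
    have h₁ := tyEq_rep A
    have h₂ := tyEq_rep B
    exact (TmEq.bind_eq h₁ h₂ (.refl (.conv (.var rfl) (.mon _ h₁.symm)))
      (.refl (.ret (hf.single h₁.symm h₂.symm _)))).conv (.mon _ h₂)

lemma mult_mk (e : Eff) (A : Th.Typ) :
    mult e (mk A) = of (.bind e (A.mon e) A (.var 0) (.var 0))
      ⟨_, _, rfl, rfl, .bind (.var rfl) (.var rfl)⟩ :=
  of_eq (A := (A.mon e).mon e) (B := A.mon e) rfl rfl <| by
    have h := tyEq_rep A
    exact (TmEq.bind_eq (.mon _ h) h (.refl (.conv (.var rfl) (.mon _ (.mon _ h.symm))))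
      (.refl (.var rfl))).conv (.mon _ h)

lemma strength_mk (e : Eff) (A B : Th.Typ) : strength e (mk A) (mk B) =
    of (.bind e B (A.prod B) (.snd A (B.mon e) (.var 0))
      (.ret e (.pair (.fst A (B.mon e) (.var 1)) (.var 0))))
      ⟨_, _, rfl, rfl, .bind (.snd (.var rfl)) (.ret (.pair (.fst (.var rfl)) (.var rfl)))⟩ :=
  of_eq (A := A.prod (B.mon e)) (B := (A.prod B).mon e) rfl rfl <| by
    have h₁ := tyEq_rep A
    have h₂ := tyEq_rep B
    have h₃ : Th.TyEq ((mk B).rep.mon e) (B.mon e) := .mon _ h₂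
    have k := h₁.prod h₃
    exact (TmEq.bind_eq h₂ (h₁.prod h₂) (.snd_eq h₁ h₃ (.refl (.conv (.var rfl) k.symm)))
      (.ret_eq (.pair_eq (.fst_eq h₁ h₃ (.refl (.conv (.var rfl) k.symm)))
        (.refl (.var rfl))))).conv (.mon _ (h₁.prod h₂))

lemma curry_mk {A B D : Th.Typ} {f} (hf : Th.HasTy [A.prod B] f D) :
    curry (a := mk A) (b := mk B) (of f ⟨_, D, rfl, rfl, hf⟩) =
      of (.lam A (f.plug (.pair (.var 0) (.var 1))))
        ⟨B, A.arr D, rfl, rfl, .lam (hf.plug (.pair (.var rfl) (.var rfl)))⟩ :=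
  of_eq (A := B) (B := A.arr D) rfl rfl <| by
    have h := tyEq_rep A
    exact (TmEq.lam_eq h (.refl (hf.plug (.pair (.conv (.var rfl) h) (.var rfl))))).conv
      (.arr h (.refl _))

lemma bind_mk (e : Eff) {A B D : Th.Typ} {m n} (hm : Th.HasTy [D] m (A.mon e))
    (hn : Th.HasTy [D.prod A] n (B.mon e)) :
    bind e (a := mk A) (b := mk B) (c := mk D) (of m ⟨D, _, rfl, rfl, hm⟩)
      (of n ⟨_, _, rfl, rfl, hn⟩) = of (.bind e A B m (n.plug (.pair (.var 1) (.var 0))))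
        ⟨D, _, rfl, rfl, .bind hm (hn.plug (.pair (.var rfl) (.var rfl)))⟩ :=
  of_eq (A := D) (B := B.mon e) rfl rfl <| by
    have h₁ := tyEq_rep A
    have h₂ := tyEq_rep B
    exact (TmEq.bind_eq h₁ h₂ (.refl (hm.conv (.mon _ h₁.symm)))
      (.refl ((hn.plug (.pair (.var rfl) (.conv (.var rfl) h₁))).conv (.mon _ h₂.symm)))).conv
        (.mon _ h₂)

lemma uncurry_id (a b : Syn Th) : uncurry (𝟙 (arr a b)) = ev a b := by
  rw [uncurry, Category.comp_id]
  have := pairing_eta (𝟙 (prod a (arr a b)))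
  simp only [Category.id_comp] at this
  rw [this, Category.id_comp]

/-- The counit of an adjunction built from a hom-set bijection is, by definition, the transpose of
the identity. -/
lemma ihom_ev_app (a b : Syn Th) : (ihom.ev a).app b = ev a b :=
  uncurry_id a b

/-- Uncurrying is determined by evaluation, and evaluation is the syntactic one; so the syntactic
transpose is a preimage of φ under uncurrying, and such a preimage is unique. -/
lemma closed_curry_eq {a b c : Syn Th} (φ : prod a b ⟶ c) :
    MonoidalClosed.curry (A := a) (Y := b) (X := c) φ = curry φ := by
  have h : MonoidalClosed.uncurry (A := a) (Y := b) (X := c) (curry φ) = φ :=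
     (MonoidalClosed.uncurry_eq (A := a) (Y := b) (X := c) (curry φ)).trans
      ((congrArg₂ (· ≫ ·) (tensorLeft_map a (curry φ)) (ihom_ev_app a c)).trans (uncurry_curry φ))
  exact (congrArg (MonoidalClosed.curry (A := a) (Y := b) (X := c)) h.symm).trans
    (MonoidalClosed.curry_uncurry (A := a) (X := b) (Y := c) (curry φ))

lemma bind_strongMonad (e : Eff) {a b c : Syn Th} (φ : c ⟶ mon e a) (ψ : prod c a ⟶ mon e b) :
    (strongMonad Th e).bind φ ψ = bind e φ ψ :=
  (doMonad Th e).bind_toStrongMonad _ _ _ φ ψ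

end Syn

/-! ### The interpretation of the internal language -/

namespace Internal

variable (C : Model.{u, v})

/-- The axioms of `L C` contain every equality that is true in `C`, and the rules derive no further
ones. -/
lemma tyEq_iff {A B : (L C).Typ} : (L C).TyEq A B ↔ tyDen C id A = tyDen C id B :=
  ⟨tyDen_eq_of_tyEq (C := C) (sg := internalSignature C) (g := id) (fun _ _ h => h),
    fun h => .ax h⟩

variable {C}

lemma exists_den {Γ M A} (h : (L C).HasTy Γ M A) : ∃ f, Den C id (internalConst C) Γ M A f :=
  Den.exists_of_hasTy (fun _ _ h => h) h

lemma tmEq_of_den {Γ M N A f} (hM : Den C id (internalConst C) Γ M A f)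
    (hN : Den C id (internalConst C) Γ N A f) : (L C).TmEq Γ M N A :=
  .ax ⟨hM.hasTy, hN.hasTy, f, hM, hN⟩

/-- Soundness, applied to axioms that are true by definition. With `tmEq_of_den`, equality in `L C`
is exactly equality of interpretations. -/
lemma exists_den_of_tmEq {Γ M N A} (h : (L C).TmEq Γ M N A) :
    ∃ f, Den C id (internalConst C) Γ M A f ∧ Den C id (internalConst C) Γ N A f :=
  TmEq.exists_den (Th := L C) (fun _ _ h => h) (fun h => h.2.2) h

/-- `x : A ⊢ M : B` is interpreted by `f`. -/
def Den₁ (A : (L C).Typ) (M : (L C).Term) (B : (L C).Typ) (f : tyDen C id A ⟶ tyDen C id B) :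
    Prop :=
  Den C id (internalConst C) [A] M B (snd _ _ ≫ f)

/-- A context with one variable is interpreted by a product with the terminal object; `Den₁` strips
that factor, which is harmless because its second projection is invertible. -/
lemma exists_den₁ {A B : (L C).Typ} {M} (h : (L C).HasTy [A] M B) : ∃ f, Den₁ A M B f := by
  obtain ⟨f, hf⟩ := exists_den h
  refine ⟨lift (toUnit _) (𝟙 _) ≫ f, hf.congr ?_⟩
  have e : snd (𝟙_ C.Obj) (tyDen C id A) ≫ lift (toUnit _) (𝟙 _) = 𝟙 _ := by
    rw [comp_lift, Category.comp_id, toUnit_unique (_ ≫ toUnit _) (fst _ _), lift_fst_snd]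
  exact ((reassoc_of% e) f).symm

lemma comp_snd_injective {X Y : C.Obj} {f f' : X ⟶ Y}
    (h : snd (𝟙_ C.Obj) X ≫ f = snd (𝟙_ C.Obj) X ≫ f') : f = f' := by
  simpa using congrArg (lift (toUnit X) (𝟙 X) ≫ ·) h

lemma Den₁.eq {A B : (L C).Typ} {M f f'} (h : Den₁ A M B f) (h' : Den₁ A M B f') : f = f' :=
  comp_snd_injective (Den.eq h h')

lemma Den₁.conv {A A' B B' : (L C).Typ} {M f} (h : Den₁ A M B f)
    (eA : tyDen C id A' = tyDen C id A) (eB : tyDen C id B = tyDen C id B') :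
    Den₁ A' M B' (eqToHom eA ≫ f ≫ eqToHom eB) := by
  have e : ∀ {X X' Y Y' : C.Obj} (eX : X' = X) (eY : Y = Y') (f : X ⟶ Y),
      (lift (fst (𝟙_ C.Obj) X') (snd (𝟙_ C.Obj) X' ≫ eqToHom eX) ≫ snd (𝟙_ C.Obj) X ≫ f) ≫
        eqToHom eY = snd (𝟙_ C.Obj) X' ≫ eqToHom eX ≫ f ≫ eqToHom eY := by
    intro X X' Y Y' eX eY f
    subst eX eY
    simp
  exact (Den.conv (Den.conv_head h (.ax eA.symm) eA.symm) (.ax eB) eB).congr (e eA eB f)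

lemma Den₁.plug {A B D : (L C).Typ} {M N f h} (hM : Den₁ A M B f) (hN : Den₁ B N D h) :
    Den₁ A (N.plug M) D (f ≫ h) := by
  have e : ∀ {X Y Z : C.Obj} (f : X ⟶ Y) (h : Y ⟶ Z),
      lift (toUnit _) (snd (𝟙_ C.Obj) X ≫ f) ≫ snd (𝟙_ C.Obj) Y ≫ h =
        snd (𝟙_ C.Obj) X ≫ f ≫ h := by simp
  exact (Den.subst hN (DenSubst.cons (σ := fun _ => M) (t := toUnit _) .nil hM (lift_fst _ _)
    (lift_snd _ _))).congr (e f h)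

/-- The constant `c_f`, applied to the variable. -/
def constApp {X Y : C.Obj} (f : X ⟶ Y) : (L C).Term :=
  .app (.ground X) (.ground Y) (.const ⟨X, Y, f⟩) (.var 0)

lemma den₁_constApp {X Y : C.Obj} (f : X ⟶ Y) :
    Den₁ (C := C) (.ground X) (constApp f) (.ground Y) f := by
  have e : lift (snd (𝟙_ C.Obj) X) (toUnit _ ≫ MonoidalClosed.curry (fst X (𝟙_ C.Obj) ≫ f)) ≫
      (ihom.ev X).app Y = snd (𝟙_ C.Obj) X ≫ f := by
    have e' : lift (snd (𝟙_ C.Obj) X) (toUnit _ ≫ MonoidalClosed.curry (fst X (𝟙_ C.Obj) ≫ f)) =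
        lift (snd (𝟙_ C.Obj) X) (toUnit _) ≫ X ◁ MonoidalClosed.curry (fst X (𝟙_ C.Obj) ≫ f) := by
      simp
    rw [e', Category.assoc, ← MonoidalClosed.uncurry_eq, MonoidalClosed.uncurry_curry]
    simp
  exact (Den.app (.const (sg := internalSignature C) ⟨X, Y, f⟩) .var_zero).congr e

/-! ### The functor from the syntactic model of the internal language -/

/-- The interpretation of a class of types. -/
def semObj : Syn (L C) → C.Obj :=
  Quotient.lift (tyDen C id) fun _ _ h => (tyEq_iff C).1 h

/-- The source and target depend on classes of types, so the morphism is characterised on all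
representatives at once, with transports between them, and chosen from this characterisation. -/
lemma exists_semMap {a b : Syn (L C)} (φ : a ⟶ b) : ∃ h : semObj a ⟶ semObj b,
    ∀ f hf, φ = Syn.of f hf → ∀ A B (hA : Syn.mk A = a) (hB : Syn.mk B = b),
      Den₁ A f B (eqToHom (congrArg semObj hA) ≫ h ≫ eqToHom (congrArg semObj hB).symm) := by
  obtain ⟨A₀, rfl⟩ := Syn.exists_mk a
  obtain ⟨B₀, rfl⟩ := Syn.exists_mk b
  obtain ⟨f₀, hf₀, rfl⟩ := Syn.exists_of φ
  obtain ⟨h, hh⟩ := exists_den₁ (hf₀.hasTy (A := A₀) (B := B₀) rfl rfl [])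
  refine ⟨h, fun f hf e A B hA hB => ?_⟩
  -- Two terms representing the same morphism are provably equal, so soundness gives them a common
  -- interpretation.
  obtain ⟨t, ht, ht'⟩ := exists_den_of_tmEq (Syn.tmEq_of_eq e (A := A₀) (B := B₀) rfl rfl)
  have hf' : Den₁ A₀ f B₀ h := ht'.congr (ht.eq hh)
  exact hf'.conv (congrArg semObj hA) (congrArg semObj hB).symm

/-- The interpretation of a class of terms. -/
noncomputable def semMap {a b : Syn (L C)} (φ : a ⟶ b) : semObj a ⟶ semObj b :=
  (exists_semMap φ).choose

lemma den₁_semMap {A B : (L C).Typ} {f} (hf : Syn.Typed (Syn.mk A) (Syn.mk B) f) :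
    Den₁ A f B (semMap (Syn.of f hf)) := by
  have e : ∀ {X Y : C.Obj} (f : X ⟶ Y), eqToHom rfl ≫ f ≫ eqToHom rfl = f := by simp
  have := (exists_semMap (Syn.of f hf)).choose_spec f hf rfl A B rfl rfl
  exact Den.congr this (congrArg (snd _ _ ≫ ·) (e _))

lemma semMap_eq {A B : (L C).Typ} {f} {hf : Syn.Typed (Syn.mk A) (Syn.mk B) f} {h}
    (H : Den₁ A f B h) : semMap (Syn.of f hf) = h :=
  (den₁_semMap hf).eq H

/-- Faithfulness: terms with the same interpretation are equal by an axiom of `L C`. -/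
lemma semMap_injective {a b : Syn (L C)} {φ ψ : a ⟶ b} (h : semMap φ = semMap ψ) : φ = ψ := by
  obtain ⟨A, rfl⟩ := Syn.exists_mk a
  obtain ⟨B, rfl⟩ := Syn.exists_mk b
  obtain ⟨f, hf, rfl⟩ := Syn.exists_of φ
  obtain ⟨f', hf', rfl⟩ := Syn.exists_of ψ
  have h₁ := den₁_semMap hf
  rw [h] at h₁
  exact Syn.of_eq (A := A) (B := B) rfl rfl (tmEq_of_den h₁ (den₁_semMap hf'))

variable (C) in
/-- The interpretation functor `S(L(C)) ⥤ C`. -/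
noncomputable def sem : Syn (L C) ⥤ C.Obj where
  obj := semObj
  map := semMap
  map_id a := by
    obtain ⟨A, rfl⟩ := Syn.exists_mk a
    exact semMap_eq (A := A) (B := A) (Den.var_zero.congr (Category.comp_id _).symm)
  map_comp {a b c} φ ψ := by
    obtain ⟨A, rfl⟩ := Syn.exists_mk a
    obtain ⟨B, rfl⟩ := Syn.exists_mk b
    obtain ⟨D, rfl⟩ := Syn.exists_mk c
    obtain ⟨f, hf, rfl⟩ := Syn.exists_of φ
    obtain ⟨h, hh, rfl⟩ := Syn.exists_of ψ
    exact semMap_eq ((den₁_semMap hf).plug (den₁_semMap hh))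

/-- On classes of the form `Syn.mk A` the object equations for the interpretation hold by
definition. The transports demanded by `ModelHom` are then along an equality of an object with
itself and vanish by these three lemmas. -/
lemma eqToHom_self_comp {X Y : C.Obj} (e : X = X) (f : X ⟶ Y) : eqToHom e ≫ f = f := by simp

lemma comp_eqToHom_self {X Y : C.Obj} (e : Y = Y) (f : X ⟶ Y) : f ≫ eqToHom e = f := by simp

lemma eqToHom_self_comp_self {X Y : C.Obj} (e : X = X) (e' : Y = Y) (f : X ⟶ Y) :
    eqToHom e ≫ f ≫ eqToHom e' = f := by simp

lemma Den₁.weaken {A B : (L C).Typ} {M f} (h : Den₁ A M B f) (Γ : List (L C).Typ) :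
    Den C id (internalConst C) (A :: Γ) M B (snd (ctxDen C id Γ) (tyDen C id A) ≫ f) := by
  have e : ∀ {Z X Y : C.Obj} (f : X ⟶ Y),
      lift (toUnit _) (snd Z X) ≫ snd (𝟙_ C.Obj) X ≫ f = snd Z X ≫ f := by simp
  have := (Den.subst h (DenSubst.cons (σ := fun _ => .var 0) (t := toUnit _) .nil .var_zero
    (lift_fst _ _) (lift_snd _ _))).congr (e (Z := ctxDen C id Γ) f)
  rwa [show M.subst _ = M from (Den.hasTy h).plug_var] at this

lemma semObj_arr (a b : Syn (L C)) : semObj (Syn.arr a b) = (ihom (semObj a)).obj (semObj b) := by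
  obtain ⟨A, rfl⟩ := Syn.exists_mk a
  obtain ⟨B, rfl⟩ := Syn.exists_mk b
  rfl

lemma semObj_prod (a b : Syn (L C)) : semObj (Syn.prod a b) = semObj a ⊗ semObj b := by
  obtain ⟨A, rfl⟩ := Syn.exists_mk a
  obtain ⟨B, rfl⟩ := Syn.exists_mk b
  rfl

lemma semObj_mon (e : Eff) (a : Syn (L C)) : semObj (Syn.mon e a) = (C.monad e).obj (semObj a) := by
  obtain ⟨A, rfl⟩ := Syn.exists_mk a
  rfl

variable (C) in
/-- The interpretation functor preserves the structure of the models. -/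
noncomputable def semHom : ModelHom (S (L C)) C where
  toFunctor := sem C
  obj_unit := rfl
  obj_prod := semObj_prod
  map_fst a b := by
    obtain ⟨A, rfl⟩ := Syn.exists_mk a
    obtain ⟨B, rfl⟩ := Syn.exists_mk b
    refine .trans ?_ (eqToHom_self_comp _ _).symm
    refine (congrArg semMap ((Syn.fst_eq _ _).trans (Syn.p₁_mk A B))).trans ?_
    exact semMap_eq (A := A.prod B) (B := A) Den.var_zero.fst
  map_snd a b := by
    obtain ⟨A, rfl⟩ := Syn.exists_mk a
    obtain ⟨B, rfl⟩ := Syn.exists_mk b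
    refine .trans ?_ (eqToHom_self_comp _ _).symm
    refine (congrArg semMap ((Syn.snd_eq _ _).trans (Syn.p₂_mk A B))).trans ?_
    exact semMap_eq (A := A.prod B) (B := B) Den.var_zero.snd
  obj_exp := semObj_arr
  map_ev a b := by
    obtain ⟨A, rfl⟩ := Syn.exists_mk a
    obtain ⟨B, rfl⟩ := Syn.exists_mk b
    refine .trans ?_ (eqToHom_self_comp _ _).symm
    refine (congrArg semMap ((Syn.ihom_ev_app _ _).trans (Syn.ev_mk A B))).trans ?_
    refine semMap_eq (A := A.prod (A.arr B)) (B := B)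
      ((Den.var_zero.snd.app Den.var_zero.fst).congr ?_)
    exact congrArg (· ≫ _) (lift_fst_snd_of_prod (snd (𝟙_ C.Obj) _))
  obj_T := semObj_mon .T
  obj_S := semObj_mon .S
  map_T {a b} φ := by
    obtain ⟨A, rfl⟩ := Syn.exists_mk a
    obtain ⟨B, rfl⟩ := Syn.exists_mk b
    obtain ⟨f, hf, rfl⟩ := Syn.exists_of φ
    refine .trans ?_ (eqToHom_self_comp_self _ _ _).symm
    refine (congrArg semMap (Syn.monMap_mk .T (hf.hasTy rfl rfl []))).trans ?_
    exact semMap_eq (A := A.mon .T) (B := B.mon .T)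
      ((Den.var_zero.bind ((den₁_semMap hf).weaken [A.mon .T]).ret).congr (C.T.bind_map _ _))
  map_ι a := by
    obtain ⟨A, rfl⟩ := Syn.exists_mk a
    refine .trans ?_ (eqToHom_self_comp_self _ _ _).symm
    refine (congrArg semMap (Syn.inclusion_mk A)).trans ?_
    exact semMap_eq (A := A.mon .S) (B := A.mon .T) Den.var_zero.incl
  map_η a := by
    obtain ⟨A, rfl⟩ := Syn.exists_mk a
    refine .trans ?_ (comp_eqToHom_self _ _).symm
    exact semMap_eq (A := A) (B := A.mon .T) Den.var_zero.ret
  map_μ a := by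
    obtain ⟨A, rfl⟩ := Syn.exists_mk a
    refine .trans ?_ (eqToHom_self_comp_self _ _ _).symm
    refine (congrArg semMap (Syn.mult_mk .T A)).trans ?_
    exact semMap_eq (A := (A.mon .T).mon .T) (B := A.mon .T)
      ((Den.var_zero.bind Den.var_zero).congr (C.T.bind_snd _))
  map_τ a b := by
    obtain ⟨A, rfl⟩ := Syn.exists_mk a
    obtain ⟨B, rfl⟩ := Syn.exists_mk b
    refine .trans ?_ (eqToHom_self_comp_self _ _ _).symm
    refine (congrArg semMap (Syn.strength_mk .T A B)).trans ?_
    exact semMap_eq (A := A.prod (B.mon .T)) (B := (A.prod B).mon .T)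
      ((Den.var_zero.snd.bind (((Den.var_succ .var_zero).fst.pair .var_zero).ret)).congr
        (C.T.bind_lift _))

/-! ### The functor naming objects and morphisms -/

lemma mk_ground_semObj (a : Syn (L C)) : Syn.mk (Th := L C) (.ground (semObj a)) = a := by
  obtain ⟨A, rfl⟩ := Syn.exists_mk a
  exact Syn.mk_eq.2 ((tyEq_iff C).2 rfl)

lemma typed_constApp {X Y : C.Obj} (f : X ⟶ Y) :
    Syn.Typed (Syn.mk (.ground X)) (Syn.mk (.ground Y)) (constApp f) :=
  ⟨.ground X, .ground Y, rfl, rfl, Den.hasTy (den₁_constApp f)⟩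

lemma semMap_constApp {X Y : C.Obj} (f : X ⟶ Y) : semMap (Syn.of _ (typed_constApp f)) = f :=
  semMap_eq (den₁_constApp f)

variable (C) in
/-- The functor `C ⥤ S(L(C))` given by the ground types and constants. -/
noncomputable def names : C.Obj ⥤ Syn (L C) where
  obj X := Syn.mk (.ground X)
  map f := Syn.of _ (typed_constApp f)
  map_id X := semMap_injective ((semMap_constApp _).trans
    ((sem C).map_id (Syn.mk (.ground X))).symm)
  map_comp f h := semMap_injective ((semMap_constApp _).trans
    (((sem C).map_comp (Syn.of _ (typed_constApp f)) (Syn.of _ (typed_constApp h))).trans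
      (congrArg₂ (· ≫ ·) (semMap_constApp f) (semMap_constApp h))).symm)

lemma semMap_names {X Y : C.Obj} (f : X ⟶ Y) : semMap ((names C).map f) = f := semMap_constApp f

/-- The object equations for naming are not definitional in the syntactic category. Pushed through
the interpretation, their transports become ones in `C` between definitionally equal objects. -/
lemma semMap_eqToHom_comp {a b c : Syn (L C)} (h : a = b) (φ : b ⟶ c) :
    semMap (eqToHom h ≫ φ) = eqToHom (congrArg semObj h) ≫ semMap φ := by
  subst h; simp

lemma semMap_comp_eqToHom {a b c : Syn (L C)} (φ : a ⟶ b) (h : b = c) :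
    semMap (φ ≫ eqToHom h) = semMap φ ≫ eqToHom (congrArg semObj h) := by
  subst h; simp

lemma semMap_eqToHom_comp_eqToHom {a b c d : Syn (L C)} (h : a = b) (φ : b ⟶ c) (h' : c = d) :
    semMap (eqToHom h ≫ φ ≫ eqToHom h') =
      eqToHom (congrArg semObj h) ≫ semMap φ ≫ eqToHom (congrArg semObj h') := by
  subst h h'; simp

lemma mk_ground_eq {X : C.Obj} {a : Syn (L C)} (h : X = semObj a) :
    Syn.mk (Th := L C) (.ground X) = a := by
  subst h; exact mk_ground_semObj a

variable (C) in
/-- Naming objects and morphisms preserves the structure of the models. -/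
noncomputable def namesHom : ModelHom C (S (L C)) where
  toFunctor := names C
  obj_unit := mk_ground_eq (a := Syn.one) rfl
  obj_prod X Y := mk_ground_eq (a := Syn.prod (Syn.mk (.ground X)) (Syn.mk (.ground Y))) rfl
  -- All structure equations are checked after interpretation. There the name disappears, the
  -- transports are identities, and what is left is the corresponding equation for `semHom` at the
  -- named objects.
  map_fst X Y := semMap_injective <| (semMap_names _).trans <| by
    refine .trans ?_ (semMap_eqToHom_comp _ _).symm
    refine .trans ?_ (eqToHom_self_comp _ _).symm
    exact (((semHom C).map_fst (Syn.mk (.ground X)) (Syn.mk (.ground Y))).trans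
      (eqToHom_self_comp _ _)).symm
  map_snd X Y := semMap_injective <| (semMap_names _).trans <| by
    refine .trans ?_ (semMap_eqToHom_comp _ _).symm
    refine .trans ?_ (eqToHom_self_comp _ _).symm
    exact (((semHom C).map_snd (Syn.mk (.ground X)) (Syn.mk (.ground Y))).trans
      (eqToHom_self_comp _ _)).symm
  obj_exp X Y := mk_ground_eq (a := Syn.arr (Syn.mk (.ground X)) (Syn.mk (.ground Y))) rfl
  map_ev X Y := semMap_injective <| (semMap_names _).trans <| by
    refine .trans ?_ (semMap_eqToHom_comp _ _).symm
    refine .trans ?_ (eqToHom_self_comp _ _).symm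
    exact (((semHom C).map_ev (Syn.mk (.ground X)) (Syn.mk (.ground Y))).trans
      (eqToHom_self_comp _ _)).symm
  obj_T X := mk_ground_eq (a := Syn.mon .T (Syn.mk (.ground X))) rfl
  obj_S X := mk_ground_eq (a := Syn.mon .S (Syn.mk (.ground X))) rfl
  map_T {X Y} f := semMap_injective <| (semMap_names _).trans <| by
    refine .trans ?_ (semMap_eqToHom_comp_eqToHom _ _ _).symm
    refine .trans ?_ (eqToHom_self_comp_self _ _ _).symm
    refine .trans (congrArg C.T.map (semMap_names f).symm) ?_
    exact (((semHom C).map_T ((names C).map f)).trans (eqToHom_self_comp_self _ _ _)).symm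
  map_ι X := semMap_injective <| (semMap_names _).trans <| by
    refine .trans ?_ (semMap_eqToHom_comp_eqToHom _ _ _).symm
    refine .trans ?_ (eqToHom_self_comp_self _ _ _).symm
    exact (((semHom C).map_ι (Syn.mk (.ground X))).trans (eqToHom_self_comp_self _ _ _)).symm
  map_η X := semMap_injective <| (semMap_names _).trans <| by
    refine .trans ?_ (semMap_comp_eqToHom _ _).symm
    refine .trans ?_ (comp_eqToHom_self _ _).symm
    exact (((semHom C).map_η (Syn.mk (.ground X))).trans (comp_eqToHom_self _ _)).symm
  map_μ X := semMap_injective <| (semMap_names _).trans <| by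
    refine .trans ?_ (semMap_eqToHom_comp_eqToHom _ _ _).symm
    refine .trans ?_ (eqToHom_self_comp_self _ _ _).symm
    exact (((semHom C).map_μ (Syn.mk (.ground X))).trans (eqToHom_self_comp_self _ _ _)).symm
  map_τ X Y := semMap_injective <| (semMap_names _).trans <| by
    refine .trans ?_ (semMap_eqToHom_comp_eqToHom _ _ _).symm
    refine .trans ?_ (eqToHom_self_comp_self _ _ _).symm
    exact (((semHom C).map_τ (Syn.mk (.ground X)) (Syn.mk (.ground Y))).trans
      (eqToHom_self_comp_self _ _ _)).symm

variable (C) in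
/-- Every class of types is the class of its interpretation. -/
noncomputable def semNamesIso : sem C ⋙ names C ≅ 𝟭 (Syn (L C)) :=
  NatIso.ofComponents (fun a => eqToIso (mk_ground_semObj a)) fun {a b} φ =>
    -- Naturality is checked after interpretation, where both components become identities.
    semMap_injective <| by
      refine (semMap_comp_eqToHom ((names C).map (semMap φ)) (mk_ground_semObj b)).trans ?_
      refine .trans ?_ (semMap_eqToHom_comp (mk_ground_semObj a) φ).symm
      refine .trans ?_ (eqToHom_self_comp _ _).symm
      exact (comp_eqToHom_self _ _).trans (semMap_names _)

variable (C) in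
/-- Objects and morphisms are the interpretations of their names. -/
noncomputable def namesSemIso : 𝟭 C.Obj ≅ names C ⋙ sem C :=
  NatIso.ofComponents (fun X => Iso.refl X) fun f =>
    (Category.comp_id f).trans ((semMap_names f).symm.trans (Category.id_comp _).symm)

end Internal

/-! ### Translations given on ground types and constants -/

/-- Substitution of types for the ground types. -/
def Ty.transl {G : Type u} {G' : Type u₁} (t : G → Ty G') : Ty G → Ty G'
  | .ground g => t g
  | .one => .one
  | .arr A B => .arr (A.transl t) (B.transl t)
  | .prod A B => .prod (A.transl t) (B.transl t)
  | .mon e A => .mon e (A.transl t)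

/-- Replacement of the ground types by types and of the constants by terms. -/
def Tm.transl {G : Type u} {K : Type v} {G' : Type u₁} {K' : Type v₁} (t : G → Ty G')
    (c : K → Tm G' K') : Tm G K → Tm G' K'
  | .var n => .var n
  | .const x => c x
  | .star => .star
  | .lam A M => .lam (A.transl t) (M.transl t c)
  | .app A B M N => .app (A.transl t) (B.transl t) (M.transl t c) (N.transl t c)
  | .pair M N => .pair (M.transl t c) (N.transl t c)
  | .fst A B M => .fst (A.transl t) (B.transl t) (M.transl t c)
  | .snd A B M => .snd (A.transl t) (B.transl t) (M.transl t c)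
  | .ret e M => .ret e (M.transl t c)
  | .incl A M => .incl (A.transl t) (M.transl t c)
  | .bind e A B M N => .bind e (A.transl t) (B.transl t) (M.transl t c) (N.transl t c)

lemma Ty.transl_transl {G : Type u} {G' : Type u₁} {G'' : Type u₂} (t : G → Ty G')
    (t' : G' → Ty G'') (A : Ty G) :
    (A.transl t).transl t' = A.transl fun g => (t g).transl t' := by
  induction A <;> simp_all [transl]

lemma Tm.transl_transl {G : Type u} {K : Type v} {G' : Type u₁} {K' : Type v₁} {G'' : Type u₂}
    {K'' : Type v₂} (t : G → Ty G') (c : K → Tm G' K') (t' : G' → Ty G'') (c' : K' → Tm G'' K'')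
    (M : Tm G K) : (M.transl t c).transl t' c' =
      M.transl (fun g => (t g).transl t') fun x => (c x).transl t' c' := by
  induction M <;> simp_all [transl, Ty.transl_transl]

lemma Signature.HasTy.transl {sg : Signature.{u, v}} {sg' : Signature.{u₁, v₁}}
    {t : sg.Ground → sg'.Typ} {c : sg.Const → sg'.Term}
    (ht : ∀ A B : sg.Typ, sg.TyEq A B → sg'.TyEq (A.transl t) (B.transl t))
    (hc : ∀ x, sg'.HasTy [] (c x) ((sg.constTy x).transl t)) {Γ M A} (h : sg.HasTy Γ M A) :
    sg'.HasTy (Γ.map (Ty.transl t)) (M.transl t c) (A.transl t) := by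
  induction h with
  | var h => exact .var (by simp [h])
  | const x => exact (hc x).of_nil _
  | star => exact .star
  | lam _ ih => exact .lam ih
  | app _ _ ih₁ ih₂ => exact .app ih₁ ih₂
  | pair _ _ ih₁ ih₂ => exact .pair ih₁ ih₂
  | fst _ ih => exact .fst ih
  | snd _ ih => exact .snd ih
  | ret _ ih => exact .ret ih
  | incl _ ih => exact .incl ih
  | bind _ _ ih₁ ih₂ => exact .bind ih₁ ih₂
  | conv _ e ih => exact .conv ih (ht _ _ e)

/-- The translation given by its values on ground types and constants. -/
def Translation.ofGenerators {Th : Theory.{u, v}} {Th' : Theory.{u₁, v₁}}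
    (t : Th.Ground → Th'.Typ) (c : Th.Const → Th'.Term)
    (ht : ∀ A B : Th.Typ, Th.TyEq A B → Th'.TyEq (A.transl t) (B.transl t))
    (hc : ∀ x, Th'.HasTy [] (c x) ((Th.constTy x).transl t))
    (h : ∀ {Γ M N A}, Th.TmEq Γ M N A →
      Th'.TmEq (Γ.map (Ty.transl t)) (M.transl t c) (N.transl t c) (A.transl t)) :
    Translation Th Th' where
  ty := Ty.transl t
  tm := Tm.transl t c
  tyEq := ht _ _
  hasTy := HasTy.transl ht hc
  tmEq := h
  ty_one := rfl
  ty_arr _ _ := rfl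
  ty_prod _ _ := rfl
  ty_mon _ _ := rfl
  tm_var _ := rfl
  tm_star := rfl
  tm_lam _ _ := rfl
  tm_app _ _ _ _ := rfl
  tm_pair _ _ := rfl
  tm_fst _ _ _ := rfl
  tm_snd _ _ _ := rfl
  tm_ret _ _ := rfl
  tm_incl _ _ := rfl
  tm_bind _ _ _ _ _ := rfl

/-! ### Translations of a theory to itself that provably fix its generators -/

section

variable {Th : Theory.{u, v}} {t : Th.Ground → Th.Typ} {c : Th.Const → Th.Term}

lemma Signature.TyEq.self_transl (ht : ∀ g, Th.TyEq (.ground g) (t g)) (A : Th.Typ) :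
    Th.TyEq A (A.transl t) := by
  induction A with
  | ground g => exact ht g
  | one => exact .refl _
  | arr _ _ ih₁ ih₂ => exact .arr ih₁ ih₂
  | prod _ _ ih₁ ih₂ => exact .prod ih₁ ih₂
  | mon e _ ih => exact .mon e ih

/-- A translation of a theory to itself that fixes the ground types and the constants up to
provable equality fixes all terms up to provable equality. -/
lemma Theory.TmEq.self_transl (ht : ∀ g, Th.TyEq (.ground g) (t g))
    (hc : ∀ x, Th.TmEq [] (.const x) (c x) (Th.constTy x)) {Γ M A} (h : Th.HasTy Γ M A) :
    Th.TmEq Γ M (M.transl t c) A := by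
  have e := TyEq.self_transl ht
  induction h with
  | var h => exact .refl (.var h)
  | @const Γ x =>
    have := TmEq.subst (hc x) (Δ := Γ) (σ := .var) (by intro n A hn; simp at hn)
    rwa [Tm.subst_var, Tm.subst_var] at this
  | star => exact .refl .star
  | lam _ ih => exact .lam_eq (e _) ih
  | app _ _ ih₁ ih₂ => exact .app_eq (e _) (e _) ih₁ ih₂
  | pair _ _ ih₁ ih₂ => exact .pair_eq ih₁ ih₂
  | fst _ ih => exact .fst_eq (e _) (e _) ih
  | snd _ ih => exact .snd_eq (e _) (e _) ih
  | ret _ ih => exact .ret_eq ih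
  | incl _ ih => exact .incl_eq (e _) ih
  | bind _ _ ih₁ ih₂ => exact .bind_eq (e _) (e _) ih₁ ih₂
  | conv _ e' ih => exact .conv ih e'

lemma Signature.IsSubst.var_map {Γ : List Th.Typ} {f : Th.Typ → Th.Typ}
    (h : ∀ A, Th.TyEq A (f A)) : Th.IsSubst (Γ.map f) Γ .var :=
  IsSubst.var_of_tyEq fun n A hn => ⟨f A, by simp [hn], (h A).symm⟩

/-- A translation that is provably the identity is isomorphic to the identity. -/
lemma Translation.isomorphic_id (V : Translation Th Th) (hty : ∀ A, Th.TyEq A (V.ty A))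
    (htm : ∀ {Γ M A}, Th.HasTy Γ M A → Th.TmEq Γ M (V.tm M) A) :
    V.Isomorphic (.id Th) ∧ (Translation.id Th).Isomorphic V := by
  have h₁ : ∀ A, Th.HasTy [V.ty A] (.var 0) A := fun A => .conv (.var rfl) (hty A).symm
  have h₂ : ∀ A, Th.HasTy [A] (.var 0) (V.ty A) := fun A => .conv (.var rfl) (hty A)
  -- As `A` and `V.ty A` are equal types, the variable itself can be retyped from one to the other,
  -- in both directions.
  let α : Transformation V (.id Th) :=
    { app := fun _ => .var 0
      hasTy := h₁
      naturality := fun {A B f} hf => by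
        have := (htm hf).subst (IsSubst.var_map hty)
        rw [Tm.subst_var, Tm.subst_var] at this
        change Th.TmEq [V.ty A] (V.tm f) (f.plug (.var 0)) B
        rw [hf.plug_var]
        exact this.symm }
  let β : Transformation (.id Th) V :=
    { app := fun _ => .var 0
      hasTy := h₂
      naturality := fun {A B f} hf => by
        change Th.TmEq [A] f ((V.tm f).plug (.var 0)) (V.ty B)
        rw [(V.hasTy hf).plug_var]
        exact (htm hf).conv (hty B) }
  exact ⟨⟨α, β, fun A => .refl (.var rfl), fun A => .refl (.var rfl)⟩,
    ⟨β, α, fun A => .refl (.var rfl), fun A => .refl (.var rfl)⟩⟩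

/-! ### Contexts as products -/

/-- The product of the types of a context. -/
def ctxTy : List Th.Typ → Th.Typ
  | [] => .one
  | A :: Γ => .prod (ctxTy Γ) A

/-- The variables of a context as terms in one variable of the product type. -/
def proj : List Th.Typ → ℕ → Th.Term
  -- An arbitrary value: a well-formed term has no variable outside its context.
  | [], _ => .star
  | A :: Γ, 0 => .snd (ctxTy Γ) A (.var 0)
  | A :: Γ, n + 1 => (proj Γ n).plug (.fst (ctxTy Γ) A (.var 0))

/-- The tuple of the variables of a context. -/
def tuple : List Th.Typ → Th.Term
  | [] => .star
  | _ :: Γ => .pair (tuple Γ).wk (.var 0)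

lemma isSubst_proj (Γ : List Th.Typ) : Th.IsSubst [ctxTy Γ] Γ (proj Γ) := by
  induction Γ with
  | nil => intro n A hn; simp at hn
  | cons B Γ ih =>
    intro n A hn
    cases n with
    | zero =>
      obtain rfl : B = A := by simpa using hn
      exact .snd (.var rfl)
    | succ n => exact (ih n A (by simpa using hn)).plug (.fst (.var rfl))

lemma hasTy_tuple (Γ : List Th.Typ) : Th.HasTy Γ (tuple Γ) (ctxTy Γ) := by
  induction Γ with
  | nil => exact .star
  | cons B Γ ih => exact .pair (ih.wk B) (.var rfl)

lemma plug_var_one {A B : Th.Typ} {M} (h : Th.HasTy [A] M B) : M.plug (.var 1) = M.wk := by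
  rw [Tm.wk, Tm.ren_eq_subst]
  exact h.subst_congr (by intro n hn; obtain rfl : n = 0 := by simpa using hn
                          rfl)

lemma proj_plug_tuple {Γ : List Th.Typ} {n A} (h : Γ[n]? = some A) :
    Th.TmEq Γ ((proj Γ n).plug (tuple Γ)) (.var n) A := by
  induction Γ generalizing n with
  | nil => simp at h
  | cons B Γ ih =>
    have hT := (hasTy_tuple Γ).wk B
    have h₀ : Th.HasTy (B :: Γ) (.var 0) B := .var rfl
    cases n with
    | zero =>
      obtain rfl : B = A := by simpa using h
      exact .snd_beta hT h₀
    | succ n =>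
      have h' : Γ[n]? = some A := by simpa using h
      have e₁ := TmEq.plug (isSubst_proj Γ n A h') (.fst (.pair hT h₀)) hT (.fst_beta hT h₀)
      have e₂ := (ih h').wk B
      simp only [proj, tuple, Tm.plug, Tm.wk, Tm.subst_subst, Tm.subst, Tm.subst_ren,
        Tm.ren] at e₁ e₂ ⊢
      exact e₁.trans e₂

/-- Needed at binders. The semantics replaces the variable of the extended product by a pair of
context and bound variable, while the syntax lifts the projections under the binder; the two agree
by β for pairs. -/
lemma proj_plug_pair {Γ : List Th.Typ} {B n A} (h : (B :: Γ)[n]? = some A) :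
    Th.TmEq [B, ctxTy Γ] ((proj (B :: Γ) n).plug (.pair (.var 1) (.var 0)))
      (Tm.up (proj Γ) n) A := by
  have h₁ : Th.HasTy [B, ctxTy Γ] (.var 1) (ctxTy Γ) := .var rfl
  have h₀ : Th.HasTy [B, ctxTy Γ] (.var 0) B := .var rfl
  cases n with
  | zero =>
    obtain rfl : B = A := by simpa using h
    exact .snd_beta h₁ h₀
  | succ n =>
    have hp := isSubst_proj Γ n A (by simpa using h)
    have e₁ := TmEq.plug hp (.fst (.pair h₁ h₀)) h₁ (.fst_beta h₁ h₀)
    rw [plug_var_one hp] at e₁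
    simp only [proj, Tm.plug, Tm.subst_subst, Tm.subst] at e₁ ⊢
    exact e₁

lemma subst_proj_plug_pair {Γ : List Th.Typ} {A B M} (h : Th.HasTy (B :: Γ) M A) :
    Th.TmEq [B, ctxTy Γ] ((M.subst (proj (B :: Γ))).plug (.pair (.var 1) (.var 0)))
      (M.subst (Tm.up (proj Γ))) A := by
  rw [Tm.plug, Tm.subst_subst]
  exact TmEq.subst_congr h fun n A hn => proj_plug_pair hn

/-- Terms are provably equal if they are so over the product of the context. -/
lemma tmEq_of_subst_proj {Γ : List Th.Typ} {M N A} (hM : Th.HasTy Γ M A) (hN : Th.HasTy Γ N A)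
    (h : Th.TmEq [ctxTy Γ] (M.subst (proj Γ)) (N.subst (proj Γ)) A) : Th.TmEq Γ M N A := by
  have key : ∀ {M}, Th.HasTy Γ M A → Th.TmEq Γ ((M.subst (proj Γ)).plug (tuple Γ)) M A := by
    intro M hM
    -- The term is written as its own identity substitution, so that it can be compared variable by
    -- variable with projecting from the tuple.
    conv in (occs := 2) M => rw [← M.subst_var]
    rw [Tm.plug, Tm.subst_subst]
    exact TmEq.subst_congr hM fun n A hn => proj_plug_tuple hn
  exact (key hM).symm.trans ((h.subst (isSubst_plug (hasTy_tuple Γ))).trans (key hN))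

end

/-! ### The interpretation of the internal language of the syntactic model -/

namespace Syn

variable {Th : Theory.{u, v}}

/-- Interpretations of types are equal to classes of types only propositionally. The `_eq_of` lemmas
therefore take the objects as variables with equations, and accept any proof of typing. -/
lemma p₁_eq_of {a b : Syn Th} {A B} (hA : a = mk A) (hB : b = mk B) {h} :
    p₁ a b = of (.fst A B (.var 0)) h := by
  subst hA hB; exact p₁_mk A B

lemma p₂_eq_of {a b : Syn Th} {A B} (hA : a = mk A) (hB : b = mk B) {h} :
    p₂ a b = of (.snd A B (.var 0)) h := by
  subst hA hB; exact p₂_mk A B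

lemma ev_eq_of {a b : Syn Th} {A B} (hA : a = mk A) (hB : b = mk B) {h} :
    ev a b = of (.app A B (.snd A (A.arr B) (.var 0)) (.fst A (A.arr B) (.var 0))) h := by
  subst hA hB; exact ev_mk A B

lemma inclusion_eq_of {a : Syn Th} {A} (hA : a = mk A) {h} :
    inclusion a = of (.incl A (.var 0)) h := by
  subst hA; exact inclusion_mk A

lemma swapHom_eq_of {a b : Syn Th} {A B} (hA : a = mk A) (hB : b = mk B) {h} :
    swapHom a b = of (.pair (.snd A B (.var 0)) (.fst A B (.var 0))) h := by
  subst hA hB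
  rw [swapHom, lift_eq, fst_eq, snd_eq, p₁_mk, p₂_mk]
  rfl

/-- The swap in the interpretation of an abstraction undoes the order of the pair in the syntactic
transpose: under the binder, variable `1` is the context and variable `0` the argument. -/
lemma curry_swapHom_of {a b d : Syn Th} {A B D} (hA : a = mk A) (hB : b = mk B) (hD : d = mk D)
    {f} (hf : Typed (prod b a) d f) {h} :
    curry (swapHom a b ≫ of f hf) = of (.lam A (f.plug (.pair (.var 1) (.var 0)))) h := by
  subst hA hB hD
  have hf' : Th.HasTy [B.prod A] f D := hf.hasTy rfl rfl []
  have hs : Th.HasTy [A.prod B] (.pair (.snd A B (.var 0)) (.fst A B (.var 0))) (B.prod A) :=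
    .pair (.snd (.var rfl)) (.fst (.var rfl))
  rw [swapHom_eq_of (h := ⟨_, _, rfl, rfl, hs⟩) rfl rfl]
  refine (curry_mk (hf'.plug hs)).trans (of_eq (A := B) (B := A.arr D) rfl rfl ?_)
  have h₁ : Th.HasTy [A, B] (.var 1) B := .var rfl
  have h₀ : Th.HasTy [A, B] (.var 0) A := .var rfl
  have e := TmEq.plug hf' (.pair (.snd (.pair h₀ h₁)) (.fst (.pair h₀ h₁))) (.pair h₁ h₀)
    (.pair_eq (.snd_beta h₀ h₁) (.fst_beta h₀ h₁))
  rw [Tm.plug, Tm.plug, Tm.subst_subst]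
  exact .lam_eq (.refl _) e

lemma bind_eq_of (e : Eff) {a b d : Syn Th} {A B D} (hA : a = mk A) (hB : b = mk B)
    (hD : d = mk D) {m n} (hm : Typed d (mon e a) m) (hn : Typed (prod d a) (mon e b) n) {h} :
    bind e (of m hm) (of n hn) = of (.bind e A B m (n.plug (.pair (.var 1) (.var 0)))) h := by
  subst hA hB hD
  exact bind_mk e (hm.hasTy rfl rfl []) (hn.hasTy rfl rfl [])

/-- Computes the interpretation of a constant of the internal language: after β for the pair with
the dummy argument from `1`, a closed abstraction remains. -/
lemma curry_fst_of {a b : Syn Th} {f} (hf : Typed a b f) {h} :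
    MonoidalClosed.curry (fst a (𝟙_ (Syn Th)) ≫ of f hf) = of (.lam a.rep f) h := by
  have hf' := hf.hasTy (mk_rep a) (mk_rep b) []
  have hp : Th.HasTy [a.rep.prod .one] (.fst a.rep .one (.var 0)) a.rep := .fst (.var rfl)
  have hp' : Typed (prod a one) a (.fst a.rep .one (.var 0)) :=
    ⟨_, _, mk_prod (mk_rep a) rfl, mk_rep a, hp⟩
  have e₁ : fst a (𝟙_ (Syn Th)) = of _ hp' := p₁_eq_of (b := one) (mk_rep a).symm rfl
  rw [e₁]
  refine (closed_curry_eq _).trans (of_eq (A := .one) (B := a.rep.arr b.rep) rfl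
    (mk_arr_rep a b) ?_)
  have h₁ : Th.HasTy [a.rep, .one] (.var 1) .one := .var rfl
  have h₀ : Th.HasTy [a.rep, .one] (.var 0) a.rep := .var rfl
  have e := TmEq.plug hf' (.fst (.pair h₀ h₁)) h₀ (.fst_beta h₀ h₁)
  rw [hf'.plug_var] at e
  simp only [Tm.plug, Tm.subst_subst] at e ⊢
  exact .lam_eq (.refl _) e

end Syn

/-! ### The translation from the internal language of the syntactic model back to the theory -/

namespace Reflect

variable {Th : Theory.{u, v}}

/-- A representative of the class of a type of `L(S(Th))`. -/
noncomputable abbrev ty (A : (L (S Th)).Typ) : Th.Typ := A.transl Syn.rep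

/-- The constant of a morphism is the abstraction of a representative. -/
noncomputable def const (c : (L (S Th)).Const) : Th.Term :=
  .lam c.1.rep (Syn.exists_of c.2.2).choose

/-- The term of `Th` that is represented by a term of `L(S(Th))`. -/
noncomputable abbrev tm (M : (L (S Th)).Term) : Th.Term := M.transl Syn.rep const

lemma tyDen_eq (A : (L (S Th)).Typ) : tyDen (S Th) id A = Syn.mk (ty A) := by
  induction A with
  | ground a => exact (Syn.mk_rep a).symm
  | one => rfl
  | arr A B ih₁ ih₂ => exact congrArg₂ Syn.arr ih₁ ih₂
  | prod A B ih₁ ih₂ => exact congrArg₂ Syn.prod ih₁ ih₂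
  | mon e A ih =>
    cases e
    · exact congrArg (Syn.mon .S) ih
    · exact congrArg (Syn.mon .T) ih

lemma ctxDen_eq (Γ : List (L (S Th)).Typ) :
    ctxDen (S Th) id Γ = Syn.mk (ctxTy (Γ.map ty)) := by
  induction Γ with
  | nil => rfl
  | cons A Γ ih => exact congrArg₂ Syn.prod ih (tyDen_eq A)

lemma tyEq_ty {A B : (L (S Th)).Typ} (h : (L (S Th)).TyEq A B) : Th.TyEq (ty A) (ty B) := by
  have := (Internal.tyEq_iff (S Th)).1 h
  rw [tyDen_eq, tyDen_eq] at this
  exact Syn.mk_eq.1 this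

lemma hasTy_rep (c : (L (S Th)).Const) :
    Th.HasTy [c.1.rep] (Syn.exists_of c.2.2).choose c.2.1.rep :=
  (Syn.exists_of c.2.2).choose_spec.choose.hasTy (Syn.mk_rep _) (Syn.mk_rep _) []

lemma hasTy_const (c : (L (S Th)).Const) :
    Th.HasTy [] (const c) (ty ((L (S Th)).constTy c)) :=
  .lam (hasTy_rep c)

lemma hasTy_tm {Γ M A} (h : (L (S Th)).HasTy Γ M A) : Th.HasTy (Γ.map ty) (tm M) (ty A) :=
  h.transl (fun _ _ => tyEq_ty) hasTy_const

lemma typed_tm {Γ M A} (h : (L (S Th)).HasTy Γ M A) :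
    Syn.Typed (ctxDen (S Th) id Γ) (tyDen (S Th) id A) ((tm M).subst (proj (Γ.map ty))) :=
  ⟨_, _, (ctxDen_eq Γ).symm, (tyDen_eq A).symm, (hasTy_tm h).subst (isSubst_proj _)⟩

lemma internalConst_eq (c : (L (S Th)).Const) {h} :
    internalConst (S Th) c = Syn.of (const c) h := by
  have hφ := (Syn.exists_of c.2.2).choose_spec.choose_spec
  exact (congrArg (fun φ => MonoidalClosed.curry (fst c.1 (𝟙_ (S Th).Obj) ≫ φ)) hφ).trans
    (Syn.curry_fst_of _)

/-- The interpretation of a term of `L(S(Th))` is the class of the term that it represents. -/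
theorem den_eq {Γ M A f} (h : Den (S Th) id (internalConst (S Th)) Γ M A f) :
    f = Syn.of ((tm M).subst (proj (Γ.map ty))) (typed_tm h.hasTy) := by
  induction h with
  | var_zero => exact Syn.p₂_eq_of (ctxDen_eq _) (tyDen_eq _)
  | @var_succ Γ A B n f h ih =>
    exact congrArg₂ (· ≫ ·) (Syn.p₁_eq_of (ctxDen_eq _) (tyDen_eq _)
      (h := ⟨_, _, (ctxDen_eq (B :: Γ)).symm, (ctxDen_eq Γ).symm, .fst (.var rfl)⟩)) ih
  | @const Γ c =>
    have hs : Syn.Typed (ctxDen (S Th) id Γ) Syn.one .star :=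
      ⟨_, _, (ctxDen_eq Γ).symm, rfl, .star⟩
    have hc : Syn.Typed (Th := Th) Syn.one _ (const c) :=
      ⟨_, _, rfl, (tyDen_eq _).symm, (hasTy_const c).of_nil [.one]⟩
    refine (congrArg₂ (· ≫ ·) (Syn.hom_one_ext _ (Syn.of _ hs)) (internalConst_eq c (h := hc))).trans
      (Syn.of_comp_of hs hc |>.trans ?_)
    congr 1
    -- The translated constant is closed, so neither substitution changes it.
    exact ((hasTy_const c).subst_of_nil _).trans ((hasTy_const c).subst_of_nil _).symm
  | star => exact Syn.hom_one_ext _ _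
  | @lam Γ A B M f h ih =>
    refine (congrArg (fun f => MonoidalClosed.curry (swapHom _ _ ≫ f)) ih).trans ?_
    refine (Syn.closed_curry_eq _).trans ?_
    refine (Syn.curry_swapHom_of (tyDen_eq A) (ctxDen_eq Γ) (tyDen_eq B) (typed_tm h.hasTy)
      (h := ⟨_, _, (ctxDen_eq Γ).symm, (tyDen_eq (A.arr B)).symm,
        .lam (subst_proj_plug_pair (hasTy_tm h.hasTy)).hasTy.1⟩)).trans
      (Syn.of_eq (ctxDen_eq Γ).symm (tyDen_eq (A.arr B)).symm ?_)
    -- The semantic and the syntactic treatment of the bound variable are reconciled.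
    exact .lam_eq (.refl _) (subst_proj_plug_pair (hasTy_tm h.hasTy))
  | @app Γ A B M N f h hM hN ih₁ ih₂ =>
    have h₁ := (hasTy_tm hM.hasTy).subst (isSubst_proj _)
    have h₂ := (hasTy_tm hN.hasTy).subst (isSubst_proj _)
    refine (congrArg₂ (· ≫ ·) ((congrArg₂ lift ih₂ ih₁).trans (Syn.lift_eq _ _))
      ((Syn.ihom_ev_app _ _).trans (Syn.ev_eq_of (tyDen_eq A) (tyDen_eq B)
        (h := ⟨_, _, (congrArg₂ Syn.prod (tyDen_eq A) (tyDen_eq (A.arr B))).symm,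
          (tyDen_eq B).symm, .app (.snd (.var rfl)) (.fst (.var rfl))⟩)))).trans ?_
    exact Syn.of_eq (ctxDen_eq Γ).symm (tyDen_eq B).symm
      (.app_eq (.refl _) (.refl _) (.snd_beta h₂ h₁) (.fst_beta h₂ h₁))
  | pair _ _ ih₁ ih₂ => exact (congrArg₂ lift ih₁ ih₂).trans (Syn.lift_eq _ _)
  | @fst Γ A B M f h ih =>
    exact congrArg₂ (· ≫ ·) ih (Syn.p₁_eq_of (tyDen_eq A) (tyDen_eq B)
      (h := ⟨_, _, (tyDen_eq (A.prod B)).symm, (tyDen_eq A).symm, .fst (.var rfl)⟩))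
  | @snd Γ A B M f h ih =>
    exact congrArg₂ (· ≫ ·) ih (Syn.p₂_eq_of (tyDen_eq A) (tyDen_eq B)
      (h := ⟨_, _, (tyDen_eq (A.prod B)).symm, (tyDen_eq B).symm, .snd (.var rfl)⟩))
  | @ret Γ e A M f h ih =>
    cases e
    · exact congrArg (· ≫ Syn.unit .S _) ih
    · exact congrArg (· ≫ Syn.unit .T _) ih
  | @incl Γ A M f h ih =>
    exact congrArg₂ (· ≫ ·) ih (Syn.inclusion_eq_of (tyDen_eq A)
      (h := ⟨_, _, (tyDen_eq (A.mon .S)).symm, (tyDen_eq (A.mon .T)).symm, .incl (.var rfl)⟩))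
  | @bind Γ e A B M N f h hM hN ih₁ ih₂ =>
    have h₁ := (hasTy_tm hM.hasTy).subst (isSubst_proj _)
    have h₂ := subst_proj_plug_pair (hasTy_tm hN.hasTy)
    -- `Model.monad` reduces to a syntactic monad only once `e` is a constructor.
    cases e
    all_goals
      exact (congrArg₂ (Syn.strongMonad Th _).bind ih₁ ih₂).trans
        ((Syn.bind_strongMonad _ _ _).trans ((Syn.bind_eq_of _ (tyDen_eq A) (tyDen_eq B)
          (ctxDen_eq Γ) (typed_tm hM.hasTy) (typed_tm hN.hasTy)
          (h := ⟨_, _, (ctxDen_eq Γ).symm, (tyDen_eq (B.mon _)).symm, .bind h₁ h₂.hasTy.1⟩)).trans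
          (Syn.of_eq (ctxDen_eq Γ).symm (tyDen_eq (B.mon _)).symm
            (.bind_eq (.refl _) (.refl _) (.refl h₁) h₂))))
  | @conv Γ M A B f h he e ih =>
    -- Transport along an equality of classes of types leaves the representing term unchanged.
    exact (congrArg (· ≫ eqToHom e) ih).trans (Syn.of_comp_eqToHom _ e)

/-- No induction over the derivation: soundness gives a common interpretation in `S Th`, `den_eq`
reads it as a provable equality over the product of the context, and substituting the tuple of
variables returns to the context itself. -/
lemma tmEq_tm {Γ M N A} (h : (L (S Th)).TmEq Γ M N A) :
    Th.TmEq (Γ.map ty) (tm M) (tm N) (ty A) := by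
  obtain ⟨f, hM, hN⟩ := Internal.exists_den_of_tmEq h
  exact tmEq_of_subst_proj (hasTy_tm hM.hasTy) (hasTy_tm hN.hasTy)
    (Syn.tmEq_of_eq ((den_eq hM).symm.trans (den_eq hN)) (ctxDen_eq Γ).symm (tyDen_eq A).symm)

/-- The translation reflects equality: by `den_eq`, terms with provably equal translations have the
same interpretation, and this is an axiom of the internal language. -/
lemma tmEq_of_tmEq_tm {Γ M N A} (hM : (L (S Th)).HasTy Γ M A) (hN : (L (S Th)).HasTy Γ N A)
    (h : Th.TmEq (Γ.map ty) (tm M) (tm N) (ty A)) : (L (S Th)).TmEq Γ M N A := by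
  obtain ⟨f, hf⟩ := Internal.exists_den hM
  obtain ⟨f', hf'⟩ := Internal.exists_den hN
  refine Internal.tmEq_of_den hf (hf'.congr ?_)
  rw [den_eq hf, den_eq hf']
  exact Syn.of_eq (ctxDen_eq Γ).symm (tyDen_eq A).symm (h.symm.subst (isSubst_proj _))

variable (Th) in
/-- The translation of `L(S(Th))` to `Th` that chooses representatives. -/
noncomputable def translation : Translation (L (S Th)) Th :=
  .ofGenerators Syn.rep const (fun _ _ => tyEq_ty) hasTy_const tmEq_tm

end Reflect

/-! ### The translation of a theory into the internal language of its syntactic model -/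

namespace Embed

variable {Th : Theory.{u, v}}

/-- A ground type is translated to the ground type of its class. -/
def ground (g : Th.Ground) : (L (S Th)).Typ := .ground (Syn.mk (.ground g))

/-- The translation of types to `L(S(Th))`. -/
abbrev ty (A : Th.Typ) : (L (S Th)).Typ := A.transl ground

lemma typed_const (c : Th.Const) :
    Syn.Typed (Syn.mk .one) (Syn.mk (Th.constTy c)) (.const c) :=
  ⟨_, _, rfl, rfl, .const c⟩

/-- A constant is translated to the constant of its class, applied to the element of `1`. -/
noncomputable def const (c : Th.Const) : (L (S Th)).Term :=
  .app (.ground (Syn.mk .one)) (.ground (Syn.mk (Th.constTy c)))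
    (.const ⟨Syn.mk .one, Syn.mk (Th.constTy c), Syn.of _ (typed_const c)⟩) .star

/-- The translation of terms to `L(S(Th))`. -/
noncomputable abbrev tm (M : Th.Term) : (L (S Th)).Term := M.transl ground const

lemma tyDen_eq (A : Th.Typ) : tyDen (S Th) id (ty A) = Syn.mk A := by
  induction A with
  | ground g => rfl
  | one => rfl
  | arr A B ih₁ ih₂ => exact congrArg₂ Syn.arr ih₁ ih₂
  | prod A B ih₁ ih₂ => exact congrArg₂ Syn.prod ih₁ ih₂
  | mon e A ih =>
    cases e
    · exact congrArg (Syn.mon .S) ih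
    · exact congrArg (Syn.mon .T) ih

lemma tyEq_ty {A B : Th.Typ} (h : Th.TyEq A B) : (L (S Th)).TyEq (ty A) (ty B) :=
  .ax ((tyDen_eq A).trans ((Syn.mk_eq.2 h).trans (tyDen_eq B).symm))

lemma hasTy_const (c : Th.Const) : (L (S Th)).HasTy [] (const c) (ty (Th.constTy c)) := by
  refine .conv (.app (.const (sg := (L (S Th)).toSignature) _) (.conv .star (.ax rfl)))
    (.ax (tyDen_eq _).symm)

lemma hasTy_tm {Γ M A} (h : Th.HasTy Γ M A) : (L (S Th)).HasTy (Γ.map ty) (tm M) (ty A) :=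
  h.transl (fun _ _ => tyEq_ty) hasTy_const

lemma tyEq_reflect (A : Th.Typ) : Th.TyEq A (Reflect.ty (ty A)) := by
  have e : Reflect.ty (ty A) = A.transl fun g => Reflect.ty (ground g) := Ty.transl_transl _ _ _
  rw [e]
  exact TyEq.self_transl (fun g => (Syn.tyEq_rep _).symm) A

/-- Only constants need an argument. A constant goes to the abstraction of a chosen representative
of its class over `1`, applied to `*`; β and the provable equality of representatives give the
constant back. -/
lemma tmEq_reflect {Γ M A} (h : Th.HasTy Γ M A) : Th.TmEq Γ M (Reflect.tm (tm M)) A := by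
  have e : Reflect.tm (tm M) = M.transl (fun g => Reflect.ty (ground g))
      fun c => Reflect.tm (const c) := Tm.transl_transl _ _ _ _ _
  rw [e]
  refine TmEq.self_transl (fun g => (Syn.tyEq_rep _).symm) (fun c => ?_) h
  let φ : Syn.mk (Th := Th) .one ⟶ Syn.mk (Th.constTy c) := Syn.of _ (typed_const c)
  obtain ⟨hf, e⟩ := (Syn.exists_of φ).choose_spec
  have h₁ : Th.TyEq (Syn.mk (Th := Th) .one).rep .one := Syn.tyEq_rep _
  have h₂ := Syn.tyEq_rep (Th.constTy c)
  have e₁ := Syn.tmEq_of_eq e rfl rfl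
  -- The constant is closed, so putting `*` for the variable of type `1` alters only the chosen
  -- representative.
  have e₂ := (e₁.subst (isSubst_plug (Γ := []) .star)).conv h₂.symm
  have hs : Th.HasTy [] .star (Syn.mk (Th := Th) .one).rep := .conv .star h₁.symm
  have e₃ := TmEq.lam_beta (hf.hasTy (Syn.mk_rep _) (Syn.mk_rep _) []) hs
  refine (TmEq.trans e₂ ?_).conv h₂
  refine TmEq.trans ?_ e₃.symm
  -- `plug` and `inst` differ only on variables that a term in one variable does not contain.
  rw [(hf.hasTy rfl rfl []).subst_congr (σ := fun _ => .star) (τ := Tm.substOne .star)]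
  · exact TmEq.refl (e₃.hasTy.2)
  · intro n hn
    obtain rfl : n = 0 := by simpa using hn
    rfl

lemma isSubst_reflect (Γ : List Th.Typ) :
    Th.IsSubst ((Γ.map ty).map Reflect.ty) Γ .var := by
  rw [List.map_map]
  exact IsSubst.var_map tyEq_reflect

/-- Going to the internal language and back is provably the identity, so the hypothesis is an
equality of back-translations, and the back-translation reflects equality. -/
lemma tmEq_tm {Γ M N A} (h : Th.TmEq Γ M N A) :
    (L (S Th)).TmEq (Γ.map ty) (tm M) (tm N) (ty A) := by
  have := (((tmEq_reflect h.hasTy.1).symm.trans (h.trans (tmEq_reflect h.hasTy.2))).subst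
    (isSubst_reflect Γ)).conv (tyEq_reflect A)
  rw [Tm.subst_var, Tm.subst_var] at this
  exact Reflect.tmEq_of_tmEq_tm (hasTy_tm h.hasTy.1) (hasTy_tm h.hasTy.2) this

variable (Th) in
/-- The translation of `Th` to `L(S(Th))`. -/
noncomputable def translation : Translation Th (L (S Th)) :=
  .ofGenerators ground const (fun _ _ => tyEq_ty) hasTy_const tmEq_tm

lemma reflect_comp_isomorphic :
    (Translation.id Th).Isomorphic ((Reflect.translation Th).comp (translation Th)) :=
  (Translation.isomorphic_id ((Reflect.translation Th).comp (translation Th)) tyEq_reflect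
    tmEq_reflect).2

lemma tyEq_embed (A : (L (S Th)).Typ) : (L (S Th)).TyEq A (ty (Reflect.ty A)) :=
  .ax ((Reflect.tyDen_eq A).trans (tyDen_eq _).symm)

/-- For constants, both sides have provably equal images in `Th` by `tmEq_reflect`, and equality of
images suffices. -/
lemma tmEq_embed {Γ M A} (h : (L (S Th)).HasTy Γ M A) :
    (L (S Th)).TmEq Γ M (tm (Reflect.tm M)) A := by
  have e : tm (Reflect.tm M) = M.transl (fun a => ty (Syn.rep a)) fun c => tm (Reflect.const c) :=
    Tm.transl_transl _ _ _ _ _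
  rw [e]
  refine TmEq.self_transl (fun g => tyEq_embed (.ground g)) (fun c => ?_) h
  refine Reflect.tmEq_of_tmEq_tm (.const c)
    (.conv (hasTy_tm (Reflect.hasTy_const c)) (tyEq_embed _).symm) ?_
  exact tmEq_reflect (Reflect.hasTy_const c)

lemma comp_reflect_isomorphic :
    ((translation Th).comp (Reflect.translation Th)).Isomorphic (.id (L (S Th))) :=
  (Translation.isomorphic_id ((translation Th).comp (Reflect.translation Th)) tyEq_embed
    tmEq_embed).1

end Embed

end CSC

theorem mainTheorem3 :
    (∀ C : CSC.Model.{u, v},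
      ∃ (F : CSC.ModelHom C (CSC.S (CSC.L C))) (G : CSC.ModelHom (CSC.S (CSC.L C)) C),
        Nonempty (G.toFunctor ⋙ F.toFunctor ≅ 𝟭 (CSC.S (CSC.L C)).Obj) ∧
        Nonempty (𝟭 C.Obj ≅ F.toFunctor ⋙ G.toFunctor)) ∧
    (∀ Th : CSC.Theory.{u, v},
      ∃ (V : CSC.Translation Th (CSC.L (CSC.S Th))) (W : CSC.Translation (CSC.L (CSC.S Th)) Th),
        (V.comp W).Isomorphic (CSC.Translation.id (CSC.L (CSC.S Th))) ∧
        (CSC.Translation.id Th).Isomorphic (W.comp V)) :=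
  ⟨fun C => ⟨CSC.Internal.namesHom C, CSC.Internal.semHom C, ⟨CSC.Internal.semNamesIso C⟩,
      ⟨CSC.Internal.namesSemIso C⟩⟩,
    fun Th => ⟨CSC.Embed.translation Th, CSC.Reflect.translation Th,
      CSC.Embed.comp_reflect_isomorphic, CSC.Embed.reflect_comp_isomorphic⟩⟩
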